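/- All monoids are commutative and written additively. For a monoid $P$, a $P$-module is a set $M$ with an action of $P$; it is free if there is a subset $S\subseteq M$ such that every element of $M$ is $p+s$ for a unique pair $(p,s)\in P\times S$, and flat if it is a filtered colimit of free modules. A monoid homomorphism $h:Q\to P$ is flat if $P$ is a flat $Q$-module via $h$. A face of $P$ is a submonoid $F$ such that $a+b\in F$ implies $a,b\in F$. $\operatorname{Spec}P$ is the set of faces of $P$ with the topology generated by the sets $U_p=\{F : p\in F\}$ and with the usual structure sheaf of monoids $\mathcal M_P$, whose stalk at $F$ is the localization $F^{-1}P$. A morphism $f:X\to Y$ of spaces with sheaves of monoids $\mathcal M_X,\mathcal M_Y$ is a continuous map with a map of sheaves of monoids $\mathcal M_Y\to f_*\mathcal M_X$ whose stalk maps $f_x:\mathcal M_{Y,f(x)}\to\mathcal M_{X,x}$ are local (only units are mapped to units). A locally finite type fan is a space with a sheaf of monoids that is covered by open subspaces isomorphic to $\operatorname{Spec}P$ with $P$ finitely generated. A morphism $f$ is a flat cover if it is surjective and all $f_x$ are flat; $h:Q\to P$ is faithfully flat if $\operatorname{Spec}h:\operatorname{Spec}P\to\operatorname{Spec}Q$ is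 a flat cover. An $\mathcal M_X$-module is a sheaf of sets on $X$ with an action of $\mathcal M_X$, and $f^*$ denotes the pullback of modules, with stalks $(f^*F)_x=\mathcal M_{X,x}\otimes_{\mathcal M_{Y,f(x)}}F_{f(x)}$. A $P$-module $M$ defines the $\mathcal M_P$-module $M^\sim=\underline M\otimes_{\underline P}\mathcal M_P$ on $\operatorname{Spec}P$. A module on a fan is quasi-coherent if it is locally, on affine open subspaces $\operatorname{Spec}P$, isomorphic to some $M^\sim$. $\mathrm{Qco}(X)$ is the category of quasi-coherent $\mathcal M_X$-modules. For $h:Q\to P$, let $\mathrm{Mod}(Q\to P)$ be the category of pairs $(N,\phi)$ of a $P$-module $N$ and an isomorphism $\phi:\pi_1^*N\to\pi_2^*N$ of $(P\oplus_QP)$-modules, where $\pi_1^*,\pi_2^*$ are extension of scalars along the two maps $P\rightrightarrows P\oplus_QP$, such that the cocycle condition $\pi_{23}^*\phi\circ\pi_{12}^*\phi=\pi_{13}^*\phi$ holds over $P\oplus_QP\oplus_QP$. Let $\phi_{\rm taut}$ be the canonical isomorphism $\pi_1^*(M\otimes_QP)\cong\pi_2^*(M\otimes_QP)$ for a $Q$-module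 $M$. For $(N,\phi)\in\mathrm{Mod}(Q\to P)$ let $G(N,\phi)$ be the $Q$-module that is the equalizer of the natural map $N\to\pi_2^*N$ and the composite of the natural map $N\to\pi_1^*N$ with $\phi$. **Theorem.** (1) If $h:Q\to P$ is a faithfully flat homomorphism of monoids, then the functor $\mathrm{Mod}(Q)\to\mathrm{Mod}(Q\to P)$, $M\mapsto(M\otimes_QP,\phi_{\rm taut})$, is an equivalence of categories with inverse $G$. (2) Let $f:X\to Y$ be a flat cover of locally finite type fans. Then $f^*$ maps quasi-coherent $\mathcal M_Y$-modules to quasi-coherent $\mathcal M_X$-modules, and $M\mapsto f^*M$ with its canonical descent datum is an equivalence of categories from $\mathrm{Qco}(Y)$ to the category $\mathrm{Qco}(X\to Y)$ of quasi-coherent $\mathcal M_X$-modules $N$ with a descent datum relative to $f$. Here a descent datum is an isomorphism $\pi_1^*N\cong\pi_2^*N$ on $X\times_YX$ that satisfies the cocycle condition on $X\times_YX\times_YX$; equivalently, it is a family of isomorphisms $p_1^*N\cong p_2^*N$, for all $p_1,p_2:T\to X$ with $fp_1=fp_2$, that is compatible with base change in $T$ and satisfies the cocycle condition for all triples $p_1,p_2,p_3$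 (and the equivalence holds with either description). -/

import Mathlib

open CategoryTheory Opposite TopologicalSpace AlgebraicGeometry

universe u

noncomputable section

namespace MonoidFan

/-- A module over a commutative monoid `P` (written multiplicatively): a set with an action
of `P`. -/
structure PMod (P : Type u) [CommMonoid P] where
  carrier : Type u
  [action : MulAction P carrier]

namespace PMod

instance (P : Type u) [CommMonoid P] : CoeSort (PMod P) (Type u) := ⟨carrier⟩

attribute [instance] action

variable {P Q R S : Type u} [CommMonoid P] [CommMonoid Q] [CommMonoid R] [CommMonoid S]

/-- Morphisms of modules are equivariant maps. -/
instance : Category (PMod P) where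
  Hom M N := M →[P] N
  id M := MulActionHom.id P
  comp f g := MulActionHom.comp g f

instance (M N : PMod P) : FunLike (M ⟶ N) M N := inferInstanceAs (FunLike (M →[P] N) M N)

@[ext]
lemma hom_ext {M N : PMod P} {f g : M ⟶ N} (h : ∀ m, f m = g m) : f = g := MulActionHom.ext h

@[simp] lemma id_apply {M : PMod P} (m : M) : (𝟙 M : M ⟶ M) m = m := rfl

@[simp] lemma comp_apply {M N L : PMod P} (f : M ⟶ N) (g : N ⟶ L) (m : M) :
    (f ≫ g) m = g (f m) := rfl

@[simp] lemma hom_smul {M N : PMod P} (f : M ⟶ N) (p : P) (m : M) : f (p • m) = p • f m :=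
  MulActionHom.map_smul f p m

/-- The morphism of modules given by an equivariant map. -/
def homMk {M N : PMod P} (f : M → N) (hf : ∀ (p : P) (m : M), f (p • m) = p • f m) : M ⟶ N :=
  ({ toFun := f, map_smul' := hf } : M →[P] N)

@[simp] lemma homMk_apply {M N : PMod P} (f : M → N) (hf) (m : M) : homMk f hf m = f m := rfl

end PMod

/-- The relation `(p * h q, m) ~ (p, q • m)` on `P × M`. -/
inductive TensorRel {P Q : Type u} [CommMonoid P] [CommMonoid Q] (h : Q →* P) (M : Type u)
    [MulAction Q M] : P × M → P × M → Prop
  | intro (p : P) (q : Q) (m : M) : TensorRel h M (p * h q, m) (p, q • m)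

/-- The tensor product `P ⊗_Q M` along `h : Q →* P`: the quotient of `P × M` by the equivalence
relation generated by `(p * h q, m) ~ (p, q • m)`. -/
def Tensor {P Q : Type u} [CommMonoid P] [CommMonoid Q] (h : Q →* P) (M : Type u)
    [MulAction Q M] : Type u :=
  Quot (TensorRel h M)

namespace Tensor
variable {P Q : Type u} [CommMonoid P] [CommMonoid Q] {h : Q →* P} {M N : Type u}
    [MulAction Q M] [MulAction Q N]

variable (h) in
/-- The element `p ⊗ m`. -/
def mk (p : P) (m : M) : Tensor h M := Quot.mk _ (p, m)

lemma mk_mul (p : P) (q : Q) (m : M) : mk h (p * h q) m = mk h p (q • m) :=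
  Quot.sound ⟨p, q, m⟩

lemma ind {motive : Tensor h M → Prop} (H : ∀ p m, motive (mk h p m)) (t) : motive t :=
  Quot.ind (fun a => H a.1 a.2) t

/-- The map out of the tensor product given by a balanced map. -/
def lift {A : Type*} (f : P → M → A) (hf : ∀ p q m, f (p * h q) m = f p (q • m)) :
    Tensor h M → A :=
  Quot.lift (fun a => f a.1 a.2) (by rintro _ _ ⟨p, q, m⟩; exact hf p q m)

@[simp] lemma lift_mk {A : Type*} (f : P → M → A) (hf) (p : P) (m : M) :
    lift (h := h) f hf (mk h p m) = f p m := rfl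

/-- `P` acts on `P ⊗_Q M` through the left factor. -/
instance : MulAction P (Tensor h M) where
  smul p := lift (fun p' m => mk h (p * p') m) (by
    intro p' q m; rw [← mul_assoc, mk_mul])
  one_smul t := by
    induction t using ind with | H p m => exact congrArg (fun x => mk h x m) (one_mul p)
  mul_smul a b t := by
    induction t using ind with | H p m => exact congrArg (fun x => mk h x m) (mul_assoc a b p)

@[simp] lemma smul_mk (p p' : P) (m : M) : p • mk h p' m = mk h (p * p') m := rfl

end Tensor

namespace PMod
variable {P Q R S : Type u} [CommMonoid P] [CommMonoid Q] [CommMonoid R] [CommMonoid S]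

/-- Extension of scalars `M ↦ P ⊗_Q M` along `h : Q →* P`. -/
def extend (h : Q →* P) : PMod Q ⥤ PMod P where
  obj M := ⟨Tensor h M⟩
  map {M N} f := homMk (M := ⟨Tensor h M⟩) (N := ⟨Tensor h N⟩)
    (Tensor.lift (fun p m => Tensor.mk h p (f m)) (by
      intro p q m; rw [hom_smul, Tensor.mk_mul]))
    (by intro p t; induction t using Tensor.ind with | H p' m => rfl)
  map_id M := by ext t; induction t using Tensor.ind with | H p m => rfl
  map_comp f g := by ext t; induction t using Tensor.ind with | H p m => rfl

@[simp] lemma extend_map_mk (h : Q →* P) {M N : PMod Q} (f : M ⟶ N) (p : P) (m : M) :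
    (extend h).map f (Tensor.mk h p m) = Tensor.mk h p (f m) := rfl

/-- The canonical isomorphism `R ⊗_P (P ⊗_Q M) ≅ R ⊗_Q M`, `r ⊗ (p ⊗ m) ↦ (r * k p) ⊗ m`. -/
def extendComp (h : Q →* P) (k : P →* R) (l : Q →* R) (hl : k.comp h = l) (M : PMod Q) :
    (extend k).obj ((extend h).obj M) ≅ (extend l).obj M where
  hom := homMk (M := ⟨Tensor k (Tensor h M)⟩) (N := ⟨Tensor l M⟩)
    (Tensor.lift (fun r t => Tensor.lift (fun p m => Tensor.mk l (r * k p) m) (by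
        intro p q m; subst hl; rw [← Tensor.mk_mul, map_mul, ← mul_assoc]; rfl) t) (by
      intro r p t; induction t using Tensor.ind with
      | H p' m =>
        change Tensor.mk l (r * k p * k p') m = Tensor.mk l (r * k (p * p')) m
        rw [map_mul, mul_assoc]))
    (by
      intro r t
      induction t using Tensor.ind with
      | H r' t => induction t using Tensor.ind with
        | H p m => exact congrArg (fun x => Tensor.mk l x m) (mul_assoc r r' (k p)))
  inv := homMk (M := ⟨Tensor l M⟩) (N := ⟨Tensor k (Tensor h M)⟩)
    (Tensor.lift (fun r m => Tensor.mk k r (Tensor.mk h 1 m)) (by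
      intro r q m; subst hl
      rw [MonoidHom.comp_apply, Tensor.mk_mul, Tensor.smul_mk, mul_one, ← one_mul (h q),
        Tensor.mk_mul]))
    (by intro r t; induction t using Tensor.ind with | H r' m => rfl)
  hom_inv_id := by
    ext t
    induction t using Tensor.ind with
    | H r t => induction t using Tensor.ind with
      | H p m =>
        change Tensor.mk k (r * k p) (Tensor.mk h 1 m) = Tensor.mk k r (Tensor.mk h p m)
        rw [Tensor.mk_mul, Tensor.smul_mk, mul_one]
  inv_hom_id := by
    ext t
    induction t using Tensor.ind with
    | H r m =>
      change Tensor.mk l (r * k 1) m = Tensor.mk l r m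
      rw [map_one, mul_one]

@[simp] lemma extendComp_hom_mk (h : Q →* P) (k : P →* R) (l : Q →* R) (hl : k.comp h = l)
    (M : PMod Q) (r : R) (p : P) (m : M) :
    (extendComp h k l hl M).hom (Tensor.mk k r (Tensor.mk h p m)) = Tensor.mk l (r * k p) m := rfl

@[simp] lemma extendComp_inv_mk (h : Q →* P) (k : P →* R) (l : Q →* R) (hl : k.comp h = l)
    (M : PMod Q) (r : R) (m : M) :
    (extendComp h k l hl M).inv (Tensor.mk l r m) = Tensor.mk k r (Tensor.mk h 1 m) := rfl

/-- For `j : R →* S`, the map `S ⊗_{j a} M ⟶ S ⊗_{j b} N` obtained from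
`φ : R ⊗_a M ⟶ R ⊗_b N` by extension of scalars along `j`. -/
def pullHom {a b : P →* R} (j : R →* S) (a' b' : P →* S) (ha : j.comp a = a') (hb : j.comp b = b')
    {M N : PMod P} (φ : (extend a).obj M ⟶ (extend b).obj N) :
    (extend a').obj M ⟶ (extend b').obj N :=
  (extendComp a j a' ha M).inv ≫ (extend j).map φ ≫ (extendComp b j b' hb N).hom

/-- Restriction of scalars along `h : Q →* P`. -/
def restrict (h : Q →* P) (M : PMod P) : PMod Q :=
  letI := MulAction.compHom M h
  ⟨M⟩

/-- `P` as a module over itself. -/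
def self (P : Type u) [CommMonoid P] : PMod P := ⟨P⟩

/-- `M` is free: it has a basis `S`, i.e. every `m : M` is `p • s` for a unique pair `(p, s)`
with `p : P` and `s ∈ S`. -/
def IsFree (M : PMod P) : Prop :=
  ∃ S : Set M, ∀ m : M, ∃! ps : P × S, ps.1 • (ps.2 : M) = m

/-- `M` is flat: it is a filtered colimit of free modules. -/
def IsFlat (M : PMod P) : Prop :=
  ∃ (J : Type u) (_ : SmallCategory J) (_ : IsFiltered J) (D : J ⥤ PMod P) (c : Limits.Cocone D),
    Nonempty (Limits.IsColimit c) ∧ (∀ j, (D.obj j).IsFree) ∧ Nonempty (c.pt ≅ M)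

end PMod

/-- A homomorphism `h : Q →* P` is flat if it makes `P` a flat `Q`-module. -/
def IsFlatHom {P Q : Type u} [CommMonoid P] [CommMonoid Q] (h : Q →* P) : Prop :=
  (PMod.restrict h (PMod.self P)).IsFlat

section Pushout
variable {P Q R S : Type u} [CommMonoid P] [CommMonoid Q] [CommMonoid R] [CommMonoid S]

/-- The relation `(h q, 1) ~ (1, k q)` on `P × R`. -/
inductive PushoutRel (h : Q →* P) (k : Q →* R) : P × R → P × R → Prop
  | intro (q : Q) : PushoutRel h k (h q, 1) (1, k q)

/-- The pushout `P ⊕_Q R` of commutative monoids: the quotient of `P × R` by the congruence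
generated by `(h q, 1) ~ (1, k q)`. -/
def Pushout (h : Q →* P) (k : Q →* R) : Type u := (conGen (PushoutRel h k)).Quotient

instance (h : Q →* P) (k : Q →* R) : CommMonoid (Pushout h k) :=
  inferInstanceAs (CommMonoid (conGen (PushoutRel h k)).Quotient)

namespace Pushout
variable (h : Q →* P) (k : Q →* R)

/-- The map `P → P ⊕_Q R`. -/
def inl : P →* Pushout h k := (conGen (PushoutRel h k)).mk'.comp (MonoidHom.inl P R)
/-- The map `R → P ⊕_Q R`. -/
def inr : R →* Pushout h k := (conGen (PushoutRel h k)).mk'.comp (MonoidHom.inr P R)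

lemma condition : (inl h k).comp h = (inr h k).comp k :=
  MonoidHom.ext fun q => (Con.eq _).2 (ConGen.Rel.of _ _ ⟨q⟩)

variable {h k}

/-- The map out of the pushout. -/
def lift (f : P →* S) (g : R →* S) (w : f.comp h = g.comp k) : Pushout h k →* S :=
  (conGen (PushoutRel h k)).lift (f.coprod g) (Con.conGen_le.2 (by
    rintro _ _ ⟨q⟩
    have := DFunLike.congr_fun w q
    simpa [Con.ker_rel] using this))

lemma lift_comp_inl (f : P →* S) (g : R →* S) (w : f.comp h = g.comp k) :
    (lift f g w).comp (inl h k) = f := by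
  ext p; change f p * g 1 = f p; simp

lemma lift_comp_inr (f : P →* S) (g : R →* S) (w : f.comp h = g.comp k) :
    (lift f g w).comp (inr h k) = g := by
  ext p; change f 1 * g p = g p; simp

end Pushout
end Pushout

section Descent
variable {P Q : Type u} [CommMonoid P] [CommMonoid Q] (h : Q →* P)

/-- `P ⊕_Q P`. -/
abbrev Two : Type u := Pushout h h
/-- The first map `P → P ⊕_Q P` (dual to the first projection `π₁`). -/
abbrev two₁ : P →* Two h := Pushout.inl h h
/-- The second map `P → P ⊕_Q P` (dual to the second projection `π₂`). -/
abbrev two₂ : P →* Two h := Pushout.inr h h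
/-- `P ⊕_Q P ⊕_Q P`. -/
abbrev Three : Type u := Pushout ((two₁ h).comp h) h
/-- The first map `P → P ⊕_Q P ⊕_Q P`. -/
def three₁ : P →* Three h := (Pushout.inl ((two₁ h).comp h) h).comp (two₁ h)
/-- The second map `P → P ⊕_Q P ⊕_Q P`. -/
def three₂ : P →* Three h := (Pushout.inl ((two₁ h).comp h) h).comp (two₂ h)
/-- The third map `P → P ⊕_Q P ⊕_Q P`. -/
def three₃ : P →* Three h := Pushout.inr ((two₁ h).comp h) h

lemma three₁_eq_three₂ : (three₁ h).comp h = (three₂ h).comp h :=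
  congrArg (fun g => (Pushout.inl ((two₁ h).comp h) h).comp g) (Pushout.condition h h)
lemma three₁_eq_three₃ : (three₁ h).comp h = (three₃ h).comp h := by
  rw [three₁, three₃, ← Pushout.condition, MonoidHom.comp_assoc]
lemma three₂_eq_three₃ : (three₂ h).comp h = (three₃ h).comp h := by
  rw [← three₁_eq_three₂, three₁_eq_three₃]

/-- The map `P ⊕_Q P → P ⊕_Q P ⊕_Q P` into the first and second factor. -/
def three₁₂ : Two h →* Three h := Pushout.lift (three₁ h) (three₂ h) (three₁_eq_three₂ h)
/-- The map `P ⊕_Q P → P ⊕_Q P ⊕_Q P` into the first and third factor. -/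
def three₁₃ : Two h →* Three h := Pushout.lift (three₁ h) (three₃ h) (three₁_eq_three₃ h)
/-- The map `P ⊕_Q P → P ⊕_Q P ⊕_Q P` into the second and third factor. -/
def three₂₃ : Two h →* Three h := Pushout.lift (three₂ h) (three₃ h) (three₂_eq_three₃ h)

lemma three₁₂_two₁ : (three₁₂ h).comp (two₁ h) = three₁ h := Pushout.lift_comp_inl _ _ _
lemma three₁₂_two₂ : (three₁₂ h).comp (two₂ h) = three₂ h := Pushout.lift_comp_inr _ _ _
lemma three₁₃_two₁ : (three₁₃ h).comp (two₁ h) = three₁ h := Pushout.lift_comp_inl _ _ _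
lemma three₁₃_two₂ : (three₁₃ h).comp (two₂ h) = three₃ h := Pushout.lift_comp_inr _ _ _
lemma three₂₃_two₁ : (three₂₃ h).comp (two₁ h) = three₂ h := Pushout.lift_comp_inl _ _ _
lemma three₂₃_two₂ : (three₂₃ h).comp (two₂ h) = three₃ h := Pushout.lift_comp_inr _ _ _

/-- The objects `(N, φ)` of `Mod(Q → P)`: a `P`-module `N` with an isomorphism `φ : π₁^* N ≅ π₂^* N`
of `P ⊕_Q P`-modules that satisfies the cocycle condition `π₂₃^* φ ∘ π₁₂^* φ = π₁₃^* φ` over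
`P ⊕_Q P ⊕_Q P`. -/
structure DescentMod where
  obj : PMod P
  iso : (PMod.extend (two₁ h)).obj obj ≅ (PMod.extend (two₂ h)).obj obj
  cocycle :
    PMod.pullHom (three₁₂ h) (three₁ h) (three₂ h) (three₁₂_two₁ h) (three₁₂_two₂ h) iso.hom ≫
      PMod.pullHom (three₂₃ h) (three₂ h) (three₃ h) (three₂₃_two₁ h) (three₂₃_two₂ h) iso.hom =
    PMod.pullHom (three₁₃ h) (three₁ h) (three₃ h) (three₁₃_two₁ h) (three₁₃_two₂ h) iso.hom

namespace DescentMod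
variable {h}

/-- Morphisms `(N, φ) ⟶ (N', φ')`: morphisms `N ⟶ N'` of `P`-modules compatible with `φ`, `φ'`. -/
@[ext]
structure Hom (D E : DescentMod h) where
  hom : D.obj ⟶ E.obj
  comm : (PMod.extend (two₁ h)).map hom ≫ E.iso.hom = D.iso.hom ≫ (PMod.extend (two₂ h)).map hom

instance : Category (DescentMod h) where
  Hom := Hom
  id D := ⟨𝟙 _, by simp⟩
  comp f g := ⟨f.hom ≫ g.hom, by
    rw [Functor.map_comp, Category.assoc, g.comm, ← Category.assoc, f.comm, Functor.map_comp,
      Category.assoc]⟩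

@[ext]
lemma hom_ext {D E : DescentMod h} {f g : D ⟶ E} (w : f.hom = g.hom) : f = g := Hom.ext w

@[simp] lemma id_hom (D : DescentMod h) : Hom.hom (𝟙 D) = 𝟙 D.obj := rfl
@[simp] lemma comp_hom {D E F : DescentMod h} (f : D ⟶ E) (g : E ⟶ F) :
    (f ≫ g).hom = f.hom ≫ g.hom := rfl

end DescentMod

/-- The tautological isomorphism `π₁^*(M ⊗_Q P) ≅ π₂^*(M ⊗_Q P)`. -/
def tautIso (M : PMod Q) :
    (PMod.extend (two₁ h)).obj ((PMod.extend h).obj M) ≅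
      (PMod.extend (two₂ h)).obj ((PMod.extend h).obj M) :=
  PMod.extendComp h (two₁ h) ((two₁ h).comp h) rfl M ≪≫
    (PMod.extendComp h (two₂ h) ((two₁ h).comp h) (Pushout.condition h h).symm M).symm

lemma pullHom_tautIso_mk {S : Type u} [CommMonoid S] (j : Two h →* S) (a b : P →* S)
    (ha : j.comp (two₁ h) = a) (hb : j.comp (two₂ h) = b) (M : PMod Q) (s : S) (p : P) (m : M) :
    PMod.pullHom j a b ha hb (tautIso h M).hom (Tensor.mk a s (Tensor.mk h p m)) =
      Tensor.mk b (s * a p) (Tensor.mk h 1 m) := by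
  subst ha
  change Tensor.mk b (s * j (1 * two₁ h p)) (Tensor.mk h 1 m) = _
  rw [one_mul]; rfl

/-- The functor `M ↦ (P ⊗_Q M, tautIso)` from `Q`-modules to `Mod(Q → P)`. -/
def tautDescent : PMod Q ⥤ DescentMod h where
  obj M :=
    { obj := (PMod.extend h).obj M
      iso := tautIso h M
      cocycle := by
        ext t
        induction t using Tensor.ind with
        | H r t => induction t using Tensor.ind with
          | H p m =>
            refine (congrArg (PMod.pullHom (three₂₃ h) (three₂ h) (three₃ h) (three₂₃_two₁ h)
              (three₂₃_two₂ h) (tautIso h M).hom) (pullHom_tautIso_mk h (three₁₂ h) (three₁ h)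
              (three₂ h) (three₁₂_two₁ h) (three₁₂_two₂ h) M r p m)).trans ?_
            refine (pullHom_tautIso_mk h (three₂₃ h) (three₂ h) (three₃ h) (three₂₃_two₁ h)
              (three₂₃_two₂ h) M (r * three₁ h p) 1 m).trans ?_
            rw [map_one, mul_one]
            exact (pullHom_tautIso_mk h (three₁₃ h) (three₁ h) (three₃ h) (three₁₃_two₁ h)
              (three₁₃_two₂ h) M r p m).symm }
  map f := ⟨(PMod.extend h).map f, by
    ext t
    induction t using Tensor.ind with
    | H r t => induction t using Tensor.ind with
      | H p m => rfl⟩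
  map_id M := by ext1; exact (PMod.extend h).map_id M
  map_comp f g := by ext1; exact (PMod.extend h).map_comp f g

namespace DescentMod
variable {h}

/-- The equalizer of the natural map `N → π₂^* N` and the composite of the natural map
`N → π₁^* N` with `φ`. -/
def equalizer (D : DescentMod h) : Type u :=
  {n : D.obj // Tensor.mk (two₂ h) 1 n = D.iso.hom (Tensor.mk (two₁ h) 1 n)}

instance (D : DescentMod h) : MulAction Q D.equalizer where
  smul q n := ⟨h q • n.1, by
    have e : two₁ h (h q) = two₂ h (h q) := DFunLike.congr_fun (Pushout.condition h h) q
    rw [← Tensor.mk_mul, ← Tensor.mk_mul, one_mul, one_mul, e,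
      ← mul_one (two₂ h (h q)), ← Tensor.smul_mk, ← Tensor.smul_mk, n.2]
    exact (PMod.hom_smul D.iso.hom _ _).symm⟩
  one_smul n := Subtype.ext (show h 1 • n.1 = n.1 by rw [map_one, one_smul])
  mul_smul a b n := Subtype.ext
    (show h (a * b) • n.1 = h a • h b • n.1 by rw [map_mul, mul_smul])

end DescentMod

/-- The functor `G : Mod(Q → P) ⥤ Mod(Q)`, which sends `(N, φ)` to the equalizer of
`N ⇉ π₂^* N`. -/
def descend : DescentMod h ⥤ PMod Q where
  obj D := ⟨D.equalizer⟩
  map {D E} f := PMod.homMk (M := ⟨D.equalizer⟩) (N := ⟨E.equalizer⟩)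
    (fun n => ⟨f.hom n.1, by
      have := congrArg (fun g => g (Tensor.mk (two₁ h) 1 n.1)) f.comm
      refine Eq.trans ?_ this.symm
      exact congrArg ((PMod.extend (two₂ h)).map f.hom) n.2⟩)
    (fun q n => Subtype.ext (PMod.hom_smul f.hom (h q) n.1))
  map_id D := rfl
  map_comp f g := rfl

end Descent

namespace CommMonColimit
variable {J : Type u} [SmallCategory J] (F : J ⥤ CommMonCat.{u})

/-- The relations on the free commutative monoid on the disjoint union of the `F.obj j` that
define the colimit of `F`. -/
inductive Rel : Multiplicative (Multiset (Σ j, F.obj j)) →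
    Multiplicative (Multiset (Σ j, F.obj j)) → Prop
  | one (j : J) : Rel (.ofAdd {⟨j, 1⟩}) 1
  | mul (j : J) (a b : F.obj j) : Rel (.ofAdd {⟨j, a * b⟩}) (.ofAdd {⟨j, a⟩} * .ofAdd {⟨j, b⟩})
  | map {j k : J} (f : j ⟶ k) (a : F.obj j) : Rel (.ofAdd {⟨j, a⟩}) (.ofAdd {⟨k, F.map f a⟩})

/-- The colimit of `F`, with its coprojections. -/
def cocone : Limits.Cocone F where
  pt := CommMonCat.of (conGen (Rel F)).Quotient
  ι :=
    { app := fun j => CommMonCat.ofHom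
        { toFun := fun a => (conGen (Rel F)).mk' (.ofAdd {⟨j, a⟩})
          map_one' := (Con.eq _).2 (ConGen.Rel.of _ _ (.one j))
          map_mul' := fun a b => (Con.eq _).2 (ConGen.Rel.of _ _ (.mul j a b)) }
      naturality := fun j k f => by
        ext a
        exact (Con.eq _).2 ((conGen (Rel F)).symm (ConGen.Rel.of _ _ (.map f a))) }

variable {F} in
/-- The map out of the free commutative monoid given by a cocone. -/
def descAux (s : Limits.Cocone F) : Multiplicative (Multiset (Σ j, F.obj j)) →* s.pt where
  toFun m := ((Multiplicative.toAdd m).map fun x => s.ι.app x.1 x.2).prod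
  map_one' := by simp
  map_mul' a b := by simp

variable {F} in
lemma descAux_single (s : Limits.Cocone F) (j : J) (a : F.obj j) :
    descAux s (.ofAdd {⟨j, a⟩}) = s.ι.app j a := by
  simp [descAux]

/-- The universal property of the colimit. -/
def isColimit : Limits.IsColimit (cocone F) where
  desc s := CommMonCat.ofHom ((conGen (Rel F)).lift (descAux s) (Con.conGen_le.2 (by
    rintro _ _ (⟨j⟩ | ⟨j, a, b⟩ | ⟨f, a⟩)
    · simp [Con.ker_rel, descAux_single]
    · simp [Con.ker_rel, descAux_single]
    · rw [Con.ker_rel, descAux_single, descAux_single]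
      exact (ConcreteCategory.congr_hom (s.w f) a).symm)))
  fac s j := by
    ext a
    exact descAux_single s j a
  uniq s m h := by
    ext x
    obtain ⟨x, rfl⟩ := Con.mk'_surjective x
    let φ : (conGen (Rel F)).Quotient →* s.pt := m.hom
    suffices H : ∀ x : Multiset (Σ j, F.obj j),
        φ ((conGen (Rel F)).mk' (.ofAdd x)) = descAux s (.ofAdd x) from H x
    intro x
    induction x using Multiset.induction with
    | empty => exact (φ.map_one).trans (map_one (descAux s)).symm
    | cons a t ih =>
      have e : Multiplicative.ofAdd (a ::ₘ t) = .ofAdd {a} * .ofAdd t := rfl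
      rw [e, map_mul, map_mul, map_mul, ih]
      congr 1
      rw [descAux_single, ← h]; rfl

end CommMonColimit

instance : Limits.HasColimits CommMonCat.{u} :=
  ⟨fun _ _ => ⟨fun F => ⟨⟨⟨_, CommMonColimit.isColimit F⟩⟩⟩⟩⟩

/-- A space with a sheaf of (commutative) monoids. -/
structure LMS where
  /-- The underlying space with its sheaf. -/
  toSheafedSpace : SheafedSpace CommMonCat.{u}

namespace LMS

instance : CoeSort LMS.{u} (Type u) := ⟨fun X => X.toSheafedSpace⟩

/-- The underlying presheafed space. -/
abbrev toPresheafedSpace (X : LMS.{u}) : PresheafedSpace CommMonCat.{u} :=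
  X.toSheafedSpace.toPresheafedSpace

/-- The structure sheaf `M_X`. -/
abbrev str (X : LMS.{u}) : TopCat.Presheaf CommMonCat.{u} X.toPresheafedSpace.carrier :=
  X.toPresheafedSpace.presheaf

/-- A morphism: a continuous map `f` with a map of sheaves of monoids `M_Y → f_* M_X` whose
maps on stalks are local. -/
@[ext]
structure Hom (X Y : LMS.{u}) where
  hom : X.toPresheafedSpace ⟶ Y.toPresheafedSpace
  isLocal : ∀ x, IsLocalHom (hom.stalkMap x).hom

instance : Category LMS.{u} where
  Hom := Hom
  id X := ⟨𝟙 _, fun x => by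
    rw [PresheafedSpace.stalkMap.id]; exact ⟨fun a h => h⟩⟩
  comp f g := ⟨f.hom ≫ g.hom, fun x => by
    rw [PresheafedSpace.stalkMap.comp]
    exact ⟨fun a h => (g.isLocal _).map_nonunit a ((f.isLocal x).map_nonunit _ h)⟩⟩

@[ext]
lemma hom_ext {X Y : LMS.{u}} {f g : X ⟶ Y} (h : f.hom = g.hom) : f = g := by
  exact Hom.ext h

@[simp] lemma id_hom (X : LMS.{u}) : Hom.hom (𝟙 X) = 𝟙 X.toPresheafedSpace := rfl
@[simp] lemma comp_hom {X Y Z : LMS.{u}} (f : X ⟶ Y) (g : Y ⟶ Z) :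
    (f ≫ g).hom = f.hom ≫ g.hom := rfl

/-- The map on stalks `M_{Y, f x} → M_{X, x}`. -/
def stalkHom {X Y : LMS.{u}} (f : X ⟶ Y) (x : X) :
    Y.str.stalk (f.hom.base x) →* X.str.stalk x :=
  (f.hom.stalkMap x).hom

end LMS

/-- The faces of `P`, i.e. the submonoids `F` such that `a * b ∈ F` implies `a, b ∈ F`;
these are the points of `Spec P`. -/
def Face (P : Type u) [CommMonoid P] : Type u :=
  {F : Submonoid P // ∀ a b, a * b ∈ F → a ∈ F ∧ b ∈ F}

namespace Face
variable {P Q : Type u} [CommMonoid P] [CommMonoid Q]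

/-- The set `U_p` of faces that contain `p`. -/
def basicOpen (p : P) : Set (Face P) := {F | p ∈ F.1}

/-- The topology generated by the sets `U_p`. -/
instance : TopologicalSpace (Face P) := .generateFrom (Set.range basicOpen)

lemma isOpen_basicOpen (p : P) : IsOpen (basicOpen p) :=
  isOpen_generateFrom_of_mem ⟨p, rfl⟩

/-- The preimage of a face. -/
def comap (h : Q →* P) (F : Face P) : Face Q :=
  ⟨F.1.comap h, fun a b hab => F.2 (h a) (h b) (by simpa using hab)⟩

lemma continuous_comap (h : Q →* P) : Continuous (comap h) := by
  refine continuous_generateFrom_iff.2 ?_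
  rintro _ ⟨q, rfl⟩
  exact isOpen_basicOpen (h q)

/-- The localization `F⁻¹ P`, the stalk of the structure sheaf at `F`. -/
abbrev Loc (F : Face P) : Type u := Localization F.1

lemma mem_of_isUnit_mk (F : Face P) (a : P) (b : F.1) (h : IsUnit (Localization.mk a b)) :
    a ∈ F.1 := by
  obtain ⟨c, hc⟩ := h.exists_right_inv
  induction c using Localization.induction_on with
  | H y =>
    rw [Localization.mk_mul, ← Localization.mk_one, Localization.mk_eq_mk_iff,
      Localization.r_iff_exists] at hc
    obtain ⟨s, hs⟩ := hc
    have : a * (s.1 * y.1) ∈ F.1 := by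
      have h2 : a * (s.1 * y.1) = s.1 * (b * y.2).1 := by
        simpa [mul_assoc, mul_left_comm] using hs
      rw [h2]; exact F.1.mul_mem s.2 (b * y.2).2
    exact (F.2 _ _ this).1

/-- The map `(h⁻¹ F)⁻¹ Q → F⁻¹ P` induced by `h`. -/
def locMap (h : Q →* P) (F : Face P) : (comap h F).Loc →* F.Loc :=
  (Localization.monoidOf (comap h F).1).map (g := h) (T := F.1) (fun y => y.2)
    (Localization.monoidOf F.1)

lemma locMap_mk (h : Q →* P) (F : Face P) (a : Q) (b : (comap h F).1) :
    locMap h F (Localization.mk a b) = Localization.mk (h a) ⟨h b, b.2⟩ := by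
  rw [locMap, Localization.mk_eq_monoidOf_mk', Localization.mk_eq_monoidOf_mk']
  exact Submonoid.LocalizationMap.map_mk' _ _ _ _

lemma isUnit_mk_of_mem (F : Face P) (a : P) (b : F.1) (h : a ∈ F.1) :
    IsUnit (Localization.mk a b : F.Loc) := by
  refine IsUnit.of_mul_eq_one (Localization.mk b.1 ⟨a, h⟩) ?_
  rw [Localization.mk_mul, ← Localization.mk_one, Localization.mk_eq_mk_iff,
    Localization.r_iff_exists]
  exact ⟨1, by simp [mul_comm]⟩

lemma isUnit_of_isUnit_locMap (h : Q →* P) (F : Face P) (z : (comap h F).Loc)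
    (hz : IsUnit (locMap h F z)) : IsUnit z := by
  induction z using Localization.induction_on with
  | H y =>
    rw [locMap_mk] at hz
    exact isUnit_mk_of_mem (comap h F) _ _ (mem_of_isUnit_mk F _ _ hz)

end Face

namespace Spec
variable (P : Type u) [CommMonoid P]

/-- The space of faces of `P`. -/
def top : TopCat.{u} := TopCat.of (Face P)

/-- The families `F ↦ a / b ∈ F⁻¹ P` over an open set, for fixed `a, b : P` with `b` in all faces
`F` of the open set. -/
def isFraction : TopCat.PrelocalPredicate (fun F : top P => Face.Loc (F : Face P)) where
  pred {U} f := ∃ a b : P, ∀ F : U, ∃ hb : b ∈ F.1.1, f F = Localization.mk a ⟨b, hb⟩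
  res {U V} i f := by
    rintro ⟨a, b, h⟩
    exact ⟨a, b, fun F => h (i F)⟩

/-- The families that are locally of the form `a / b`. -/
def isLocallyFraction : TopCat.LocalPredicate (fun F : top P => Face.Loc (F : Face P)) :=
  (isFraction P).sheafify

/-- The sections of the structure sheaf: the families of elements of the `F⁻¹ P` that are locally
of the form `a / b`. -/
def sections (U : (Opens (top P))ᵒᵖ) :
    Submonoid (∀ F : U.unop, Face.Loc (F.1 : Face P)) where
  carrier := {f | (isLocallyFraction P).pred f}
  one_mem' := fun F => ⟨U.unop, F.2, 𝟙 _, 1, 1, fun G => ⟨G.1.1.one_mem, Localization.mk_one.symm⟩⟩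
  mul_mem' := by
    intro f g hf hg F
    obtain ⟨V, hV, i, a, b, h⟩ := hf F
    obtain ⟨V', hV', i', a', b', h'⟩ := hg F
    refine ⟨V ⊓ V', ⟨hV, hV'⟩, homOfLE inf_le_left ≫ i, a * a', b * b', fun G => ?_⟩
    obtain ⟨hb, e⟩ := h ⟨G.1, G.2.1⟩
    obtain ⟨hb', e'⟩ := h' ⟨G.1, G.2.2⟩
    refine ⟨G.1.1.mul_mem hb hb', ?_⟩
    refine (congrArg₂ (· * ·) e e').trans ?_
    exact Localization.mk_mul _ _ _ _

/-- The structure sheaf of `Spec P`. -/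
def presheaf : TopCat.Presheaf CommMonCat.{u} (top P) where
  obj U := CommMonCat.of (sections P U)
  map {U V} i := CommMonCat.ofHom
    { toFun := fun f => ⟨fun F => f.1 (i.unop F), (isLocallyFraction P).res i.unop f.1 f.2⟩
      map_one' := rfl
      map_mul' := fun _ _ => rfl }

lemma isSheaf : (presheaf P).IsSheaf :=
  (TopCat.Presheaf.isSheaf_iff_isSheaf_comp (forget CommMonCat) _).2
    (TopCat.Presheaf.isSheaf_of_iso (NatIso.ofComponents (fun U => Iso.refl _) (by intros; rfl))
      (TopCat.subsheafToTypes (isLocallyFraction P)).property)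


/-- `Spec P` as a space with a sheaf of monoids. -/
def toSheafedSpace : SheafedSpace CommMonCat.{u} where
  carrier := top P
  presheaf := presheaf P
  IsSheaf := isSheaf P

variable {P} {Q : Type u} [CommMonoid Q]

lemma germ_eq' (F : top P) {U V : Opens (top P)} (hU : F ∈ U) (hV : F ∈ V)
    (s : (presheaf P).obj (op U)) (t : (presheaf P).obj (op V)) :
    (presheaf P).germ U F hU s = (presheaf P).germ V F hV t ↔
      ∃ (W : Opens (top P)) (_ : F ∈ W) (i : W ⟶ U) (j : W ⟶ V),
        ∀ G : W, s.1 (i G) = t.1 (j G) := by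
  constructor
  · intro e
    obtain ⟨W, hW, i, j, h⟩ := TopCat.Presheaf.germ_eq _ F hU hV s t e
    exact ⟨W, hW, i, j, fun G => congrFun (congrArg Subtype.val h) G⟩
  · rintro ⟨W, hW, i, j, h⟩
    refine TopCat.Presheaf.germ_ext _ W hW i j (Subtype.ext (funext h))

lemma isUnit_germ_iff (F : top P) {U : Opens (top P)} (hU : F ∈ U)
    (s : (presheaf P).obj (op U)) :
    IsUnit ((presheaf P).germ U F hU s) ↔ IsUnit (s.1 ⟨F, hU⟩) := by
  constructor
  · intro h
    obtain ⟨t, ht⟩ := h.exists_right_inv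
    obtain ⟨V, hV, t, rfl⟩ := TopCat.Presheaf.exists_germ_eq _ t
    have e1 : (presheaf P).germ U F hU s = (presheaf P).germ (U ⊓ V) F ⟨hU, hV⟩
        ((presheaf P).map (homOfLE inf_le_left).op s) :=
      (TopCat.Presheaf.germ_res_apply _ _ _ _ _).symm
    have e2 : (presheaf P).germ V F hV t = (presheaf P).germ (U ⊓ V) F ⟨hU, hV⟩
        ((presheaf P).map (homOfLE inf_le_right).op t) :=
      (TopCat.Presheaf.germ_res_apply _ _ _ _ _).symm
    rw [e1, e2, ← map_mul, ← map_one ((presheaf P).germ (U ⊓ V) F ⟨hU, hV⟩).hom] at ht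
    obtain ⟨W, hW, i, j, h⟩ := (germ_eq' F _ _ _ _).1 ht
    exact IsUnit.of_mul_eq_one (t.1 ⟨F, hV⟩) (h ⟨F, hW⟩)
  · intro h
    obtain ⟨V, hV, i, a, b, hab⟩ := s.2 ⟨F, hU⟩
    obtain ⟨hb, e⟩ := hab ⟨F, hV⟩
    have ha : a ∈ F.1 := Face.mem_of_isUnit_mk F a ⟨b, hb⟩ (by
      have e' : s.1 ⟨F, hU⟩ = Localization.mk a ⟨b, hb⟩ := e
      rwa [← e'])
    let W : Opens (top P) := V ⊓ ⟨Face.basicOpen a, Face.isOpen_basicOpen a⟩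
    have hW : F ∈ W := ⟨hV, ha⟩
    let t : (presheaf P).obj (op W) := ⟨fun G => Localization.mk b ⟨a, G.2.2⟩, fun G =>
      ⟨W, G.2, 𝟙 _, b, a, fun H => ⟨H.2.2, rfl⟩⟩⟩
    have e1 : (presheaf P).germ U F hU s = (presheaf P).germ W F hW
        ((presheaf P).map (homOfLE (fun _ h => i.le h.1) : W ⟶ U).op s) :=
      (TopCat.Presheaf.germ_res_apply _ _ _ _ _).symm
    refine IsUnit.of_mul_eq_one ((presheaf P).germ W F hW t) ?_
    rw [e1, ← map_mul, ← map_one ((presheaf P).germ W F hW).hom]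
    refine congrArg _ (Subtype.ext (funext fun G => ?_))
    obtain ⟨hb', e'⟩ := hab ⟨G.1, G.2.1⟩
    change s.1 (i ⟨G.1, G.2.1⟩) * Localization.mk b ⟨a, G.2.2⟩ = 1
    have e'' : s.1 (i ⟨G.1, G.2.1⟩) = Localization.mk a ⟨b, hb'⟩ := e'
    rw [e'', Localization.mk_mul, ← Localization.mk_one, Localization.mk_eq_mk_iff,
      Localization.r_iff_exists]
    exact ⟨1, by simp [mul_comm]⟩

/-- The map of spaces with sheaves of monoids `Spec P → Spec Q` induced by `h : Q →* P`. -/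
def mapHom (h : Q →* P) :
    (toSheafedSpace P).toPresheafedSpace ⟶ (toSheafedSpace Q).toPresheafedSpace where
  base := TopCat.ofHom ⟨Face.comap h, Face.continuous_comap h⟩
  c :=
    { app := fun U => CommMonCat.ofHom
        { toFun := fun s => ⟨fun F => Face.locMap h F.1 (s.1 ⟨Face.comap h F.1, F.2⟩), by
            intro F
            obtain ⟨V, hV, i, a, b, hab⟩ := s.2 ⟨Face.comap h F.1, F.2⟩
            refine ⟨(Opens.map (TopCat.ofHom ⟨Face.comap h, Face.continuous_comap h⟩)).obj V, hV,
              (Opens.map _).map i, h a, h b, fun G => ?_⟩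
            obtain ⟨hb, e⟩ := hab ⟨Face.comap h G.1, G.2⟩
            exact ⟨hb, (congrArg (Face.locMap h G.1) e).trans (Face.locMap_mk h G.1 a ⟨b, hb⟩)⟩⟩
          map_one' := Subtype.ext (funext fun F => map_one (Face.locMap h F.1))
          map_mul' := fun s t => Subtype.ext (funext fun F => map_mul (Face.locMap h F.1) _ _) }
      naturality := fun _ _ _ => rfl }

lemma mapHom_isLocal (h : Q →* P) (F : top P) : IsLocalHom ((mapHom h).stalkMap F).hom where
  map_nonunit a ha := by
    obtain ⟨U, hU, s, rfl⟩ := TopCat.Presheaf.exists_germ_eq _ a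
    have e : ((mapHom h).stalkMap F).hom ((presheaf Q).germ U _ hU s) =
        (presheaf P).germ ((Opens.map (mapHom h).base).obj U) F hU ((mapHom h).c.app (op U) s) :=
      PresheafedSpace.stalkMap_germ_apply (mapHom h) U F hU s
    have ha' := (isUnit_germ_iff F hU ((mapHom h).c.app (op U) s)).1 (e ▸ ha)
    refine (isUnit_germ_iff _ _ _).2 ?_
    exact Face.isUnit_of_isUnit_locMap h F _ ha'

end Spec

/-- The affine fan `Spec P`. -/
def Spec (P : Type u) [CommMonoid P] : LMS.{u} := ⟨Spec.toSheafedSpace P⟩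

/-- The map of affine fans induced by a map of monoids. -/
def Spec.map {P Q : Type u} [CommMonoid P] [CommMonoid Q] (h : Q →* P) :
    Spec P ⟶ Spec Q :=
  ⟨Spec.mapHom h, Spec.mapHom_isLocal h⟩

/-- An `M_X`-module: a sheaf of sets on `X` with an action of the sheaf of monoids `M_X`. -/
structure LMS.Modules (X : LMS.{u}) where
  presheaf : TopCat.Presheaf (Type u) X.toPresheafedSpace.carrier
  isSheaf : presheaf.IsSheaf
  [action : ∀ U, MulAction (X.str.obj U) (presheaf.obj U)]
  map_smul : ∀ {U V} (i : U ⟶ V) (a : X.str.obj U) (s : presheaf.obj U),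
    presheaf.map i (a • s) = X.str.map i a • presheaf.map i s

namespace LMS.Modules

attribute [instance] action

variable {X Y Z : LMS.{u}}

/-- Morphisms of modules: equivariant morphisms of sheaves. -/
@[ext]
structure Hom (F G : X.Modules) where
  hom : F.presheaf ⟶ G.presheaf
  map_smul : ∀ U (a : X.str.obj U) (s : F.presheaf.obj U),
    hom.app U (a • s) = a • hom.app U s

instance : Category X.Modules where
  Hom := Hom
  id F := ⟨𝟙 _, fun _ _ _ => rfl⟩
  comp f g := ⟨f.hom ≫ g.hom, fun U a s => by
    change g.hom.app U (f.hom.app U (a • s)) = a • g.hom.app U (f.hom.app U s)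
    rw [f.map_smul, g.map_smul]⟩

lemma hom_ext {F G : X.Modules} {f g : F ⟶ G}
    (h : ∀ (U : Opens X) (s : F.presheaf.obj (op U)), f.hom.app (op U) s = g.hom.app (op U) s) :
    f = g :=
  Hom.ext (NatTrans.ext (funext fun U => ConcreteCategory.hom_ext _ _ fun s => h U.unop s))

lemma naturality_apply {F G : X.Modules} (f : F ⟶ G) {U V} (i : U ⟶ V)
    (s : F.presheaf.obj U) :
    f.hom.app V (F.presheaf.map i s) = G.presheaf.map i (f.hom.app U s) :=
  ConcreteCategory.congr_hom (f.hom.naturality i) s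

/-- The stalk of a module. -/
abbrev stalk (F : X.Modules) (x : X) : Type u := F.presheaf.stalk x

/-- The germ of a section of a module. -/
abbrev germ (F : X.Modules) {U : Opens X} (x : X) (hx : x ∈ U) (s : F.presheaf.obj (op U)) :
    F.stalk x :=
  F.presheaf.germ U x hx s

lemma germ_map (F : X.Modules) {U V : Opens X} (i : V ⟶ U) (x : X) (hx : x ∈ V)
    (s : F.presheaf.obj (op U)) :
    F.germ x hx (F.presheaf.map i.op s) = F.germ x (i.le hx) s :=
  TopCat.Presheaf.germ_res_apply _ _ _ _ _

lemma exists_germ (F : X.Modules) (x : X) (m : F.stalk x) :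
    ∃ (U : Opens X) (hx : x ∈ U) (s : F.presheaf.obj (op U)), F.germ x hx s = m :=
  F.presheaf.exists_germ_eq m

lemma germ_eq_iff (F : X.Modules) (x : X) {U V : Opens X} (hU : x ∈ U) (hV : x ∈ V)
    (s : F.presheaf.obj (op U)) (t : F.presheaf.obj (op V)) :
    F.germ x hU s = F.germ x hV t ↔ ∃ (W : Opens X) (_ : x ∈ W) (i : W ⟶ U) (j : W ⟶ V),
      F.presheaf.map i.op s = F.presheaf.map j.op t := by
  constructor
  · exact fun h => F.presheaf.germ_eq x hU hV s t h
  · rintro ⟨W, hW, i, j, h⟩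
    exact TopCat.Presheaf.germ_ext _ W hW i j h

end Modules

/-- The germ of a section of the structure sheaf. -/
abbrev germ (X : LMS.{u}) {U : Opens X} (x : X) (hx : x ∈ U) (s : X.str.obj (op U)) :
    X.str.stalk x :=
  X.str.germ U x hx s

lemma germ_map (X : LMS.{u}) {U V : Opens X} (i : V ⟶ U) (x : X) (hx : x ∈ V)
    (s : X.str.obj (op U)) :
    X.germ x hx (X.str.map i.op s) = X.germ x (i.le hx) s :=
  TopCat.Presheaf.germ_res_apply _ _ _ _ _

lemma exists_germ (X : LMS.{u}) (x : X) (m : X.str.stalk x) :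
    ∃ (U : Opens X) (hx : x ∈ U) (s : X.str.obj (op U)), X.germ x hx s = m :=
  TopCat.Presheaf.exists_germ_eq _ m

lemma germ_eq_iff (X : LMS.{u}) (x : X) {U V : Opens X} (hU : x ∈ U) (hV : x ∈ V)
    (s : X.str.obj (op U)) (t : X.str.obj (op V)) :
    X.germ x hU s = X.germ x hV t ↔ ∃ (W : Opens X) (_ : x ∈ W) (i : W ⟶ U) (j : W ⟶ V),
      X.str.map i.op s = X.str.map j.op t := by
  constructor
  · exact fun h => TopCat.Presheaf.germ_eq _ x hU hV s t h
  · rintro ⟨W, hW, i, j, h⟩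
    exact TopCat.Presheaf.germ_ext _ W hW i j h

lemma germ_one (X : LMS.{u}) {U : Opens X} (x : X) (hx : x ∈ U) : X.germ x hx 1 = 1 :=
  map_one (X.str.germ U x hx).hom

lemma germ_mul (X : LMS.{u}) {U : Opens X} (x : X) (hx : x ∈ U) (s t : X.str.obj (op U)) :
    X.germ x hx (s * t) = X.germ x hx s * X.germ x hx t :=
  map_mul (X.str.germ U x hx).hom s t

namespace Modules

variable {X Y Z : LMS.{u}}

lemma exists_smul_germ (F : X.Modules) (x : X) (a : X.str.stalk x) (m : F.stalk x) :
    ∃ n : F.stalk x, ∀ (U : Opens X) (hx : x ∈ U) (s : X.str.obj (op U))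
      (t : F.presheaf.obj (op U)), X.germ x hx s = a → F.germ x hx t = m →
        F.germ x hx (s • t) = n := by
  obtain ⟨U, hU, s, rfl⟩ := X.exists_germ x a
  obtain ⟨V, hV, t, rfl⟩ := F.exists_germ x m
  refine ⟨F.germ (U := U ⊓ V) x ⟨hU, hV⟩ (X.str.map (homOfLE inf_le_left : U ⊓ V ⟶ U).op s •
    F.presheaf.map (homOfLE inf_le_right : U ⊓ V ⟶ V).op t), fun W hW s' t' hs ht => ?_⟩
  rw [germ_eq_iff] at ht
  rw [LMS.germ_eq_iff] at hs
  obtain ⟨A, hA, i, j, e⟩ := hs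
  obtain ⟨B, hB, i', j', e'⟩ := ht
  refine (F.germ_eq_iff _ _ _ _ _).2 ⟨A ⊓ B, ⟨hA, hB⟩, homOfLE inf_le_left ≫ i,
    homOfLE (inf_le_inf j.le j'.le), ?_⟩
  rw [F.map_smul, F.map_smul, ← ConcreteCategory.comp_apply, ← ConcreteCategory.comp_apply,
    ← Functor.map_comp, ← Functor.map_comp]
  have e1 := congrArg (X.str.map (homOfLE (inf_le_left : A ⊓ B ≤ A)).op) e
  have e2 := congrArg (F.presheaf.map (homOfLE (inf_le_right : A ⊓ B ≤ B)).op) e'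
  rw [← ConcreteCategory.comp_apply, ← ConcreteCategory.comp_apply, ← Functor.map_comp,
    ← Functor.map_comp] at e1 e2
  exact congrArg₂ (· • ·) e1 e2

/-- The stalk of a module is acted on by the stalk of the structure sheaf. -/
instance (F : X.Modules) (x : X) : SMul (X.str.stalk x) (F.stalk x) :=
  ⟨fun a m => (F.exists_smul_germ x a m).choose⟩

lemma germ_smul (F : X.Modules) {U : Opens X} (x : X) (hx : x ∈ U) (s : X.str.obj (op U))
    (t : F.presheaf.obj (op U)) :
    F.germ x hx (s • t) = X.germ x hx s • F.germ x hx t :=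
  (F.exists_smul_germ x _ _).choose_spec U hx s t rfl rfl

instance (F : X.Modules) (x : X) : MulAction (X.str.stalk x) (F.stalk x) where
  one_smul m := by
    obtain ⟨U, hU, t, rfl⟩ := F.exists_germ x m
    rw [← X.germ_one x hU, ← germ_smul, one_smul]
  mul_smul a b m := by
    obtain ⟨U, hU, s, rfl⟩ := X.exists_germ x a
    obtain ⟨V, hV, s', rfl⟩ := X.exists_germ x b
    obtain ⟨W, hW, t, rfl⟩ := F.exists_germ x m
    let T : Opens X := U ⊓ V ⊓ W
    have hT : x ∈ T := ⟨⟨hU, hV⟩, hW⟩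
    rw [← X.germ_map (homOfLE (inf_le_left.trans inf_le_left) : T ⟶ U) x hT,
      ← X.germ_map (homOfLE (inf_le_left.trans inf_le_right) : T ⟶ V) x hT,
      ← F.germ_map (homOfLE inf_le_right : T ⟶ W) x hT, ← X.germ_mul, ← germ_smul, ← germ_smul,
      ← germ_smul, mul_smul]

lemma section_ext (F : X.Modules) {U : Opens X} {s t : F.presheaf.obj (op U)}
    (h : ∀ x (hx : x ∈ U), F.germ x hx s = F.germ x hx t) : s = t :=
  TopCat.Presheaf.section_ext ⟨F.presheaf, F.isSheaf⟩ U s t h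

lemma exists_section (F : X.Modules) {U : Opens X} (t : ∀ x : U, F.stalk x.1)
    (ht : ∀ x : U, ∃ (V : Opens X) (_ : x.1 ∈ V) (i : V ⟶ U) (s : F.presheaf.obj (op V)),
      ∀ y : V, F.germ y.1 y.2 s = t (i y)) :
    ∃ s : F.presheaf.obj (op U), ∀ x : U, F.germ x.1 x.2 s = t x := by
  choose V hV i s hs using ht
  obtain ⟨g, hg, -⟩ := TopCat.Sheaf.existsUnique_gluing' ⟨F.presheaf, F.isSheaf⟩ V U i
    (fun x hx => Opens.mem_iSup.2 ⟨⟨x, hx⟩, hV _⟩) s (by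
      intro a b
      refine F.section_ext fun x hx => ?_
      refine (F.germ_map _ _ _ _).trans (Eq.trans ?_ (F.germ_map _ _ _ _).symm)
      exact (hs a ⟨x, hx.1⟩).trans (hs b ⟨x, hx.2⟩).symm)
  refine ⟨g, fun x => ?_⟩
  rw [← F.germ_map (i x) x.1 (hV x) g]
  exact (congrArg (F.germ x.1 (hV x)) (hg x)).trans (hs x ⟨x.1, hV x⟩)

/-- The map on stalks given by a morphism of modules. -/
def stalkMap {F G : X.Modules} (φ : F ⟶ G) (x : X) : F.stalk x → G.stalk x :=
  (TopCat.Presheaf.stalkFunctor (Type u) x).map φ.hom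

lemma stalkMap_germ {F G : X.Modules} (φ : F ⟶ G) {U : Opens X} (x : X) (hx : x ∈ U)
    (s : F.presheaf.obj (op U)) :
    stalkMap φ x (F.germ x hx s) = G.germ x hx (φ.hom.app (op U) s) :=
  TopCat.Presheaf.stalkFunctor_map_germ_apply _ _ _ _ _

/-- The module of families of elements of `T x`, `x ∈ U`, that satisfy a local condition, where each
`T x` is a module over the stalk of the structure sheaf at `x`. -/
def ofLocalPredicate (T : X → Type u) [∀ x, MulAction (X.str.stalk x) (T x)]
    (p : TopCat.LocalPredicate (X := X.toPresheafedSpace.carrier) T)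
    (hp : ∀ (U : Opens X) (a : X.str.obj (op U)) (s : ∀ x : U, T x), p.pred s →
      p.pred fun x : U => X.germ x.1 x.2 a • s x) : X.Modules where
  presheaf := TopCat.subpresheafToTypes p.toPrelocalPredicate
  isSheaf := (TopCat.subsheafToTypes p).property
  action U :=
    { smul := fun a s => ⟨fun x => X.germ x.1 x.2 a • s.1 x, hp U.unop a s.1 s.2⟩
      one_smul := fun s => Subtype.ext (funext fun x => by
        change X.germ x.1 x.2 1 • s.1 x = s.1 x
        rw [X.germ_one, one_smul])
      mul_smul := fun a b s => Subtype.ext (funext fun x => by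
        change X.germ x.1 x.2 (a * b) • s.1 x = X.germ x.1 x.2 a • X.germ x.1 x.2 b • s.1 x
        rw [X.germ_mul, mul_smul]) }
  map_smul {U V} i a s := Subtype.ext (funext fun x => congrArg (· • s.1 (i.unop x))
    (X.germ_map i.unop x.1 x.2 a).symm)

end Modules
end LMS

namespace LMS

variable {X Y Z : LMS.{u}}

/-- The map `M_Y(V) → M_X(f⁻¹ V)`. -/
abbrev app (f : X ⟶ Y) (V : (Opens Y)ᵒᵖ) :
    Y.str.obj V →* X.str.obj (op ((Opens.map f.hom.base).obj V.unop)) :=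
  (f.hom.c.app V).hom

lemma stalkHom_germ (f : X ⟶ Y) {V : Opens Y} (x : X) (hx : f.hom.base x ∈ V)
    (s : Y.str.obj (op V)) :
    stalkHom f x (Y.germ _ hx s) = X.germ (U := (Opens.map f.hom.base).obj V) x hx (app f (op V) s) :=
  PresheafedSpace.stalkMap_germ_apply f.hom V x hx s

namespace Modules

/-- The pushforward `f_*` of modules: `(f_* F)(V) = F(f⁻¹ V)`. -/
def pushforward (f : X ⟶ Y) : X.Modules ⥤ Y.Modules where
  obj F :=
    { presheaf := (TopCat.Presheaf.pushforward _ f.hom.base).obj F.presheaf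
      isSheaf := TopCat.Sheaf.pushforward_sheaf_of_sheaf _ F.isSheaf
      action := fun V => MulAction.compHom
        (F.presheaf.obj (op ((Opens.map f.hom.base).obj V.unop))) (app f V)
      map_smul := fun {U V} i a s => by
        refine (F.map_smul ((Opens.map f.hom.base).op.map i) (app f U a) s).trans ?_
        exact congrArg (· • F.presheaf.map ((Opens.map f.hom.base).op.map i) s)
          (ConcreteCategory.congr_hom (f.hom.c.naturality i) a).symm }
  map φ :=
    { hom := (TopCat.Presheaf.pushforward _ f.hom.base).map φ.hom
      map_smul := fun V a s => φ.map_smul _ (app f V a) s }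
  map_id _ := rfl
  map_comp _ _ := rfl

/-- `M_{X, x} ⊗ F_{f x}` over `M_{Y, f x}`, the stalk of `f^* F` at `x`. -/
abbrev PullbackStalk (f : X ⟶ Y) (F : Y.Modules) (x : X) : Type u :=
  Tensor (stalkHom f x) (F.stalk (f.hom.base x))

/-- The families `x ↦ a_x ⊗ m_{f x}` for a section `a` of `M_X` and a section `m` of `F`. -/
def pullbackPred (f : X ⟶ Y) (F : Y.Modules) :
    TopCat.PrelocalPredicate (X := X.toPresheafedSpace.carrier) (PullbackStalk f F) where
  pred {U} t := ∃ (V : Opens Y) (hV : U ≤ (Opens.map f.hom.base).obj V) (a : X.str.obj (op U))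
    (m : F.presheaf.obj (op V)), ∀ x : U,
      t x = Tensor.mk (stalkHom f x.1) (X.germ x.1 x.2 a) (F.germ (f.hom.base x.1) (hV x.2) m)
  res {U U'} i t := by
    rintro ⟨V, hV, a, m, h⟩
    refine ⟨V, i.le.trans hV, X.str.map i.op a, m, fun x => (h (i x)).trans ?_⟩
    rw [X.germ_map i x.1 x.2 a]; rfl

/-- The pullback `f^* F`: its sections over `U` are the families of elements of
`M_{X, x} ⊗ F_{f x}`, `x ∈ U`, that are locally of the form `x ↦ a_x ⊗ m_{f x}`. -/
def pullbackObj (f : X ⟶ Y) (F : Y.Modules) : X.Modules :=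
  ofLocalPredicate (PullbackStalk f F) (pullbackPred f F).sheafify (by
    intro U a t ht x
    obtain ⟨W, hW, i, V, hV, b, m, h⟩ := ht x
    refine ⟨W, hW, i, V, hV, X.str.map i.op a * b, m, fun y => ?_⟩
    refine (congrArg (X.germ (i y).1 (i y).2 a • ·) (h y)).trans ?_
    rw [Tensor.smul_mk, X.germ_mul, X.germ_map]; rfl)

section
variable (f : X ⟶ Y) (F : Y.Modules) (G : X.Modules)

lemma germ_pushforward_smul {V : Opens Y} (x : X) (hx : f.hom.base x ∈ V) (a : Y.str.obj (op V))
    (s : ((pushforward f).obj G).presheaf.obj (op V)) :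
    G.germ (U := (Opens.map f.hom.base).obj V) x hx (a • s : ((pushforward f).obj G).presheaf.obj (op V)) =
      stalkHom f x (Y.germ _ hx a) • G.germ (U := (Opens.map f.hom.base).obj V) x hx s := by
  rw [stalkHom_germ]
  exact G.germ_smul (U := (Opens.map f.hom.base).obj V) x hx (app f (op V) a) s

variable {f F G}

/-- The map `F_{f x} → G_x` given by a morphism `F ⟶ f_* G`. -/
def adjStalkMap (φ : F ⟶ (pushforward f).obj G) (x : X) : F.stalk (f.hom.base x) → G.stalk x :=
  fun m => G.presheaf.stalkPushforward (Type u) f.hom.base x (stalkMap φ (f.hom.base x) m)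

lemma adjStalkMap_germ (φ : F ⟶ (pushforward f).obj G) (x : X) {V : Opens Y}
    (hx : f.hom.base x ∈ V) (m : F.presheaf.obj (op V)) :
    adjStalkMap φ x (F.germ _ hx m) =
      G.germ (U := (Opens.map f.hom.base).obj V) x hx (φ.hom.app (op V) m) := by
  rw [adjStalkMap, stalkMap_germ]
  exact ConcreteCategory.congr_hom
    (TopCat.Presheaf.stalkPushforward_germ (Type u) f.hom.base G.presheaf V x hx) _

lemma adjStalkMap_smul (φ : F ⟶ (pushforward f).obj G) (x : X) (a : Y.str.stalk (f.hom.base x))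
    (m : F.stalk (f.hom.base x)) :
    adjStalkMap φ x (a • m) = stalkHom f x a • adjStalkMap φ x m := by
  obtain ⟨U, hU, s, rfl⟩ := Y.exists_germ _ a
  obtain ⟨V, hV, t, rfl⟩ := F.exists_germ _ m
  let T : Opens Y := U ⊓ V
  have hT : f.hom.base x ∈ T := ⟨hU, hV⟩
  rw [← Y.germ_map (homOfLE inf_le_left : T ⟶ U) _ hT,
    ← F.germ_map (homOfLE inf_le_right : T ⟶ V) _ hT, ← germ_smul, adjStalkMap_germ,
    adjStalkMap_germ, φ.map_smul]
  exact germ_pushforward_smul f G x hT _ _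

/-- The map `M_{X, x} ⊗ F_{f x} → G_x` given by a morphism `F ⟶ f_* G`. -/
def adjTensorMap (φ : F ⟶ (pushforward f).obj G) (x : X) : PullbackStalk f F x → G.stalk x :=
  Tensor.lift (fun a m => a • adjStalkMap φ x m) (by
    intro a b m; rw [adjStalkMap_smul, mul_smul])

lemma adjTensorMap_smul (φ : F ⟶ (pushforward f).obj G) (x : X) (a : X.str.stalk x)
    (t : PullbackStalk f F x) : adjTensorMap φ x (a • t) = a • adjTensorMap φ x t := by
  induction t using Tensor.ind with
  | H p m => exact mul_smul a p _

lemma exists_adjSection (φ : F ⟶ (pushforward f).obj G) {U : Opens X}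
    (t : (pullbackObj f F).presheaf.obj (op U)) :
    ∃ s : G.presheaf.obj (op U), ∀ x : U, G.germ x.1 x.2 s = adjTensorMap φ x.1 (t.1 x) := by
  refine G.exists_section (fun x => adjTensorMap φ x.1 (t.1 x)) fun x => ?_
  obtain ⟨W, hW, i, V, hV, b, m, h⟩ := t.2 x
  refine ⟨W, hW, i, b • G.presheaf.map (homOfLE hV).op (φ.hom.app (op V) m), fun y => ?_⟩
  have h' : t.1 (i y) = _ := h y
  rw [h', germ_smul]
  refine congrArg (X.germ y.1 y.2 b • ·) ?_
  refine (G.germ_map (homOfLE hV) y.1 y.2 _).trans ?_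
  exact (adjStalkMap_germ φ y.1 (hV y.2) m).symm

/-- The section of `G` given by a section of `f^* F` and a morphism `F ⟶ f_* G`. -/
def adjSection (φ : F ⟶ (pushforward f).obj G) {U : Opens X}
    (t : (pullbackObj f F).presheaf.obj (op U)) : G.presheaf.obj (op U) :=
  (exists_adjSection φ t).choose

lemma germ_adjSection (φ : F ⟶ (pushforward f).obj G) {U : Opens X}
    (t : (pullbackObj f F).presheaf.obj (op U)) (x : X) (hx : x ∈ U) :
    G.germ x hx (adjSection φ t) = adjTensorMap φ x (t.1 ⟨x, hx⟩) :=
  (exists_adjSection φ t).choose_spec ⟨x, hx⟩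

variable (f F) in
/-- The section `x ↦ 1 ⊗ m_{f x}` of the pullback over `f⁻¹ V`. -/
def pullbackSection {V : Opens Y} (m : F.presheaf.obj (op V)) :
    (pullbackObj f F).presheaf.obj (op ((Opens.map f.hom.base).obj V)) :=
  ⟨fun x => Tensor.mk (stalkHom f x.1) 1 (F.germ (f.hom.base x.1) x.2 m), fun x =>
    ⟨_, x.2, 𝟙 _, V, le_rfl, 1, m, fun y => by rw [X.germ_one]; rfl⟩⟩

lemma pullbackSection_smul {V : Opens Y} (a : Y.str.obj (op V)) (m : F.presheaf.obj (op V)) :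
    pullbackSection f F (a • m) =
      app f (op V) a • pullbackSection f F m := by
  refine Subtype.ext (funext fun x => ?_)
  have hx : f.hom.base x.1 ∈ V := x.2
  have e : Tensor.mk (stalkHom f x.1) 1 (F.germ (f.hom.base x.1) hx (a • m)) =
      X.germ (U := (Opens.map f.hom.base).obj V) x.1 x.2 (app f (op V) a) •
        Tensor.mk (stalkHom f x.1) 1 (F.germ (f.hom.base x.1) hx m) := by
    rw [germ_smul, ← Tensor.mk_mul, Tensor.smul_mk, one_mul, mul_one, stalkHom_germ]
  exact e

lemma pullbackSection_map {V W : Opens Y} (i : W ⟶ V) (m : F.presheaf.obj (op V)) :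
    pullbackSection f F (F.presheaf.map i.op m) =
      (pullbackObj f F).presheaf.map ((Opens.map f.hom.base).map i).op (pullbackSection f F m) :=
  Subtype.ext (funext fun x =>
    congrArg (Tensor.mk (stalkHom f x.1) 1) (F.germ_map i (f.hom.base x.1) x.2 m))

lemma exists_map_eq {U : Opens X} (t : (pullbackObj f F).presheaf.obj (op U)) (x : X)
    (hx : x ∈ U) :
    ∃ (W : Opens X) (_ : x ∈ W) (i : W ⟶ U) (V : Opens Y) (j : W ⟶ (Opens.map f.hom.base).obj V)
      (b : X.str.obj (op W)) (m : F.presheaf.obj (op V)),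
      (pullbackObj f F).presheaf.map i.op t =
        b • (pullbackObj f F).presheaf.map j.op (pullbackSection f F m) := by
  obtain ⟨W, hW, i, V, hV, b, m, h⟩ := t.2 ⟨x, hx⟩
  refine ⟨W, hW, i, V, homOfLE hV, b, m, Subtype.ext (funext fun y => (h y).trans ?_)⟩
  have e : Tensor.mk (stalkHom f y.1) (X.germ y.1 y.2 b) (F.germ (f.hom.base y.1) (hV y.2) m) =
      X.germ y.1 y.2 b • Tensor.mk (stalkHom f y.1) 1 (F.germ (f.hom.base y.1) (hV y.2) m) := by
    rw [Tensor.smul_mk, mul_one]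
  exact e

/-- The morphism `F ⟶ f_* G` given by a morphism `f^* F ⟶ G`. -/
def pullbackToFun (ψ : pullbackObj f F ⟶ G) : F ⟶ (pushforward f).obj G where
  hom :=
    { app := fun V => ↾ fun m => ψ.hom.app _ (pullbackSection f F (V := V.unop) m)
      naturality := fun V W i => by
        refine ConcreteCategory.hom_ext _ _ fun m => ?_
        refine Eq.trans ?_ (naturality_apply ψ ((Opens.map f.hom.base).op.map i)
          (pullbackSection f F (V := V.unop) m))
        exact congrArg (ψ.hom.app _) (pullbackSection_map i.unop m) }
  map_smul V a m := (congrArg (ψ.hom.app _) (pullbackSection_smul (V := V.unop) a m)).trans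
    (ψ.map_smul _ (app f V a) (pullbackSection f F (V := V.unop) m))

/-- The morphism `f^* F ⟶ G` given by a morphism `F ⟶ f_* G`. -/
def pullbackInvFun (φ : F ⟶ (pushforward f).obj G) : pullbackObj f F ⟶ G where
  hom :=
    { app := fun U => ↾ fun t => adjSection (U := U.unop) φ t
      naturality := fun U V i => by
        refine ConcreteCategory.hom_ext _ _ fun t => G.section_ext (U := V.unop) fun x hx => ?_
        refine (germ_adjSection (U := V.unop) φ _ x hx).trans ?_
        exact ((G.germ_map i.unop x hx _).trans (germ_adjSection (U := U.unop) φ t x _)).symm }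
  map_smul U a t := by
    refine G.section_ext (U := U.unop) fun x hx => ?_
    refine (germ_adjSection (U := U.unop) φ _ x hx).trans ?_
    refine Eq.trans ?_ (germ_smul G (U := U.unop) x hx _ _).symm
    refine (adjTensorMap_smul φ x _ _).trans ?_
    exact congrArg (X.germ (U := U.unop) x hx a • ·) (germ_adjSection (U := U.unop) φ t x hx).symm

lemma pullback_hom_ext {ψ ψ' : pullbackObj f F ⟶ G}
    (h : ∀ (V : Opens Y) (m : F.presheaf.obj (op V)),
      ψ.hom.app _ (pullbackSection f F m) = ψ'.hom.app _ (pullbackSection f F m)) : ψ = ψ' := by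
  refine hom_ext fun U t => G.section_ext fun x hx => ?_
  obtain ⟨W, hW, i, V, j, b, m, e⟩ := exists_map_eq t x hx
  rw [← G.germ_map i x hW, ← G.germ_map i x hW, ← naturality_apply, ← naturality_apply, e,
    ψ.map_smul, ψ'.map_smul, naturality_apply, naturality_apply, h]

lemma pullbackInvFun_app_pullbackSection (φ : F ⟶ (pushforward f).obj G) {V : Opens Y}
    (m : F.presheaf.obj (op V)) :
    (pullbackInvFun φ).hom.app _ (pullbackSection f F m) = φ.hom.app (op V) m := by
  refine G.section_ext (U := (Opens.map f.hom.base).obj V) fun x hx => ?_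
  refine (germ_adjSection φ _ x hx).trans ?_
  refine (one_smul (X.str.stalk x) (adjStalkMap φ x (F.germ (f.hom.base x) hx m))).trans ?_
  exact adjStalkMap_germ φ x hx m

variable (f F G) in
/-- Morphisms `f^* F ⟶ G` are the same as morphisms `F ⟶ f_* G`. -/
def pullbackHomEquiv : (pullbackObj f F ⟶ G) ≃ (F ⟶ (pushforward f).obj G) where
  toFun := pullbackToFun
  invFun := pullbackInvFun
  left_inv ψ := pullback_hom_ext fun _ m => pullbackInvFun_app_pullbackSection (pullbackToFun ψ) m
  right_inv φ := hom_ext fun _ m => pullbackInvFun_app_pullbackSection φ m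

end

/-- The pullback functor `f^*`, with the values `pullbackObj f F`. -/
def pullback (f : X ⟶ Y) : Y.Modules ⥤ X.Modules :=
  Adjunction.leftAdjointOfEquiv (F_obj := pullbackObj f) (G := pushforward f)
    (fun F G => pullbackHomEquiv f F G) (fun _ _ _ _ _ => rfl)

/-- `f^*` is left adjoint to `f_*`. -/
def pullbackAdj (f : X ⟶ Y) : pullback f ⊣ pushforward f :=
  Adjunction.adjunctionOfEquivLeft _ _

end Modules
end LMS

namespace LMS
namespace Modules
variable {X Y Z W : LMS.{u}}

/-- `g_* f_* = (g f)_*`. -/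
def pushforwardComp (f : X ⟶ Y) (g : Y ⟶ Z) :
    pushforward f ⋙ pushforward g ≅ pushforward (f ≫ g) :=
  NatIso.ofComponents (fun _ =>
    { hom := { hom := { app := fun _ => 𝟙 _, naturality := fun _ _ _ => rfl }
               map_smul := fun _ _ _ => rfl }
      inv := { hom := { app := fun _ => 𝟙 _, naturality := fun _ _ _ => rfl }
               map_smul := fun _ _ _ => rfl }
      hom_inv_id := rfl
      inv_hom_id := rfl }) (fun _ => rfl)

/-- `id_* = id`. -/
def pushforwardId (X : LMS.{u}) : pushforward (𝟙 X) ≅ 𝟭 X.Modules :=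
  NatIso.ofComponents (fun _ =>
    { hom := { hom := { app := fun _ => 𝟙 _, naturality := fun _ _ _ => rfl }
               map_smul := fun _ _ _ => rfl }
      inv := { hom := { app := fun _ => 𝟙 _, naturality := fun _ _ _ => rfl }
               map_smul := fun _ _ _ => rfl }
      hom_inv_id := rfl
      inv_hom_id := rfl }) (fun _ => rfl)

/-- The canonical isomorphism `f^* g^* ≅ (g f)^*`, adjoint to `g_* f_* = (g f)_*`. -/
def pullbackComp (f : X ⟶ Y) (g : Y ⟶ Z) : pullback g ⋙ pullback f ≅ pullback (f ≫ g) :=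
  Adjunction.leftAdjointCompIso (pullbackAdj g) (pullbackAdj f) (pullbackAdj (f ≫ g))
    (pushforwardComp f g)

/-- The canonical isomorphism `id^* ≅ id`. -/
def pullbackId (X : LMS.{u}) : pullback (𝟙 X) ≅ 𝟭 X.Modules :=
  (pullbackAdj (𝟙 X)).leftAdjointIdIso (pushforwardId X)

lemma pullback_assoc (f : X ⟶ Y) (g : Y ⟶ Z) (h : Z ⟶ W) :
    Functor.isoWhiskerLeft _ (pullbackComp f g) ≪≫ pullbackComp (f ≫ g) h =
      (Functor.associator _ _ _).symm ≪≫
        Functor.isoWhiskerRight (pullbackComp g h) (pullback f) ≪≫ pullbackComp f (g ≫ h) :=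
  Adjunction.leftAdjointCompIso_assoc _ _ _ _ _ _ _ _ _ _ rfl

lemma pullback_id_comp (f : X ⟶ Y) :
    pullbackComp f (𝟙 Y) =
      Functor.isoWhiskerRight (pullbackId Y) (pullback f) ≪≫ Functor.leftUnitor _ :=
  Adjunction.leftAdjointCompIso_id_comp _ _ _ _ rfl

lemma pullback_comp_id (f : X ⟶ Y) :
    pullbackComp (𝟙 X) f =
      Functor.isoWhiskerLeft (pullback f) (pullbackId X) ≪≫ Functor.rightUnitor _ :=
  Adjunction.leftAdjointCompIso_comp_id _ _ _ _ rfl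

lemma pseudofunctor_assoc (f : X ⟶ Y) (g : Y ⟶ Z) (h : Z ⟶ W) :
    (pullbackComp f (g ≫ h)).inv ≫
      Functor.whiskerRight (pullbackComp g h).inv _ ≫ (Functor.associator _ _ _).hom ≫
        Functor.whiskerLeft _ (pullbackComp f g).hom ≫ (pullbackComp (f ≫ g) h).hom = 𝟙 _ := by
  let e₁ := pullbackComp f (g ≫ h)
  let e₂ := Functor.isoWhiskerRight (pullbackComp g h) (pullback f)
  let e₃ := Functor.isoWhiskerLeft (pullback h) (pullbackComp f g)
  let e₄ : pullback h ⋙ pullback (f ≫ g) ≅ pullback (f ≫ g ≫ h) := pullbackComp (f ≫ g) h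
  change e₁.inv ≫ e₂.inv ≫ (Functor.associator _ _ _).hom ≫ e₃.hom ≫ e₄.hom = 𝟙 (pullback (f ≫ g ≫ h))
  have : e₃.hom ≫ e₄.hom = (Functor.associator _ _ _).inv ≫ e₂.hom ≫ e₁.hom :=
    congrArg Iso.hom (pullback_assoc f g h)
  rw [this, Iso.hom_inv_id_assoc, Iso.inv_hom_id_assoc, Iso.inv_hom_id]

lemma pseudofunctor_left_unit (f : X ⟶ Y) :
    (pullbackComp f (𝟙 Y)).inv ≫ Functor.whiskerRight (pullbackId Y).hom (pullback f) ≫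
      (Functor.leftUnitor _).hom = 𝟙 _ := by
  have : (pullbackComp f (𝟙 Y)).hom =
      Functor.whiskerRight (pullbackId Y).hom (pullback f) ≫ (Functor.leftUnitor _).hom :=
    congrArg Iso.hom (pullback_id_comp f)
  rw [← this]
  exact (pullbackComp f (𝟙 Y)).inv_hom_id

lemma pseudofunctor_right_unit (f : X ⟶ Y) :
    (pullbackComp (𝟙 X) f).inv ≫ Functor.whiskerLeft (pullback f) (pullbackId X).hom ≫
      (Functor.rightUnitor _).hom = 𝟙 _ := by
  have : (pullbackComp (𝟙 X) f).hom =
      Functor.whiskerLeft (pullback f) (pullbackId X).hom ≫ (Functor.rightUnitor _).hom :=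
    congrArg Iso.hom (pullback_comp_id f)
  rw [← this]
  exact (pullbackComp (𝟙 X) f).inv_hom_id

/-- The pseudofunctor `X ↦ Mod(X)`, `f ↦ f^*`. -/
def pseudofunctor : Pseudofunctor (LocallyDiscrete LMS.{u}ᵒᵖ) Cat.{u, u + 1} :=
  LocallyDiscrete.mkPseudofunctor
    (fun X => Cat.of X.unop.Modules)
    (fun f => (pullback f.unop).toCatHom)
    (fun X => Cat.Hom.isoMk (pullbackId X.unop))
    (fun f g => Cat.Hom.isoMk (pullbackComp g.unop f.unop).symm)
    (fun f g h => Cat.Hom₂.ext (pseudofunctor_assoc h.unop g.unop f.unop))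
    (fun f => Cat.Hom₂.ext (pseudofunctor_left_unit f.unop))
    (fun f => Cat.Hom₂.ext (pseudofunctor_right_unit f.unop))

end Modules
end LMS

namespace Spec
variable {P : Type u} [CommMonoid P]

/-- The germ at `F` of the global section of the structure sheaf given by an element of `P`. -/
def toStalk (F : Spec P) : P →* (Spec P).str.stalk F :=
  ((Spec P).str.germ ⊤ F trivial).hom.comp
    { toFun := fun p => ⟨fun _ => Localization.mk p 1, fun _ =>
        ⟨⊤, trivial, Opens.leTop _, p, 1, fun G' => ⟨G'.1.1.one_mem, rfl⟩⟩⟩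
      map_one' := Subtype.ext (funext fun _ => Localization.mk_one)
      map_mul' := fun a b => Subtype.ext (funext fun G =>
        (congrArg (Localization.mk (a * b)) (mul_one (1 : G.1.1)).symm).trans
          (Localization.mk_mul a b (1 : G.1.1) 1).symm) }

/-- The families `F ↦ a_F ⊗ m` for a section `a` of the structure sheaf and `m : M`. -/
def tildePred (M : PMod P) : TopCat.PrelocalPredicate (X := (Spec P).toPresheafedSpace.carrier)
    (fun F => Tensor (toStalk F) M) where
  pred {U} t := ∃ (a : (Spec P).str.obj (op U)) (m : M), ∀ F : U,
    t F = Tensor.mk (toStalk F.1) ((Spec P).germ F.1 F.2 a) m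
  res {U U'} i t := by
    rintro ⟨a, m, h⟩
    refine ⟨(Spec P).str.map i.op a, m, fun F => (h (i F)).trans ?_⟩
    rw [(Spec P).germ_map i F.1 F.2 a]; rfl

/-- The module on `Spec P` associated with a `P`-module `M`, i.e. the tensor product over the
constant sheaf `P` of the structure sheaf and the constant sheaf `M`. -/
def tilde (M : PMod P) : (Spec P).Modules :=
  LMS.Modules.ofLocalPredicate (fun F => Tensor (toStalk F) M) (tildePred M).sheafify (by
    intro U a t ht x
    obtain ⟨W, hW, i, b, m, h⟩ := ht x
    refine ⟨W, hW, i, (Spec P).str.map i.op a * b, m, fun y => ?_⟩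
    refine (congrArg ((Spec P).germ (i y).1 (i y).2 a • ·) (h y)).trans ?_
    rw [Tensor.smul_mk, LMS.germ_mul, LMS.germ_map]; rfl)

end Spec

namespace LMS

/-- `f` is an isomorphism onto an open subspace. -/
def IsOpenEmbedding {X Y : LMS.{u}} (f : X ⟶ Y) : Prop :=
  PresheafedSpace.IsOpenImmersion f.hom

/-- `X` is a locally finite type fan: it is covered by open subspaces isomorphic to `Spec P` with
`P` finitely generated. -/
def IsLocFinTypeFan (X : LMS.{u}) : Prop :=
  ∀ x : X, ∃ (P : Type u) (_ : CommMonoid P) (j : Spec P ⟶ X),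
    Monoid.FG P ∧ IsOpenEmbedding j ∧ x ∈ Set.range j.hom.base

/-- `f` is flat: all maps `M_{Y, f x} → M_{X, x}` are flat. -/
def IsFlat {X Y : LMS.{u}} (f : X ⟶ Y) : Prop :=
  ∀ x : X, IsFlatHom (stalkHom f x)

/-- `f` is a flat cover: it is flat and surjective. -/
def IsFlatCover {X Y : LMS.{u}} (f : X ⟶ Y) : Prop :=
  IsFlat f ∧ Function.Surjective f.hom.base

namespace Modules

/-- `F` is quasi-coherent: `X` is covered by affine open subspaces `Spec P` on which `F` is
isomorphic to the module associated with a `P`-module. -/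
def IsQCoh {X : LMS.{u}} (F : X.Modules) : Prop :=
  ∀ x : X, ∃ (P : Type u) (_ : CommMonoid P) (j : Spec P ⟶ X) (M : PMod P),
    IsOpenEmbedding j ∧ x ∈ Set.range j.hom.base ∧
      Nonempty ((pullback j).obj F ≅ Spec.tilde M)

end Modules

/-- The category of quasi-coherent modules on `X`. -/
abbrev QCoh (X : LMS.{u}) : Type (u + 1) :=
  ObjectProperty.FullSubcategory (fun F : X.Modules => F.IsQCoh)

variable {X Y : LMS.{u}} (f : X ⟶ Y)

/-- Modules on `X` with a descent datum relative to `f : X ⟶ Y`: modules `N` on `X` with compatible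
isomorphisms `p₁^* N ≅ p₂^* N` for all `T` and all `p₁ p₂ : T ⟶ X` with `f p₁ = f p₂`, which satisfy
the cocycle condition for all triples `p₁ p₂ p₃`. -/
abbrev ModDescent : Type (u + 1) :=
  Modules.pseudofunctor.{u}.DescentData (fun _ : Unit => f)

/-- The underlying module on `X`. -/
def ModDescent.sheaf {f : X ⟶ Y} (D : ModDescent f) : X.Modules := D.obj ()

/-- The functor from modules on `Y` to modules on `X` with a descent datum which sends `M` to `f^* M`
with the canonical isomorphisms `p₁^* f^* M ≅ (f p₁)^* M = (f p₂)^* M ≅ p₂^* f^* M`. -/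
def toModDescent : Y.Modules ⥤ ModDescent f :=
  Modules.pseudofunctor.{u}.toDescentData (fun _ : Unit => f)

/-- Quasi-coherent modules on `X` with a descent datum relative to `f`. -/
abbrev QCohDescent : Type (u + 1) :=
  ObjectProperty.FullSubcategory (fun D : ModDescent f => D.sheaf.IsQCoh)

/-- The functor from quasi-coherent modules on `Y` to quasi-coherent modules on `X` with a descent
datum induced by `f^*`. -/
def toQCohDescent (hf : ∀ M : Y.Modules, M.IsQCoh → ((Modules.pullback f).obj M).IsQCoh) :
    QCoh Y ⥤ QCohDescent f :=
  ObjectProperty.lift _ (ObjectProperty.ι _ ⋙ toModDescent f) (fun M => hf M.obj M.property)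

section FibreProduct
variable {f} (sq : Limits.ChosenPullback f f) (sq₃ : Limits.ChosenPullback₃ sq sq sq)

/-- Modules `N` on `X` with an isomorphism `π₁^* N ≅ π₂^* N` on a given fibre product `X ×_Y X` which
satisfies the cocycle condition on a given triple fibre product `X ×_Y X ×_Y X`. -/
abbrev ModFibreDescent : Type (u + 1) :=
  Modules.pseudofunctor.{u}.DescentData' (f := fun _ : Unit => f) (fun _ _ => sq)
    (fun _ _ _ => sq₃)

variable {sq sq₃} in
/-- The underlying module on `X`. -/
def ModFibreDescent.sheaf (D : ModFibreDescent sq sq₃) : X.Modules := D.obj ()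

/-- The functor which sends a module `M` on `Y` to `f^* M` with the canonical isomorphism
`π₁^* f^* M ≅ π₂^* f^* M` on the given fibre product. -/
def toModFibreDescent : Y.Modules ⥤ ModFibreDescent sq sq₃ :=
  toModDescent f ⋙ Pseudofunctor.DescentData'.fromDescentDataFunctor _ _ _

/-- Quasi-coherent modules on `X` with a descent datum on the given fibre product. -/
abbrev QCohFibreDescent : Type (u + 1) :=
  ObjectProperty.FullSubcategory (fun D : ModFibreDescent sq sq₃ => D.sheaf.IsQCoh)

/-- The functor from quasi-coherent modules on `Y` to quasi-coherent modules on `X` with a descent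
datum on the given fibre product. -/
def toQCohFibreDescent
    (hf : ∀ M : Y.Modules, M.IsQCoh → ((Modules.pullback f).obj M).IsQCoh) :
    QCoh Y ⥤ QCohFibreDescent sq sq₃ :=
  ObjectProperty.lift _ (ObjectProperty.ι _ ⋙ toModFibreDescent sq sq₃)
    (fun M => hf M.obj M.property)

end FibreProduct

end LMS

end MonoidFan

end

/-! Every element of P ⊗_Q M is a pure tensor, and for flat h : Q → P equality of pure tensors is a
one-step relation. Flatness enters only through an equational criterion (`IsEqFlat`): a h(q) = b
h(r) forces a = c h(s), b = c h(s') with s q = s' r, and for a = b one can take s = s'. Free modules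
satisfy it because coordinates are unique, and filtered colimits inherit it. It follows that a ⊗ m =
b ⊗ n exactly when a = c h(q), b = c h(r), q m = r n (`Tensor.mk_eq_iff`), and P ⊕_Q R has a similar
description (`Pushout.mul_eq_iff`). Faithful flatness adds that h is local: in an equation 1 = c
h(q) the element q is a unit. This gives injectivity of M → P ⊗_Q M, stability under base change and
descent of elements.

For (1), a flat cover Spec P → Spec Q hits the closed point, so h is local, and the stalk map at the
closed point is h itself. Bijectivity of the unit is descent of elements. For the counit let φ(1 ⊗
n) = p ⊗ m. The cocycle condition says p ⊗ φ(1 ⊗ m) = p ⊗ (1 ⊗ m), hence p = c h(q) = c h(r) with q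
(1 ⊗ m) = r φ(1 ⊗ m). The case a = b of flatness gives c = d h(s) with s q = s r; then h(s q) m lies
in the equalizer and n is d times it (`DescentMod.exists_eq_smul`). Injectivity comes from applying
φ to a relation a g = b g' (`DescentMod.exists_of_smul_eq`).

For (2), descent is proved for all modules, along every f satisfying `IsDescentMap`, and then
restricted. No fibre product is constructed. A descent datum is tested on one-point spaces with a
monoid A, whose maps to X are points x with a local map M_{X,x} → A, and on Sierpiński spaces, which
record generization. Elements of N_{x₁} and N_{x₂} match if all these tests identify them. Since the
stalk maps are faithfully flat, matching is transitive on a fibre of f, partners are unique, and an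
element that matches itself has a partner at every point of its fibre. The descended module consists
of the sections of f_* N whose germs match along fibres. Its stalk at f(x) is the equalizer in N_x:
an element that matches itself spreads over the smallest neighbourhood of f(x) because generizations
lift along f. So on stalks f^* G(N) → N is the counit of (1).

On locally finite type fans smallest neighbourhoods exist, generizations of x correspond to faces of
M_{X,x}, and flatness lifts them (`IsEqFaithfullyFlat.mem_map_iff`). Quasi-coherent modules are the
cartesian ones, those with M_{X,x'} ⊗ F_x ≅ F_{x'} for all generizations x' of x, a property that is
preserved by pullback and reflected along f. Descent data on a chosen fibre product are formally
equivalent to those on all T. -/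

noncomputable section

namespace MonoidFan

/-! ### Equational flatness and equality of tensors -/

section Flatness
variable {P Q R S : Type u} [CommMonoid P] [CommMonoid Q] [CommMonoid R] [CommMonoid S]

/-- The equational criterion for flatness of `h`. -/
structure IsEqFlat (h : Q →* P) : Prop where
  eq_mul : ∀ (a b : P) (q r : Q), a * h q = b * h r →
    ∃ (c : P) (s s' : Q), a = c * h s ∧ b = c * h s' ∧ s * q = s' * r
  eq_self : ∀ (a : P) (q r : Q), a * h q = a * h r →
    ∃ (c : P) (s : Q), a = c * h s ∧ s * q = s * r

/-- The equational criterion for faithful flatness of `h`. -/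
structure IsEqFaithfullyFlat (h : Q →* P) : Prop extends IsEqFlat h where
  isUnit : ∀ q, IsUnit (h q) → IsUnit q

namespace Tensor
variable {h : Q →* P} {M N : Type u} [MulAction Q M] [MulAction Q N]

/-- The relation on the right contains the generating pairs and is reflexive and symmetric. It is
transitive by `eq_mul`: two factorizations c h(r) = c' h(q') of the middle element have a common
refinement d. Hence it is the generated equivalence relation. -/
lemma mk_eq_iff (hh : IsEqFlat h) {a b : P} {m n : M} :
    mk h a m = mk h b n ↔ ∃ (c : P) (q r : Q), a = c * h q ∧ b = c * h r ∧ q • m = r • n := by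
  constructor
  · intro e
    have e' := Quot.eqvGen_exact e
    suffices H : ∀ x y : P × M, Relation.EqvGen (TensorRel h M) x y →
        ∃ (c : P) (q r : Q), x.1 = c * h q ∧ y.1 = c * h r ∧ q • x.2 = r • y.2 from H _ _ e'
    intro x y hxy
    induction hxy with
    | rel x y hxy =>
      obtain ⟨p, q, m⟩ := hxy
      exact ⟨p, q, 1, rfl, by simp, by simp⟩
    | refl x => exact ⟨x.1, 1, 1, by simp, by simp, rfl⟩
    | symm x y _ ih =>
      obtain ⟨c, q, r, h1, h2, h3⟩ := ih
      exact ⟨c, r, q, h2, h1, h3.symm⟩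
    | trans x y z _ _ ih ih' =>
      obtain ⟨c, q, r, h1, h2, h3⟩ := ih
      obtain ⟨c', q', r', h1', h2', h3'⟩ := ih'
      obtain ⟨d, s, s', rfl, rfl, e⟩ := hh.eq_mul _ _ _ _ (h2.symm.trans h1')
      refine ⟨d, s * q, s' * r', by rw [h1, map_mul, mul_assoc], by rw [h2', map_mul, mul_assoc],
        ?_⟩
      rw [mul_smul, h3, ← mul_smul, e, mul_smul, h3', mul_smul]
  · rintro ⟨c, q, r, rfl, rfl, e⟩
    rw [mk_mul, mk_mul, e]

/-- From 1 = c h(q) = c h(r) locality makes q a unit, and `eq_self` together with locality gives q =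
r, which can then be cancelled. -/
lemma mk_one_injective (hh : IsEqFaithfullyFlat h) {m n : M} (e : mk h 1 m = mk h 1 n) :
    m = n := by
  obtain ⟨c, q, r, h1, h2, e⟩ := (mk_eq_iff hh.toIsEqFlat).1 e
  obtain ⟨d, s, rfl, e'⟩ := hh.eq_self _ _ _ (h1.symm.trans h2)
  have hq : IsUnit q := hh.isUnit _ (IsUnit.of_mul_eq_one (d * h s) (by rw [mul_comm]; exact h1.symm))
  have hs : IsUnit s := hh.isUnit _ (IsUnit.of_mul_eq_one (d * h q) (by rw [h1]; ac_rfl))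
  obtain rfl : q = r := hs.mul_left_cancel e'
  exact hq.smul_left_cancel.1 e

/-- The map `P ⊗_Q M → R ⊗_Q M` induced by `j : P →* R`. -/
def map (j : P →* R) {l : Q →* R} (hl : j.comp h = l) : Tensor h M → Tensor l M :=
  lift (fun p m => mk l (j p) m) (by intro p q m; subst hl; rw [map_mul, ← mk_mul]; rfl)

@[simp] lemma map_mk (j : P →* R) {l : Q →* R} (hl : j.comp h = l) (p : P) (m : M) :
    map j hl (mk h p m) = mk l (j p) m := rfl

lemma map_smul (j : P →* R) {l : Q →* R} (hl : j.comp h = l) (p : P) (t : Tensor h M) :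
    map j hl (p • t) = j p • map j hl t := by
  induction t using ind with | H p' m => simp

lemma smul_mk_one (p : P) (m : M) : p • mk h 1 m = mk h p m := by simp

lemma mk_one_smul (q : Q) (m : M) : mk h 1 (q • m) = h q • mk h 1 m := by
  rw [← mk_mul, smul_mk]; simp

/-- Under R ⊗_Q M ≅ R ⊗_P (P ⊗_Q M) the map becomes t ↦ 1 ⊗ t for the faithfully flat j. -/
lemma map_injective {j : P →* R} (hj : IsEqFaithfullyFlat j) {l : Q →* R} (hl : j.comp h = l) :
    Function.Injective (map (M := M) j hl) := by
  intro x y e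
  refine mk_one_injective hj (h := j) (M := Tensor h M) ?_
  have H : ∀ z : Tensor h M,
      (PMod.extendComp h j l hl ⟨M⟩).inv (map j hl z) = mk j 1 z := by
    intro z
    induction z using ind with
    | H p m =>
      change mk j (j p) (mk h 1 m) = _
      rw [← one_mul (j p), mk_mul, smul_mk, mul_one]
  rw [← H, ← H, e]

end Tensor

lemma IsEqFlat.comp {h : Q →* P} {k : P →* R} (hk : IsEqFlat k) (hh : IsEqFlat h) :
    IsEqFlat (k.comp h) where
  eq_mul _ _ q r e := by
    obtain ⟨c, s, s', rfl, rfl, e'⟩ := hk.eq_mul _ _ (h q) (h r) e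
    obtain ⟨d, t, t', rfl, rfl, e''⟩ := hh.eq_mul _ _ _ _ e'
    exact ⟨c * k d, t, t', by simp [mul_assoc], by simp [mul_assoc], e''⟩
  eq_self _ q r e := by
    obtain ⟨c, s, rfl, e'⟩ := hk.eq_self _ (h q) (h r) e
    obtain ⟨d, t, rfl, e''⟩ := hh.eq_self _ _ _ e'
    exact ⟨c * k d, t, by simp [mul_assoc], e''⟩

lemma IsEqFaithfullyFlat.comp {h : Q →* P} {k : P →* R} (hk : IsEqFaithfullyFlat k)
    (hh : IsEqFaithfullyFlat h) : IsEqFaithfullyFlat (k.comp h) where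
  toIsEqFlat := hk.toIsEqFlat.comp hh.toIsEqFlat
  isUnit _ hq := hh.isUnit _ (hk.isUnit _ hq)

lemma IsEqFaithfullyFlat.of_bijective {h : Q →* P} (hh : Function.Bijective h) :
    IsEqFaithfullyFlat h where
  eq_mul a b q r e := by
    obtain ⟨a, rfl⟩ := hh.2 a
    obtain ⟨b, rfl⟩ := hh.2 b
    exact ⟨1, a, b, by simp, by simp, hh.1 (by simpa using e)⟩
  eq_self a q r e := by
    obtain ⟨a, rfl⟩ := hh.2 a
    exact ⟨1, a, by simp, hh.1 (by simpa using e)⟩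
  isUnit _ hq := (MulEquiv.isUnit_map (MulEquiv.ofBijective h hh)).1 hq

/-! ### Pushouts of monoids and faithfully flat base change -/

namespace Pushout
variable {h : Q →* P} {k : Q →* R}

lemma exists_eq (x : Pushout h k) : ∃ p r, x = inl h k p * inr h k r := by
  obtain ⟨⟨p, r⟩, rfl⟩ := Con.mk'_surjective x
  refine ⟨p, r, ?_⟩
  exact (congrArg (conGen (PushoutRel h k)).mk' (show (p, r) = (p, 1) * (1, r) by simp)).trans
    (map_mul _ _ _)

lemma inl_apply (q : Q) : inl h k (h q) = inr h k (k q) := DFunLike.congr_fun (condition h k) q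

/-- The interchange of the two factors. -/
def swap (h : Q →* P) (k : Q →* R) : Pushout h k →* Pushout k h :=
  lift (inr k h) (inl k h) (condition k h).symm

lemma swap_inl (p : P) : swap h k (inl h k p) = inr k h p :=
  DFunLike.congr_fun (lift_comp_inl (inr k h) (inl k h) (condition k h).symm) p

lemma swap_inr (r : R) : swap h k (inr h k r) = inl k h r :=
  DFunLike.congr_fun (lift_comp_inr (inr k h) (inl k h) (condition k h).symm) r

lemma swap_swap (x : Pushout h k) : swap k h (swap h k x) = x := by
  obtain ⟨p, r, rfl⟩ := exists_eq x
  simp only [map_mul, swap_inl, swap_inr]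

lemma swap_bijective : Function.Bijective (swap h k) :=
  ⟨Function.LeftInverse.injective swap_swap, Function.RightInverse.surjective swap_swap⟩

/-- The mechanism is that of `Tensor.mk_eq_iff`, now for a congruence: the relation `C` is
transitive by flatness of k, is multiplicative and contains the generating pairs. Flatness of one of
the two maps suffices. -/
lemma mul_eq_iff (hk : IsEqFlat k) {p p' : P} {r r' : R} :
    inl h k p * inr h k r = inl h k p' * inr h k r' ↔
      ∃ (c : R) (q q' : Q), r = c * k q ∧ r' = c * k q' ∧ p * h q = p' * h q' := by
  constructor
  · intro e
    let C : Con (P × R) :=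
      { r := fun x y => ∃ (c : R) (q q' : Q), x.2 = c * k q ∧ y.2 = c * k q' ∧
          x.1 * h q = y.1 * h q'
        iseqv :=
          { refl := fun x => ⟨x.2, 1, 1, by simp, by simp, rfl⟩
            symm := by
              rintro x y ⟨c, q, q', h1, h2, h3⟩
              exact ⟨c, q', q, h2, h1, h3.symm⟩
            trans := by
              rintro x y z ⟨c, q, r, h1, h2, h3⟩ ⟨c', q', r', h1', h2', h3'⟩
              obtain ⟨d, s, s', rfl, rfl, e⟩ := hk.eq_mul _ _ _ _ (h2.symm.trans h1')
              refine ⟨d, s * q, s' * r', by rw [h1, map_mul, mul_assoc],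
                by rw [h2', map_mul, mul_assoc], ?_⟩
              calc x.1 * h (s * q) = x.1 * h q * h s := by rw [map_mul]; ac_rfl
                _ = y.1 * h (s * r) := by rw [h3, map_mul]; ac_rfl
                _ = y.1 * h q' * h s' := by rw [e, map_mul]; ac_rfl
                _ = z.1 * h (s' * r') := by rw [h3', map_mul]; ac_rfl }
        mul' := by
          rintro w x y z ⟨c, q, r, h1, h2, h3⟩ ⟨c', q', r', h1', h2', h3'⟩
          refine ⟨c * c', q * q', r * r', ?_, ?_, ?_⟩
          · rw [Prod.snd_mul, h1, h1', map_mul]; ac_rfl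
          · rw [Prod.snd_mul, h2, h2', map_mul]; ac_rfl
          · calc w.1 * y.1 * h (q * q') = (w.1 * h q) * (y.1 * h q') := by rw [map_mul]; ac_rfl
              _ = x.1 * z.1 * h (r * r') := by rw [h3, h3', map_mul]; ac_rfl }
    have hC : conGen (PushoutRel h k) ≤ C := Con.conGen_le.2 (by
      rintro _ _ ⟨q⟩
      exact ⟨1, 1, q, by simp, by simp, by simp⟩)
    have e' : (conGen (PushoutRel h k)).mk' (p, r) = (conGen (PushoutRel h k)).mk' (p', r') := by
      have := fun p r => (map_mul (conGen (PushoutRel h k)).mk' (p, 1) (1, r)).symm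
      simpa using (this p r).symm.trans (Eq.trans e (this p' r'))
    exact hC ((Con.eq _).1 e')
  · rintro ⟨c, q, q', rfl, rfl, e⟩
    have key : ∀ p q, inl h k p * inr h k (c * k q) = inl h k (p * h q) * inr h k c := by
      intro p q
      rw [map_mul, map_mul, inl_apply]; ac_rfl
    rw [key, key, e]

/-- Base change of faithful flatness: `mul_eq_iff` turns each condition into conditions on the two
coordinates, and factors from Q are moved across the pushout by `inl_apply`. -/
lemma inl_faithfullyFlat (hk : IsEqFaithfullyFlat k) : IsEqFaithfullyFlat (inl h k) where
  eq_mul x y q r e := by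
    obtain ⟨a, b, rfl⟩ := exists_eq x
    obtain ⟨a', b', rfl⟩ := exists_eq y
    rw [mul_right_comm, ← map_mul, mul_right_comm, ← map_mul] at e
    obtain ⟨c, s, s', rfl, rfl, e'⟩ := (mul_eq_iff hk.toIsEqFlat).1 e
    refine ⟨inr h k c, a * h s, a' * h s', ?_, ?_, ?_⟩
    · rw [map_mul, map_mul, inl_apply]; ac_rfl
    · rw [map_mul, map_mul, inl_apply]; ac_rfl
    · rw [mul_right_comm, e', mul_right_comm]
  eq_self x q r e := by
    obtain ⟨a, b, rfl⟩ := exists_eq x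
    rw [mul_right_comm, ← map_mul, mul_right_comm, ← map_mul] at e
    obtain ⟨c, s, s', rfl, e₁, e₂⟩ := (mul_eq_iff hk.toIsEqFlat).1 e
    obtain ⟨d, t, rfl, e₃⟩ := hk.eq_self _ _ _ e₁
    -- The factor t is included because only t s = t s' is known, not s = s'.
    refine ⟨inr h k d, a * h (t * s), ?_, ?_⟩
    · rw [map_mul, map_mul, map_mul, map_mul, map_mul, inl_apply, inl_apply]; ac_rfl
    · calc a * h (t * s) * q = a * q * h s * h t := by rw [map_mul]; ac_rfl
        _ = a * h (t * s') * r := by rw [e₂, map_mul]; ac_rfl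
        _ = a * h (t * s) * r := by rw [e₃]
  isUnit p hp := by
    obtain ⟨x, hx⟩ := hp.exists_right_inv
    obtain ⟨a, b, rfl⟩ := exists_eq x
    have hx' : inl h k (p * a) * inr h k b = inl h k 1 * inr h k 1 := by
      rw [map_mul, mul_assoc, hx]; simp
    obtain ⟨c, q, q', rfl, e1, e2⟩ := (mul_eq_iff hk.toIsEqFlat).1 hx'
    have hq' : IsUnit q' := hk.isUnit _ (IsUnit.of_mul_eq_one c (by rw [mul_comm]; exact e1.symm))
    have : IsUnit (p * (a * h q)) := by
      rw [← mul_assoc, e2, one_mul]; exact hq'.map h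
    exact isUnit_of_mul_isUnit_left this

lemma inr_faithfullyFlat (hh : IsEqFaithfullyFlat h) : IsEqFaithfullyFlat (inr h k) := by
  have : inr h k = (swap k h).comp (inl k h) := MonoidHom.ext fun r => (swap_inl r).symm
  rw [this]
  exact (IsEqFaithfullyFlat.of_bijective swap_bijective).comp (inl_faithfullyFlat hh)

end Pushout

/-- Descent of elements: an element of `P ⊗_Q M` whose two images in `(P ⊕_Q P) ⊗_Q M` agree comes
from `M`. -/
lemma IsEqFaithfullyFlat.exists_eq_mk {h : Q →* P} (hh : IsEqFaithfullyFlat h) {M : Type u}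
    [MulAction Q M] {l : Q →* Two h} (hl₁ : (two₁ h).comp h = l) (hl₂ : (two₂ h).comp h = l)
    (t : Tensor h M) (ht : Tensor.map (two₁ h) hl₁ t = Tensor.map (two₂ h) hl₂ t) :
    ∃ m : M, t = Tensor.mk h 1 m := by
  induction t using Tensor.ind with
  | H p m =>
    have hl : IsEqFaithfullyFlat l := hl₁ ▸ (Pushout.inl_faithfullyFlat hh).comp hh
    rw [Tensor.map_mk, Tensor.map_mk] at ht
    obtain ⟨c, q, r, e1, e2, e⟩ := (Tensor.mk_eq_iff hl.toIsEqFlat).1 ht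
    obtain ⟨a, b, rfl⟩ := Pushout.exists_eq c
    -- The aim is to show that p itself lies in h(Q). With c = a ⊕ b, this equation puts b in h(Q),
    -- and the next one gives p = d h(s) with d h(t) = b h(r). Flatness and locality then put d in
    -- h(Q).
    have e₁ : Pushout.inl h h p * Pushout.inr h h 1 =
        Pushout.inl h h (a * h q) * Pushout.inr h h b := by
      rw [map_one, mul_one, map_mul, mul_right_comm]
      exact e1.trans (congrArg (_ * ·) (DFunLike.congr_fun hl₁ q).symm)
    have e₂ : Pushout.inl h h 1 * Pushout.inr h h p =
        Pushout.inl h h a * Pushout.inr h h (b * h r) := by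
      rw [map_one, one_mul, map_mul, ← mul_assoc]
      exact e2.trans (congrArg (_ * ·) (DFunLike.congr_fun hl₂ r).symm)
    obtain ⟨c, u, v, hu, rfl, -⟩ := (Pushout.mul_eq_iff hh.toIsEqFlat).1 e₁
    obtain ⟨d, s, t, rfl, e₃, -⟩ := (Pushout.mul_eq_iff hh.toIsEqFlat).1 e₂
    have hu' : IsUnit u := hh.isUnit _ (IsUnit.of_mul_eq_one c (by rw [mul_comm]; exact hu.symm))
    obtain ⟨u, rfl⟩ := hu'
    have e₄ : d * h (t * u) = 1 * h (v * r) := by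
      rw [map_mul, ← mul_assoc, ← e₃, one_mul, map_mul]
      calc c * h v * h r * h u = (c * h u) * (h v * h r) := by ac_rfl
        _ = h v * h r := by rw [← hu, one_mul]
    obtain ⟨w, x, y, rfl, hw, -⟩ := hh.eq_mul _ _ _ _ e₄
    have hy : IsUnit y := hh.isUnit _ (IsUnit.of_mul_eq_one w (by rw [mul_comm]; exact hw.symm))
    obtain ⟨y, rfl⟩ := hy
    refine ⟨(x * ↑y⁻¹ * s) • m, ?_⟩
    rw [← Tensor.mk_mul, one_mul]
    congr 1
    rw [map_mul, map_mul]
    calc w * h x * h s = w * h (y * ↑y⁻¹) * h x * h s := by simp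
      _ = (w * h y) * (h x * h ↑y⁻¹ * h s) := by rw [map_mul]; ac_rfl
      _ = _ := by rw [← hw, one_mul]

end Flatness
end MonoidFan

/-! ### Flat modules satisfy the equational criterion -/

namespace MonoidFan

namespace PMod
variable {P Q : Type u} [CommMonoid P] [CommMonoid Q]

/-- The equational criterion for flatness of a module. -/
structure IsEqFlat (M : PMod Q) : Prop where
  eq_smul : ∀ (a b : M) (q r : Q), q • a = r • b →
    ∃ (c : M) (s s' : Q), a = s • c ∧ b = s' • c ∧ s * q = s' * r
  eq_self : ∀ (a : M) (q r : Q), q • a = r • a → ∃ (c : M) (s : Q), a = s • c ∧ s * q = s * r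

/-- Write a = s x and b = t y in the basis. The element q a = r b has the coordinates (q s, x) and
(r t, y), so x = y is the required c and q s = r t. -/
lemma IsFree.isEqFlat {M : PMod Q} (hM : M.IsFree) : M.IsEqFlat := by
  obtain ⟨B, hB⟩ := hM
  have key : ∀ (a b : M) (q r : Q), q • a = r • b →
      ∃ (c : M) (s s' : Q), a = s • c ∧ b = s' • c ∧ s * q = s' * r ∧ (a = b → s = s') := by
    intro a b q r e
    obtain ⟨⟨s, x⟩, hx, hxu⟩ := hB a
    obtain ⟨⟨t, y⟩, hy, hyu⟩ := hB b
    obtain ⟨z, -, hz⟩ := hB (q • a)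
    have e1 := hz (q * s, x) (by simp only [mul_smul, ← hx])
    have e2 := hz (r * t, y) (by simp only [mul_smul, hy, e])
    have e3 := e1.trans e2.symm
    have e4 : x = y := congrArg Prod.snd e3
    subst e4
    refine ⟨x, s, t, hx.symm, hy.symm, ?_, ?_⟩
    · rw [mul_comm s, mul_comm t]; exact congrArg Prod.fst e3
    · rintro rfl
      exact congrArg Prod.fst (hyu _ hx)
  refine ⟨fun a b q r e => ?_, fun a q r e => ?_⟩
  · obtain ⟨c, s, s', h1, h2, h3, -⟩ := key a b q r e
    exact ⟨c, s, s', h1, h2, h3⟩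
  · obtain ⟨c, s, s', h1, h2, h3, h4⟩ := key a a q r e
    obtain rfl := h4 rfl
    exact ⟨c, s, h1, h3⟩

variable (Q) in
/-- The underlying set of a module. -/
def forgetType : PMod Q ⥤ Type u where
  obj M := M
  map f := ↾ f

section Colimit
variable {J : Type u} [SmallCategory J] (D : J ⥤ PMod Q)

/-- Multiplication by `q` as an endomorphism of the diagram of underlying sets. -/
def smulNatTrans (q : Q) : D ⋙ forgetType Q ⟶ D ⋙ forgetType Q where
  app j := ↾ fun x : D.obj j => q • x
  naturality i j f := by
    ext x
    exact (hom_smul (D.map f) q x).symm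

/-- The map from `D.obj j` to the colimit of the underlying sets. -/
def colimι (j : J) (x : D.obj j) : Limits.colimit (D ⋙ forgetType Q) :=
  Limits.colimit.ι (D ⋙ forgetType Q) j x

lemma colimι_surjective (x : Limits.colimit (D ⋙ forgetType Q)) : ∃ j y, colimι D j y = x :=
  Limits.Types.jointly_surjective' x

lemma colimMap_colimι (q : Q) (j : J) (x : D.obj j) :
    Limits.colimMap (smulNatTrans D q) (colimι D j x) = colimι D j (q • x) :=
  ConcreteCategory.congr_hom (Limits.ι_colimMap (smulNatTrans D q) j) x

lemma colimι_map {i j : J} (f : i ⟶ j) (x : D.obj i) :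
    colimι D j (D.map f x) = colimι D i x :=
  ConcreteCategory.congr_hom (Limits.colimit.w (D ⋙ forgetType Q) f) x

/-- The action on the colimit of the underlying sets. -/
instance colimitAction : MulAction Q (Limits.colimit (D ⋙ forgetType Q)) where
  smul q := Limits.colimMap (smulNatTrans D q)
  one_smul x := by
    obtain ⟨j, x, rfl⟩ := colimι_surjective D x
    refine (colimMap_colimι D 1 j x).trans ?_
    rw [one_smul]
  mul_smul a b x := by
    obtain ⟨j, x, rfl⟩ := colimι_surjective D x
    refine (colimMap_colimι D (a * b) j x).trans ?_
    refine Eq.trans ?_ (congrArg (Limits.colimMap (smulNatTrans D a))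
      (colimMap_colimι D b j x)).symm
    rw [colimMap_colimι, mul_smul]

lemma smul_colimι (q : Q) (j : J) (x : D.obj j) : q • colimι D j x = colimι D j (q • x) :=
  colimMap_colimι D q j x

/-- The colimit of the underlying sets as a cocone of modules. -/
def colimitCocone : Limits.Cocone D where
  pt := ⟨Limits.colimit (D ⋙ forgetType Q)⟩
  ι :=
    { app := fun j => homMk (N := ⟨Limits.colimit (D ⋙ forgetType Q)⟩) (colimι D j)
        (fun q x => (smul_colimι D q j x).symm)
      naturality := fun i j f => by
        ext x
        exact colimι_map D f x }

/-- The map from the colimit of the underlying sets to a cocone. -/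
def colimitDesc (c : Limits.Cocone D) : (colimitCocone D).pt ⟶ c.pt :=
  homMk (M := ⟨Limits.colimit (D ⋙ forgetType Q)⟩)
    (Limits.colimit.desc (D ⋙ forgetType Q) ((forgetType Q).mapCocone c)) (by
      intro q x
      obtain ⟨j, x, rfl⟩ := colimι_surjective D x
      rw [smul_colimι]
      have key := fun x => ConcreteCategory.congr_hom
        (Limits.colimit.ι_desc ((forgetType Q).mapCocone c) j) x
      refine (key _).trans (Eq.trans ?_ (congrArg (q • ·) (key x).symm))
      exact hom_smul (c.ι.app j) q x)

lemma colimitDesc_ι (c : Limits.Cocone D) (j : J) :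
    (colimitCocone D).ι.app j ≫ colimitDesc D c = c.ι.app j := by
  ext x
  exact ConcreteCategory.congr_hom (Limits.colimit.ι_desc ((forgetType Q).mapCocone c) j) x

variable {D} {c : Limits.Cocone D} (hc : Limits.IsColimit c)
include hc

/-- The colimit of the underlying sets carries an action and is a cocone of modules. The identity of
`c.pt` factors through it, and its elements come from the diagram. -/
lemma exists_ι_eq (x : c.pt) : ∃ j y, c.ι.app j y = x := by
  obtain ⟨j, y, hy⟩ := colimι_surjective D (hc.desc (colimitCocone D) x)
  refine ⟨j, y, ?_⟩
  have e : hc.desc (colimitCocone D) ≫ colimitDesc D c = 𝟙 _ := hc.hom_ext fun j => by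
    rw [hc.fac_assoc, colimitDesc_ι, Category.comp_id]
  have e1 : colimitDesc D c (colimι D j y) = c.ι.app j y :=
    congrArg (fun g => g y) (colimitDesc_ι D c j)
  rw [← e1, hy]
  exact congrArg (fun g => g x) e

lemma exists_map_eq_of_ι_eq [IsFiltered J] {i j : J} {x : D.obj i} {y : D.obj j}
    (e : c.ι.app i x = c.ι.app j y) :
    ∃ (k : J) (f : i ⟶ k) (g : j ⟶ k), D.map f x = D.map g y := by
  have e1 : ∀ k z, hc.desc (colimitCocone D) (c.ι.app k z) = colimι D k z := fun k z =>
    congrArg (fun g => g z) (hc.fac (colimitCocone D) k)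
  have e2 : colimι D i x = colimι D j y := by rw [← e1, ← e1, e]
  exact (Limits.Types.FilteredColimit.colimit_eq_iff (D ⋙ forgetType Q)).1 e2

lemma isEqFlat_of_isColimit [IsFiltered J] (hD : ∀ j, (D.obj j).IsEqFlat) : c.pt.IsEqFlat := by
  have ws : ∀ {i j : J} (f : i ⟶ j) (x : D.obj i), c.ι.app j (D.map f x) = c.ι.app i x :=
    fun f x => congrArg (fun g => g x) (c.w f)
  refine ⟨fun a b q r e => ?_, fun a q r e => ?_⟩
  · obtain ⟨i, x, rfl⟩ := exists_ι_eq hc a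
    obtain ⟨j, y, rfl⟩ := exists_ι_eq hc b
    rw [← hom_smul, ← hom_smul] at e
    obtain ⟨k, f, g, e⟩ := exists_map_eq_of_ι_eq hc e
    rw [hom_smul, hom_smul] at e
    obtain ⟨z, s, s', h1, h2, h3⟩ := (hD k).eq_smul _ _ _ _ e
    refine ⟨c.ι.app k z, s, s', ?_, ?_, h3⟩
    · rw [← hom_smul, ← h1, ws]
    · rw [← hom_smul, ← h2, ws]
  · obtain ⟨i, x, rfl⟩ := exists_ι_eq hc a
    rw [← hom_smul, ← hom_smul] at e
    obtain ⟨k, f, g, e⟩ := exists_map_eq_of_ι_eq hc e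
    -- The maps f and g may send x to different elements at stage k; after coequalizing them there
    -- is a single element to which the second condition applies.
    let l := IsFiltered.coeq f g
    let u : k ⟶ l := IsFiltered.coeqHom f g
    have e' := congrArg (D.map u) e
    rw [← comp_apply, ← comp_apply, ← Functor.map_comp, ← Functor.map_comp,
      ← IsFiltered.coeq_condition f g, hom_smul, hom_smul] at e'
    obtain ⟨z, s, h1, h2⟩ := (hD l).eq_self _ _ _ e'
    refine ⟨c.ι.app l z, s, ?_, h2⟩
    rw [← hom_smul, ← h1, ws]

end Colimit

lemma IsEqFlat.of_iso {M N : PMod Q} (e : M ≅ N) (hM : M.IsEqFlat) : N.IsEqFlat := by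
  have he : ∀ x, e.hom (e.inv x) = x := fun x => congrArg (fun g => g x) e.inv_hom_id
  refine ⟨fun a b q r h => ?_, fun a q r h => ?_⟩
  · obtain ⟨c, s, s', h1, h2, h3⟩ := hM.eq_smul (e.inv a) (e.inv b) q r (by
      rw [← hom_smul, ← hom_smul, h])
    exact ⟨e.hom c, s, s', by rw [← hom_smul, ← h1, he], by rw [← hom_smul, ← h2, he], h3⟩
  · obtain ⟨c, s, h1, h2⟩ := hM.eq_self (e.inv a) q r (by rw [← hom_smul, ← hom_smul, h])
    exact ⟨e.hom c, s, by rw [← hom_smul, ← h1, he], h2⟩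

lemma IsFlat.isEqFlat {M : PMod Q} (hM : M.IsFlat) : M.IsEqFlat := by
  obtain ⟨J, _, _, D, c, ⟨hc⟩, hD, ⟨e⟩⟩ := hM
  exact (isEqFlat_of_isColimit hc fun j => (hD j).isEqFlat).of_iso e

end PMod

lemma IsFlatHom.isEqFlat {P Q : Type u} [CommMonoid P] [CommMonoid Q] {h : Q →* P}
    (hh : IsFlatHom h) : IsEqFlat h := by
  have H := PMod.IsFlat.isEqFlat hh
  have es : ∀ (q : Q) (a : P), @HSMul.hSMul Q (PMod.restrict h (PMod.self P)) _ _ q a = h q * a := fun _ _ => rfl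
  refine ⟨fun a b q r e => ?_, fun a q r e => ?_⟩
  · obtain ⟨c, s, s', h1, h2, h3⟩ := H.eq_smul a b q r (by
      rw [es, es, mul_comm, e, mul_comm])
    exact ⟨c, s, s', h1.trans (mul_comm (h s) c), h2.trans (mul_comm (h s') c), h3⟩
  · obtain ⟨c, s, h1, h2⟩ := H.eq_self a q r (by
      rw [es, es, mul_comm, e, mul_comm])
    exact ⟨c, s, h1.trans (mul_comm (h s) c), h2⟩

/-! ### Faithfully flat descent for modules over monoids -/

namespace Pushout
variable {P Q R : Type u} [CommMonoid P] [CommMonoid Q] [CommMonoid R] {h : Q →* P} {k : Q →* R}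

/-- `(P ⊕_Q R) ⊗_R M` is `P ⊗_Q M`. -/
lemma exists_of_mk_inl_eq (hh : IsEqFaithfullyFlat h) (hk : IsEqFaithfullyFlat k) {M : Type u} [MulAction R M] {a b : P}
    {m n : M} (e : Tensor.mk (inr h k) (inl h k a) m = Tensor.mk (inr h k) (inl h k b) n) :
    ∃ (c : P) (q r : Q), a = c * h q ∧ b = c * h r ∧ k q • m = k r • n := by
  obtain ⟨x, s, t, e1, e2, e3⟩ := (Tensor.mk_eq_iff (inr_faithfullyFlat hh).toIsEqFlat).1 e
  obtain ⟨c, d, rfl⟩ := exists_eq x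
  -- Comparing a ⊕ 1 with c ⊕ (d s) gives 1 = z k(u), so u is a unit by locality of k, and q = v u⁻¹
  -- serves.
  have key : ∀ (a : P) (s : R), inl h k a = inl h k c * inr h k d * inr h k s →
      ∃ q, a = c * h q ∧ d * s = k q := by
    intro a s e
    have e' : inl h k a * inr h k 1 = inl h k c * inr h k (d * s) := by
      rw [e, map_one, mul_one, map_mul, mul_assoc]
    obtain ⟨z, u, v, hz, hv, e''⟩ := (mul_eq_iff hk.toIsEqFlat).1 e'
    obtain ⟨u, rfl⟩ := hk.isUnit u (IsUnit.of_mul_eq_one z (by rw [mul_comm]; exact hz.symm))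
    refine ⟨v * ↑u⁻¹, ?_, ?_⟩
    · calc a = a * h (u * ↑u⁻¹) := by simp
        _ = a * h u * h ↑u⁻¹ := by rw [map_mul, mul_assoc]
        _ = _ := by rw [e'', map_mul, mul_assoc]
    · calc d * s = z * k v * k (u * ↑u⁻¹) := by rw [hv]; simp
        _ = z * k u * (k v * k ↑u⁻¹) := by rw [map_mul]; ac_rfl
        _ = _ := by rw [← hz, map_mul, one_mul]
  obtain ⟨q, h1, h2⟩ := key a s e1
  obtain ⟨r, h3, h4⟩ := key b t e2
  exact ⟨c, q, r, h1, h3, by rw [← h2, ← h4, mul_smul, mul_smul, e3]⟩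

end Pushout

namespace DescentMod
variable {P Q : Type u} [CommMonoid P] [CommMonoid Q] {h : Q →* P} (D : DescentMod h)

/-- The isomorphism `φ` as a map of sets. -/
def isoFun : Tensor (two₁ h) D.obj → Tensor (two₂ h) D.obj := fun t => D.iso.hom t

lemma isoFun_smul (t : Two h) (x : Tensor (two₁ h) D.obj) :
    D.isoFun (t • x) = t • D.isoFun x :=
  PMod.hom_smul D.iso.hom t x

lemma isoFun_injective : Function.Injective D.isoFun := fun x y e => by
  have he : ∀ x, D.iso.inv (D.iso.hom x) = x := fun x => congrArg (fun g => g x) D.iso.hom_inv_id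
  exact (he x).symm.trans ((congrArg D.iso.inv e).trans (he y))

lemma isoFun_equalizer (g : D.equalizer) :
    D.isoFun (Tensor.mk (two₁ h) 1 g.1) = Tensor.mk (two₂ h) 1 g.1 := g.2.symm

lemma exists_isoFun_eq (n : D.obj) :
    ∃ (p : P) (m : D.obj), D.isoFun (Tensor.mk (two₁ h) 1 n) = Tensor.mk (two₂ h) (two₁ h p) m := by
  obtain ⟨⟨t, m⟩, ht⟩ := Quot.exists_rep (D.isoFun (Tensor.mk (two₁ h) 1 n))
  obtain ⟨p, r, rfl⟩ := Pushout.exists_eq t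
  exact ⟨p, r • m, ht.symm.trans (Tensor.mk_mul _ _ _)⟩

lemma pullHom_mk {S : Type u} [CommMonoid S] (j : Two h →* S) (a b : P →* S)
    (ha : j.comp (two₁ h) = a) (hb : j.comp (two₂ h) = b) (s : S) (n : D.obj) :
    PMod.pullHom j a b ha hb D.iso.hom (Tensor.mk a s n) =
      s • Tensor.map j hb (D.isoFun (Tensor.mk (two₁ h) 1 n)) := by
  change (PMod.extendComp (two₂ h) j b hb D.obj).hom (Tensor.mk j s (D.isoFun _)) = _
  induction D.isoFun (Tensor.mk (two₁ h) 1 n) using Tensor.ind with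
  | H t m => rfl

variable {D}

/-- Surjectivity of the counit, where the cocycle condition is needed. With φ(1 ⊗ n) = p ⊗ m and φ(1
⊗ m) = p' ⊗ m' it reads p ⊗ p' ⊗ m' = p ⊗ 1 ⊗ m: after tensoring with p, the element m is fixed by
φ. Flatness converts this into a multiple of m that is fixed exactly. -/
lemma exists_eq_smul (hh : IsEqFaithfullyFlat h) (n : D.obj) :
    ∃ (p : P) (g : D.equalizer), n = p • g.1 := by
  obtain ⟨p, m, h1⟩ := D.exists_isoFun_eq n
  obtain ⟨p', m', h2⟩ := D.exists_isoFun_eq m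
  have hc := congrArg (fun f => f (Tensor.mk (three₁ h) 1 n)) D.cocycle
  have hc' : PMod.pullHom (three₂₃ h) (three₂ h) (three₃ h) (three₂₃_two₁ h) (three₂₃_two₂ h)
        D.iso.hom (PMod.pullHom (three₁₂ h) (three₁ h) (three₂ h) (three₁₂_two₁ h)
        (three₁₂_two₂ h) D.iso.hom (Tensor.mk (three₁ h) 1 n)) =
      PMod.pullHom (three₁₃ h) (three₁ h) (three₃ h) (three₁₃_two₁ h) (three₁₃_two₂ h)
        D.iso.hom (Tensor.mk (three₁ h) 1 n) := hc
  have e12 : three₁₂ h (two₁ h p) = three₁ h p := DFunLike.congr_fun (three₁₂_two₁ h) p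
  have e13 : three₁₃ h (two₁ h p) = three₁ h p := DFunLike.congr_fun (three₁₃_two₁ h) p
  have e23 : three₂₃ h (two₁ h p') = three₂ h p' := DFunLike.congr_fun (three₂₃_two₁ h) p'
  rw [pullHom_mk, pullHom_mk, h1, Tensor.map_mk, Tensor.map_mk, one_smul, one_smul, pullHom_mk,
    h2, Tensor.map_mk, Tensor.smul_mk, e12, e13, e23] at hc'
  -- the isomorphism of `P ⊕_Q P ⊕_Q P` with `P ⊕_Q (P ⊕_Q P)`
  let k : Q →* Two h := (two₁ h).comp h
  let θ : Three h →* Pushout h k := Pushout.lift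
    (Pushout.lift (Pushout.inl h k) ((Pushout.inr h k).comp (two₁ h)) (Pushout.condition h k))
    ((Pushout.inr h k).comp (two₂ h)) (by
      rw [← MonoidHom.comp_assoc, Pushout.lift_comp_inl, Pushout.condition h k,
        MonoidHom.comp_assoc, ← Pushout.condition h h])
  have θ3 : θ.comp (three₃ h) = (Pushout.inr h k).comp (two₂ h) := Pushout.lift_comp_inr _ _ _
  have θ12 : θ.comp (Pushout.inl ((two₁ h).comp h) h) = _ := Pushout.lift_comp_inl _ _ _
  have θ1 : θ (three₁ h p) = Pushout.inl h k p :=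
    (DFunLike.congr_fun θ12 (two₁ h p)).trans
      (DFunLike.congr_fun (Pushout.lift_comp_inl (Pushout.inl h k) ((Pushout.inr h k).comp (two₁ h))
        (Pushout.condition h k)) p)
  have θ2 : θ (three₂ h p') = Pushout.inr h k (two₁ h p') :=
    (DFunLike.congr_fun θ12 (two₂ h p')).trans
      (DFunLike.congr_fun (Pushout.lift_comp_inr (Pushout.inl h k) ((Pushout.inr h k).comp (two₁ h))
        (Pushout.condition h k)) p')
  -- Over P ⊕_Q (P ⊕_Q P) the condition becomes p ⊗ φ(1 ⊗ m) = p ⊗ (1 ⊗ m), to which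
  -- `Pushout.exists_of_mk_inl_eq` applies with the P ⊕_Q P-module π₂^* N.
  have hw := congrArg (Tensor.map θ θ3) hc'
  rw [Tensor.map_mk, Tensor.map_mk, map_mul, θ1, θ2] at hw
  have hw' := congrArg (PMod.extendComp (two₂ h) (Pushout.inr h k) _ rfl D.obj).inv hw
  rw [PMod.extendComp_inv_mk, PMod.extendComp_inv_mk, Tensor.mk_mul, Tensor.smul_mk, mul_one] at hw'
  have hk : IsEqFaithfullyFlat k := (Pushout.inl_faithfullyFlat hh).comp hh
  obtain ⟨c, q, r, e1, e2, e3⟩ := Pushout.exists_of_mk_inl_eq hh hk hw'.symm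
  -- Since c h(q) = p = c h(r), multiplication by a suitable s makes the two coefficients in the
  -- relation between 1 ⊗ m and φ(1 ⊗ m) equal.
  obtain ⟨d, s, rfl, e4⟩ := hh.eq_self _ _ _ (e1.symm.trans e2)
  rw [← h2] at e3
  have hkm : ∀ (x : Q) (n : D.obj), k x • Tensor.mk (two₂ h) 1 n = Tensor.mk (two₂ h) 1 (h x • n) :=
    fun x n => by
      rw [Tensor.mk_one_smul]
      exact congrArg (· • Tensor.mk (two₂ h) 1 n) (DFunLike.congr_fun (Pushout.condition h h) x)
  have hg : Tensor.mk (two₂ h) 1 (h (s * q) • m) =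
      D.isoFun (Tensor.mk (two₁ h) 1 (h (s * q) • m)) := by
    rw [← hkm, Tensor.mk_one_smul, isoFun_smul]
    have e5 : ∀ x : Tensor (two₂ h) D.obj, k s • k q • x = k (s * q) • x := fun x => by
      rw [← mul_smul, map_mul]
    refine (e5 _).symm.trans ((congrArg (k s • ·) e3).trans ?_)
    refine Eq.trans ?_ (congrArg (fun y => k y • D.isoFun (Tensor.mk (two₁ h) 1 m)) e4).symm
    rw [← mul_smul, map_mul]
  refine ⟨d, ⟨h (s * q) • m, hg⟩, ?_⟩
  -- N embeds into π₁^* N and φ is injective, so both sides may be compared after φ, where each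
  -- becomes p ⊗ m.
  refine Tensor.mk_one_injective (Pushout.inl_faithfullyFlat hh) (D.isoFun_injective ?_)
  rw [h1, Tensor.mk_one_smul, isoFun_smul, ← hg, ← hkm, ← mul_smul, Tensor.smul_mk_one, e2, e4]
  refine congrArg (fun y => Tensor.mk (two₂ h) y m) ?_
  change two₁ h (d * h s * h r) = two₁ h d * two₁ h (h (s * r))
  rw [← map_mul, map_mul h, mul_assoc]

/-- φ fixes 1 ⊗ g for g in the equalizer, so it turns a g = b g' into an equation in π₂^* N where a
and b sit in the first factor of P ⊕_Q P, apart from g and g'. -/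
lemma exists_of_smul_eq (hh : IsEqFaithfullyFlat h) {a b : P} {g g' : D.equalizer}
    (e : a • g.1 = b • g'.1) :
    ∃ (c : P) (q r : Q), a = c * h q ∧ b = c * h r ∧ q • g = r • g' := by
  have key : ∀ (a : P) (g : D.equalizer), D.isoFun (Tensor.mk (two₁ h) 1 (a • g.1)) =
      Tensor.mk (two₂ h) (two₁ h a) g.1 := by
    intro a g
    rw [Tensor.mk_one_smul, isoFun_smul, isoFun_equalizer, Tensor.smul_mk_one]
  have e' := (key a g).symm.trans ((congrArg _ (congrArg _ e)).trans (key b g'))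
  obtain ⟨c, q, r, h1, h2, h3⟩ := Pushout.exists_of_mk_inl_eq hh hh e'
  exact ⟨c, q, r, h1, h2, Subtype.ext h3⟩

end DescentMod

section Equivalence
variable {P Q : Type u} [CommMonoid P] [CommMonoid Q] {h : Q →* P}

lemma PMod.isIso_of_bijective {M N : PMod Q} (f : M ⟶ N) (hf : Function.Bijective f) : IsIso f :=
  have hs : ∀ n, f (Function.surjInv hf.surjective n) = n := Function.surjInv_eq hf.surjective
  ⟨PMod.homMk (Function.surjInv hf.surjective) (fun q n => hf.1 (by
      rw [PMod.hom_smul, hs, hs])),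
    PMod.hom_ext fun _ => hf.1 (hs _), PMod.hom_ext fun _ => hs _⟩

lemma tautDescent_isoFun (M : PMod Q) (s : Two h) (p : P) (m : M) :
    ((tautDescent h).obj M).isoFun (Tensor.mk (two₁ h) s (Tensor.mk h p m)) =
      Tensor.mk (two₂ h) (s * two₁ h p) (Tensor.mk h 1 m) := rfl

variable (h) in
/-- The unit `M → G(P ⊗_Q M)`. -/
def descentUnit : 𝟭 (PMod Q) ⟶ tautDescent h ⋙ descend h where
  app M := PMod.homMk (N := ⟨((tautDescent h).obj M).equalizer⟩)
    (fun m => ⟨Tensor.mk h 1 m, by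
      refine Eq.trans ?_ (tautDescent_isoFun M 1 1 m).symm
      rw [map_one, mul_one]; rfl⟩)
    (fun q m => Subtype.ext (Tensor.mk_one_smul q m))
  naturality M N f := rfl

variable (h) in
/-- The counit `P ⊗_Q G(N, φ) → N`. -/
def descentCounit : descend h ⋙ tautDescent h ⟶ 𝟭 (DescentMod h) where
  app D :=
    { hom := PMod.homMk (M := ⟨Tensor h D.equalizer⟩)
        (Tensor.lift (fun p g => p • g.1) (fun p q g => mul_smul p (h q) g.1))
        (fun p t => by
          induction t using Tensor.ind with
          | H p' g => exact mul_smul p p' g.1)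
      comm := by
        ext t
        induction t using Tensor.ind with
        | H r t => induction t using Tensor.ind with
          | H p g =>
            have e : D.isoFun (Tensor.mk (two₁ h) r (p • g.1)) =
                Tensor.mk (two₂ h) (r * two₁ h p) ((1 : P) • g.1) := by
              rw [← Tensor.smul_mk_one, D.isoFun_smul, Tensor.mk_one_smul, D.isoFun_smul,
                D.isoFun_equalizer (g : D.equalizer), one_smul, ← mul_smul, Tensor.smul_mk_one]
            exact e }
  naturality D E f := by
    ext t
    induction t using Tensor.ind with
    | H p g => exact (PMod.hom_smul f.hom p g.1).symm

lemma IsEqFaithfullyFlat.bijective_descentUnit (hh : IsEqFaithfullyFlat h) (M : PMod Q) :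
    Function.Bijective ((descentUnit h).app M) := by
  constructor
  · intro m n e
    exact Tensor.mk_one_injective hh (congrArg Subtype.val e)
  · rintro ⟨t, ht⟩
    obtain ⟨m, rfl⟩ := hh.exists_eq_mk rfl (Pushout.condition h h).symm t (by
      induction t using Tensor.ind with
      | H p m =>
        have e := congrArg (PMod.extendComp h (two₂ h) ((two₁ h).comp h)
          (Pushout.condition h h).symm M).hom (ht.trans (tautDescent_isoFun M 1 p m))
        have e' : Tensor.mk ((two₁ h).comp h) (1 * two₂ h p) m =
          Tensor.mk ((two₁ h).comp h) (1 * two₁ h p * two₂ h 1) m := e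
        rw [map_one, mul_one, one_mul, one_mul] at e'
        exact e'.symm)
    exact ⟨m, rfl⟩

lemma IsEqFaithfullyFlat.bijective_descentCounit (hh : IsEqFaithfullyFlat h) (D : DescentMod h) :
    Function.Bijective ((descentCounit h).app D).hom := by
  constructor
  · intro x y e
    induction x using Tensor.ind with
    | H a g => induction y using Tensor.ind with
      | H b g' =>
        obtain ⟨c, q, r, rfl, rfl, e⟩ := DescentMod.exists_of_smul_eq hh e
        exact (Tensor.mk_eq_iff hh.toIsEqFlat).2 ⟨c, q, r, rfl, rfl, e⟩
  · intro n
    obtain ⟨p, g, rfl⟩ := DescentMod.exists_eq_smul hh n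
    exact ⟨Tensor.mk h p g, rfl⟩

lemma DescentMod.isIso_of_isIso_hom {D E : DescentMod h} (f : D ⟶ E) [IsIso f.hom] : IsIso f :=
  ⟨⟨inv f.hom, by
      rw [Functor.map_inv, Functor.map_inv, IsIso.inv_comp_eq, ← Category.assoc, f.comm,
        Category.assoc, IsIso.hom_inv_id, Category.comp_id]⟩,
    DescentMod.hom_ext (IsIso.hom_inv_id f.hom), DescentMod.hom_ext (IsIso.inv_hom_id f.hom)⟩

/-- Faithfully flat descent for modules over monoids. -/
def IsEqFaithfullyFlat.descentEquivalence (hh : IsEqFaithfullyFlat h) : PMod Q ≌ DescentMod h :=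
  haveI : ∀ M, IsIso ((descentUnit h).app M) := fun M =>
    PMod.isIso_of_bijective _ (hh.bijective_descentUnit M)
  haveI : IsIso (descentUnit h) := NatIso.isIso_of_isIso_app _
  haveI : ∀ D, IsIso ((descentCounit h).app D) := fun D =>
    haveI : IsIso ((descentCounit h).app D).hom :=
      PMod.isIso_of_bijective _ (hh.bijective_descentCounit D)
    DescentMod.isIso_of_isIso_hom _
  haveI : IsIso (descentCounit h) := NatIso.isIso_of_isIso_app _
  -- This constructor adjusts only the unit to obtain the triangle identities; functor and inverse
  -- stay the given ones by definition.
  CategoryTheory.Equivalence.mk (tautDescent h) (descend h) (asIso (descentUnit h))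
    (asIso (descentCounit h))

end Equivalence

/-! ### The closed point of Spec P and faithful flatness -/

namespace Spec
variable {P Q : Type u} [CommMonoid P] [CommMonoid Q]

variable (P) in
/-- The closed point of `Spec P`, i.e. the face of units. -/
def closedPoint : Face P :=
  ⟨IsUnit.submonoid P, fun _ _ hab => ⟨isUnit_of_mul_isUnit_left hab, isUnit_of_mul_isUnit_right hab⟩⟩

/-- Open sets are stable under passage to larger faces. -/
lemma mem_of_le {U : Set (Face P)} (hU : IsOpen U) {F G : Face P} (hF : F ∈ U) (h : F.1 ≤ G.1) :
    G ∈ U := by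
  induction hU with
  | basic s hs =>
    obtain ⟨p, rfl⟩ := hs
    exact h hF
  | univ => trivial
  | inter s t _ _ hs ht => exact ⟨hs hF.1, ht hF.2⟩
  | sUnion S _ ih =>
    obtain ⟨s, hs, hFs⟩ := hF
    exact ⟨s, hs, ih s hs hFs⟩

lemma closedPoint_le (F : Face P) : (closedPoint P).1 ≤ F.1 := by
  rintro _ ⟨u, rfl⟩
  refine (F.2 _ (↑u⁻¹ : P) ?_).1
  rw [Units.mul_inv]; exact F.1.one_mem

lemma toStalk_eq_germ (F : Spec P) {U : Opens (Spec P)} (hF : F ∈ U)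
    (s : (Spec P).str.obj (op U)) (p : P)
    (h : ∀ G : U, s.1 G = Localization.mk p 1) : toStalk F p = (Spec P).germ F hF s :=
  (germ_eq' F (U := ⊤) trivial hF _ _).2 ⟨U, hF, Opens.leTop _, 𝟙 _, fun G => (h G).symm⟩

lemma toStalk_injective_loc {F : Spec P} {p q : P} (h : toStalk F p = toStalk F q) :
    (Localization.mk p 1 : Face.Loc (F : Face P)) = Localization.mk q 1 := by
  obtain ⟨W, hW, i, j, e⟩ := (germ_eq' F (U := ⊤) (V := ⊤) trivial trivial _ _).1 h
  exact e ⟨F, hW⟩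

lemma isUnit_toStalk_iff {F : Spec P} {p : P} : IsUnit (toStalk F p) ↔ p ∈ (F : Face P).1 := by
  refine (isUnit_germ_iff F (U := ⊤) trivial _).trans ⟨fun h => Face.mem_of_isUnit_mk _ _ _ h, fun h => ?_⟩
  exact Face.isUnit_mk_of_mem _ _ _ h

/-- Every element of the stalk is a fraction. -/
lemma exists_toStalk_mul_eq (F : Spec P) (x : (Spec P).str.stalk F) :
    ∃ (a b : P), b ∈ (F : Face P).1 ∧ x * toStalk F b = toStalk F a := by
  obtain ⟨U, hU, s, rfl⟩ := (Spec P).exists_germ F x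
  obtain ⟨V, hV, i, a, b, hab⟩ := s.2 ⟨F, hU⟩
  obtain ⟨hb, -⟩ := hab ⟨F, hV⟩
  refine ⟨a, b, hb, ?_⟩
  let t : (Spec P).str.obj (op V) := ⟨fun _ => Localization.mk b 1, fun G =>
    ⟨V, G.2, 𝟙 _, b, 1, fun H => ⟨H.1.1.one_mem, rfl⟩⟩⟩
  refine (congrArg₂ (· * ·) ((Spec P).germ_map i F hV s).symm
    (toStalk_eq_germ F hV t b fun _ => rfl)).trans (((Spec P).germ_mul F hV _ _).symm.trans
      (toStalk_eq_germ F hV _ a fun G => ?_).symm)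
  obtain ⟨hb', e⟩ := hab G
  refine (congrArg (· * Localization.mk b 1) e).trans ?_
  rw [Localization.mk_mul, Localization.mk_eq_mk_iff, Localization.r_iff_exists]
  exact ⟨1, by simp [mul_comm]⟩

/-- Localizing at units changes nothing. The point is a variable with an equation because the lemma
is also applied to the image of a closed point, which is closed only propositionally. -/
lemma toStalk_closedPoint_bijective {F : Spec P} (hF : F = closedPoint P) :
    Function.Bijective (toStalk F) := by
  subst hF
  constructor
  · intro p q e
    have e' := toStalk_injective_loc e
    rw [Localization.mk_eq_mk_iff, Localization.r_iff_exists] at e'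
    obtain ⟨⟨c, hc⟩, e'⟩ := e'
    have hc' : IsUnit c := hc
    exact hc'.mul_left_cancel (by simpa using e')
  · intro x
    obtain ⟨a, b, hb, e⟩ := exists_toStalk_mul_eq _ x
    obtain ⟨b, rfl⟩ : IsUnit b := hb
    refine ⟨a * ↑b⁻¹, ?_⟩
    rw [map_mul, ← e, mul_assoc, ← map_mul, Units.mul_inv, map_one, mul_one]

lemma stalkHom_toStalk (h : Q →* P) (F : Spec P) (q : Q) :
    LMS.stalkHom (Spec.map h) F (toStalk ((Spec.map h).hom.base F) q) = toStalk F (h q) := by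
  refine (LMS.stalkHom_germ (Spec.map h) (V := ⊤) F trivial _).trans ?_
  refine (toStalk_eq_germ F (U := ⊤) trivial _ (h q) fun G => ?_).symm
  refine (Face.locMap_mk h G.1 q 1).trans ?_
  congr 1
  exact Subtype.ext (map_one h)

end Spec

lemma IsEqFlat.of_comp_bijective {P Q R : Type u} [CommMonoid P] [CommMonoid Q] [CommMonoid R]
    {h : Q →* P} {k : P →* R} (hk : Function.Bijective k) (hkh : IsEqFlat (k.comp h)) :
    IsEqFlat h where
  eq_mul a b q r e := by
    obtain ⟨c, s, s', h1, h2, h3⟩ := hkh.eq_mul (k a) (k b) q r (by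
      simpa using congrArg k e)
    obtain ⟨c, rfl⟩ := hk.2 c
    exact ⟨c, s, s', hk.1 (by simpa using h1), hk.1 (by simpa using h2), h3⟩
  eq_self a q r e := by
    obtain ⟨c, s, h1, h2⟩ := hkh.eq_self (k a) q r (by simpa using congrArg k e)
    obtain ⟨c, rfl⟩ := hk.2 c
    exact ⟨c, s, hk.1 (by simpa using h1), h2⟩

/-- A map of monoids that induces a flat cover of the spectra is faithfully flat. -/
lemma LMS.IsFlatCover.isEqFaithfullyFlat {P Q : Type u} [CommMonoid P] [CommMonoid Q]
    {h : Q →* P} (hh : LMS.IsFlatCover (Spec.map h)) : IsEqFaithfullyFlat h := by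
  -- A face F over the closed point exists by surjectivity. It contains all units of P, so a q with
  -- h(q) a unit lies in the preimage of F, the units of Q.
  have hu : ∀ q, IsUnit (h q) → IsUnit q := by
    intro q hq
    obtain ⟨F, hF⟩ := hh.2 (Spec.closedPoint Q)
    have h1 : q ∈ (Face.comap h F).1 := Spec.closedPoint_le F hq
    have h2 : Face.comap h F = Spec.closedPoint Q := hF
    rwa [h2] at h1
  have hc : (Spec.map h).hom.base (Spec.closedPoint P) = Spec.closedPoint Q :=
    Subtype.ext (Submonoid.ext fun q => ⟨fun hq => hu q hq, fun hq => IsUnit.map h hq⟩)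
  -- The closed point maps to the closed point, and there the flat stalk map is h up to the
  -- isomorphisms `toStalk`.
  refine ⟨IsEqFlat.of_comp_bijective (Spec.toStalk_closedPoint_bijective rfl) ?_, hu⟩
  have e : (Spec.toStalk (Spec.closedPoint P)).comp h =
      (LMS.stalkHom (Spec.map h) (Spec.closedPoint P)).comp
        (Spec.toStalk ((Spec.map h).hom.base (Spec.closedPoint P))) :=
    MonoidHom.ext fun q => (Spec.stalkHom_toStalk h _ q).symm
  rw [e]
  exact (hh.1 _).isEqFlat.comp
    (IsEqFaithfullyFlat.of_bijective (Spec.toStalk_closedPoint_bijective hc)).toIsEqFlat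

end MonoidFan

/-! ### Generization maps on stalks and the stalks of pullbacks -/

namespace MonoidFan

namespace LMS
variable {X Y Z : LMS.{u}}

/-- The map `M_{X, x} → M_{X, x'}` for a generization `x'` of `x`. -/
def sp (X : LMS.{u}) {x x' : X} (h : x' ⤳ x) : X.str.stalk x →* X.str.stalk x' :=
  (X.str.stalkSpecializes h).hom

lemma sp_germ {x x' : X} (h : x' ⤳ x) {U : Opens X} (hx : x ∈ U) (s : X.str.obj (op U)) :
    X.sp h (X.germ x hx s) = X.germ x' (h.mem_open U.isOpen hx) s :=
  ConcreteCategory.congr_hom (X.str.germ_stalkSpecializes hx h) s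

lemma sp_refl {x : X} (h : x ⤳ x) (a : X.str.stalk x) : X.sp h a = a := by
  obtain ⟨U, hU, s, rfl⟩ := X.exists_germ x a
  exact sp_germ _ _ _

lemma map_specializes (f : X ⟶ Y) {x x' : X} (h : x' ⤳ x) : f.hom.base x' ⤳ f.hom.base x :=
  h.map (f.hom.base.hom.continuous)

lemma stalkHom_sp (f : X ⟶ Y) {x x' : X} (h : x' ⤳ x) (a : Y.str.stalk (f.hom.base x)) :
    stalkHom f x' (Y.sp (map_specializes f h) a) = X.sp h (stalkHom f x a) := by
  obtain ⟨U, hU, s, rfl⟩ := Y.exists_germ _ a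
  refine (congrArg (stalkHom f x') (sp_germ (map_specializes f h) hU s)).trans ?_
  refine (stalkHom_germ f x' _ s).trans ?_
  refine Eq.trans ?_ (congrArg (X.sp h) (stalkHom_germ f x hU s).symm)
  exact (sp_germ h (U := (Opens.map f.hom.base).obj U) hU (app f (op U) s)).symm

lemma isUnit_stalkHom (f : X ⟶ Y) {x : X} {a : Y.str.stalk (f.hom.base x)}
    (h : IsUnit (stalkHom f x a)) : IsUnit a :=
  (f.isLocal x).map_nonunit a h

lemma stalkHom_comp (f : X ⟶ Y) (g : Y ⟶ Z) (x : X) :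
    (stalkHom f x).comp (stalkHom g (f.hom.base x)) = stalkHom (f ≫ g) x := by
  ext a
  obtain ⟨U, hU, s, rfl⟩ := Z.exists_germ _ a
  rw [MonoidHom.comp_apply, stalkHom_germ]
  refine (stalkHom_germ f (V := (Opens.map g.hom.base).obj U) x hU (app g (op U) s)).trans ?_
  exact (stalkHom_germ (f ≫ g) x hU s).symm

lemma section_ext {U : Opens X} {s t : X.str.obj (op U)}
    (h : ∀ x (hx : x ∈ U), X.germ x hx s = X.germ x hx t) : s = t := by
  let F : TopCat.Sheaf (Type u) X.toPresheafedSpace.carrier := ⟨X.str ⋙ forget CommMonCat,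
    (TopCat.Presheaf.isSheaf_iff_isSheaf_comp (forget CommMonCat) _).1 X.toSheafedSpace.IsSheaf⟩
  have H : ∀ x : U, ∃ (W : Opens X) (_ : x.1 ∈ W) (i : W ⟶ U), X.str.map i.op s = X.str.map i.op t := by
    intro x
    obtain ⟨W, hW, i, j, e⟩ := (X.germ_eq_iff x.1 x.2 x.2 s t).1 (h x.1 x.2)
    exact ⟨W, hW, i, Subsingleton.elim j i ▸ e⟩
  choose W hW i e using H
  exact TopCat.Sheaf.eq_of_locally_eq' F W U i (fun x hx => Opens.mem_iSup.2 ⟨⟨x, hx⟩, hW _⟩) s t e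

/-- Morphisms that agree on points and germs are equal. -/
lemma hom_ext_of_germ {f g : X ⟶ Y} (hb : ∀ x, f.hom.base x = g.hom.base x)
    (h : ∀ (x : X) (V : Opens Y) (hf : f.hom.base x ∈ V) (hg : g.hom.base x ∈ V)
      (s : Y.str.obj (op V)),
      stalkHom f x (Y.germ _ hf s) = stalkHom g x (Y.germ _ hg s)) : f = g := by
  have hbase : f.hom.base = g.hom.base := by ext x; exact hb x
  obtain ⟨⟨fb, fc⟩, fl⟩ := f
  obtain ⟨⟨gb, gc⟩, gl⟩ := g
  obtain rfl : fb = gb := hbase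
  obtain rfl : fc = gc := by
    ext V s
    refine section_ext (U := (Opens.map fb).obj V) fun x hx => ?_
    have := h x V hx hx s
    refine (stalkHom_germ (X := X) (Y := Y) ⟨⟨fb, fc⟩, fl⟩ x hx s).symm.trans (this.trans ?_)
    exact stalkHom_germ (X := X) (Y := Y) ⟨⟨fb, gc⟩, gl⟩ x hx s
  rfl

namespace Modules

/-- The map `F_x → F_{x'}` for a generization `x'` of `x`. -/
def sp (F : X.Modules) {x x' : X} (h : x' ⤳ x) : F.stalk x → F.stalk x' :=
  F.presheaf.stalkSpecializes h

lemma sp_germ (F : X.Modules) {x x' : X} (h : x' ⤳ x) {U : Opens X} (hx : x ∈ U)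
    (s : F.presheaf.obj (op U)) :
    F.sp h (F.germ x hx s) = F.germ x' (h.mem_open U.isOpen hx) s :=
  ConcreteCategory.congr_hom (F.presheaf.germ_stalkSpecializes hx h) s

lemma sp_sp (F : X.Modules) {x x' x'' : X} (h : x' ⤳ x) (h' : x'' ⤳ x') (a : F.stalk x) :
    F.sp h' (F.sp h a) = F.sp (h'.trans h) a := by
  obtain ⟨U, hU, s, rfl⟩ := F.exists_germ x a
  rw [sp_germ, sp_germ, sp_germ]

lemma sp_refl (F : X.Modules) {x : X} (h : x ⤳ x) (a : F.stalk x) : F.sp h a = a := by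
  obtain ⟨U, hU, s, rfl⟩ := F.exists_germ x a
  exact sp_germ _ _ _ _

lemma exists_germ₂ (F : X.Modules) (x : X) (a : X.str.stalk x) (m : F.stalk x) :
    ∃ (U : Opens X) (hx : x ∈ U) (s : X.str.obj (op U)) (t : F.presheaf.obj (op U)),
      X.germ x hx s = a ∧ F.germ x hx t = m := by
  obtain ⟨U, hU, s, rfl⟩ := X.exists_germ x a
  obtain ⟨V, hV, t, rfl⟩ := F.exists_germ x m
  exact ⟨U ⊓ V, ⟨hU, hV⟩, X.str.map (homOfLE inf_le_left).op s,
    F.presheaf.map (homOfLE inf_le_right).op t, X.germ_map (homOfLE inf_le_left) _ _ _,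
    F.germ_map (homOfLE inf_le_right) _ _ _⟩

lemma sp_smul (F : X.Modules) {x x' : X} (h : x' ⤳ x) (a : X.str.stalk x) (m : F.stalk x) :
    F.sp h (a • m) = X.sp h a • F.sp h m := by
  obtain ⟨U, hU, s, t, rfl, rfl⟩ := F.exists_germ₂ x a m
  rw [← germ_smul, sp_germ, sp_germ, LMS.sp_germ, germ_smul]

lemma stalkMap_sp {F G : X.Modules} (φ : F ⟶ G) {x x' : X} (h : x' ⤳ x) (m : F.stalk x) :
    stalkMap φ x' (F.sp h m) = G.sp h (stalkMap φ x m) := by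
  obtain ⟨U, hU, s, rfl⟩ := F.exists_germ x m
  rw [sp_germ, stalkMap_germ, stalkMap_germ, sp_germ]

lemma stalkMap_smul {F G : X.Modules} (φ : F ⟶ G) (x : X) (a : X.str.stalk x) (m : F.stalk x) :
    stalkMap φ x (a • m) = a • stalkMap φ x m := by
  obtain ⟨U, hU, s, t, rfl, rfl⟩ := F.exists_germ₂ x a m
  rw [← germ_smul, stalkMap_germ, stalkMap_germ, φ.map_smul, germ_smul]

lemma stalkMap_id (F : X.Modules) (x : X) (m : F.stalk x) : stalkMap (𝟙 F) x m = m := by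
  obtain ⟨U, hU, s, rfl⟩ := F.exists_germ x m
  exact stalkMap_germ _ _ _ _

lemma stalkMap_comp {F G H : X.Modules} (φ : F ⟶ G) (ψ : G ⟶ H) (x : X) (m : F.stalk x) :
    stalkMap (φ ≫ ψ) x m = stalkMap ψ x (stalkMap φ x m) := by
  obtain ⟨U, hU, s, rfl⟩ := F.exists_germ x m
  rw [stalkMap_germ, stalkMap_germ, stalkMap_germ]; rfl

lemma hom_ext_stalk {F G : X.Modules} {φ ψ : F ⟶ G}
    (h : ∀ (x : X) (m : F.stalk x), stalkMap φ x m = stalkMap ψ x m) : φ = ψ :=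
  hom_ext fun U s => G.section_ext fun x hx => by
    rw [← stalkMap_germ, ← stalkMap_germ, h]

lemma stalkMap_bijective_of_isIso {F G : X.Modules} (φ : F ⟶ G) [IsIso φ] (x : X) :
    Function.Bijective (stalkMap φ x) := by
  refine Function.bijective_iff_has_inverse.2 ⟨stalkMap (inv φ) x, fun m => ?_, fun m => ?_⟩
  · rw [← stalkMap_comp, IsIso.hom_inv_id, stalkMap_id]
  · rw [← stalkMap_comp, IsIso.inv_hom_id, stalkMap_id]

lemma isIso_of_stalkMap_bijective {F G : X.Modules} (φ : F ⟶ G)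
    (h : ∀ x, Function.Bijective (stalkMap φ x)) : IsIso φ := by
  have H : ∀ U, Function.Bijective (φ.hom.app (op U)) := fun U =>
    TopCat.Presheaf.app_bijective_of_stalkFunctor_map_bijective
      (F := ⟨F.presheaf, F.isSheaf⟩) (G := ⟨G.presheaf, G.isSheaf⟩) ⟨φ.hom⟩ U (fun x _ => h x)
  let e : ∀ U, F.presheaf.obj U ≃ G.presheaf.obj U := fun U => Equiv.ofBijective _ (H U.unop)
  have he : ∀ U s, φ.hom.app U ((e U).symm s) = s := fun U s => (e U).apply_symm_apply s
  refine ⟨⟨{ app := fun U => ↾ (e U).symm, naturality := fun U V i => ?_ }, fun U a s => ?_⟩,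
    hom_ext fun U s => ?_, hom_ext fun U s => ?_⟩
  · ext s
    refine (H V.unop).1 ?_
    refine (he V _).trans (Eq.trans ?_ (naturality_apply φ i _).symm)
    exact congrArg (G.presheaf.map i) (he U s).symm
  · refine (H U.unop).1 ?_
    refine (he U _).trans (Eq.trans ?_ (φ.map_smul U _ _).symm)
    exact congrArg (a • ·) (he U s).symm
  · exact (e (op U)).symm_apply_apply s
  · exact he (op U) s

section Pullback
variable (f : X ⟶ Y) (F : Y.Modules) (x : X)

/-- The value in `M_{X, x} ⊗ F_{f x}` of a germ of `f^* F`. -/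
def pullbackVal : (pullbackObj f F).stalk x → PullbackStalk f F x :=
  TopCat.stalkToFiber (pullbackPred f F).sheafify x

lemma pullbackVal_germ {U : Opens X} (hx : x ∈ U) (s : (pullbackObj f F).presheaf.obj (op U)) :
    pullbackVal f F x ((pullbackObj f F).germ x hx s) = s.1 ⟨x, hx⟩ :=
  TopCat.stalkToFiber_germ _ U x hx s

lemma pullbackVal_smul (a : X.str.stalk x) (m : (pullbackObj f F).stalk x) :
    pullbackVal f F x (a • m) = a • pullbackVal f F x m := by
  obtain ⟨U, hU, s, t, rfl, rfl⟩ := (pullbackObj f F).exists_germ₂ x a m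
  rw [← germ_smul, pullbackVal_germ, pullbackVal_germ]
  rfl

/-- The germ of `f^* F` with a given value. -/
def pullbackGerm : PullbackStalk f F x → (pullbackObj f F).stalk x :=
  adjTensorMap (pullbackToFun (𝟙 (pullbackObj f F))) x

lemma pullbackGerm_mk_germ (a : X.str.stalk x) {V : Opens Y} (hx : f.hom.base x ∈ V)
    (m : F.presheaf.obj (op V)) :
    pullbackGerm f F x (Tensor.mk _ a (F.germ _ hx m)) =
      a • (pullbackObj f F).germ (U := (Opens.map f.hom.base).obj V) x hx (pullbackSection f F m) :=
  congrArg (a • ·) (adjStalkMap_germ (pullbackToFun (𝟙 (pullbackObj f F))) x hx m)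

lemma pullbackVal_pullbackGerm (t : PullbackStalk f F x) :
    pullbackVal f F x (pullbackGerm f F x t) = t := by
  induction t using Tensor.ind with
  | H a m =>
    obtain ⟨V, hV, m, rfl⟩ := F.exists_germ _ m
    refine (congrArg (pullbackVal f F x) (pullbackGerm_mk_germ f F x a hV m)).trans ?_
    refine (pullbackVal_smul f F x _ _).trans ?_
    refine (congrArg (a • ·) (pullbackVal_germ f F x (U := (Opens.map f.hom.base).obj V) hV
      (pullbackSection f F m))).trans ?_
    exact Tensor.smul_mk_one _ _

/-- `pullbackGerm` comes from the adjunct of the identity of f^* F. Transposing back returns the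
identity, so a section is reassembled from its own values. -/
lemma pullbackGerm_pullbackVal (m : (pullbackObj f F).stalk x) :
    pullbackGerm f F x (pullbackVal f F x m) = m := by
  obtain ⟨U, hU, s, rfl⟩ := (pullbackObj f F).exists_germ x m
  rw [pullbackVal_germ]
  refine (germ_adjSection (pullbackToFun (𝟙 (pullbackObj f F))) s x hU).symm.trans ?_
  refine congrArg ((pullbackObj f F).germ x hU) ?_
  exact congrArg (fun φ => φ.hom.app (op U) s)
    ((pullbackHomEquiv f F (pullbackObj f F)).left_inv (𝟙 _))

lemma pullbackVal_bijective : Function.Bijective (pullbackVal f F x) :=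
  Function.bijective_iff_has_inverse.2 ⟨pullbackGerm f F x, pullbackGerm_pullbackVal f F x,
    pullbackVal_pullbackGerm f F x⟩

variable {f F} in
/-- A morphism out of a pullback on stalks. -/
lemma stalkMap_pullbackGerm {G : X.Modules} (ψ : pullbackObj f F ⟶ G) (a : X.str.stalk x)
    {V : Opens Y} (hx : f.hom.base x ∈ V) (m : F.presheaf.obj (op V)) :
    stalkMap ψ x (pullbackGerm f F x (Tensor.mk _ a (F.germ _ hx m))) =
      a • G.germ (U := (Opens.map f.hom.base).obj V) x hx (ψ.hom.app _ (pullbackSection f F m)) := by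
  refine (congrArg (stalkMap ψ x) (pullbackGerm_mk_germ f F x a hx m)).trans ?_
  refine (stalkMap_smul ψ x a _).trans (congrArg (a • ·) ?_)
  exact stalkMap_germ ψ (U := (Opens.map f.hom.base).obj V) x hx (pullbackSection f F m)

lemma pullbackObj_sp {x x' : X} (h : x' ⤳ x) (m : (pullbackObj f F).stalk x) :
    pullbackVal f F x' ((pullbackObj f F).sp h m) =
      Tensor.lift (fun a n => Tensor.mk (stalkHom f x') (X.sp h a) (F.sp (map_specializes f h) n))
        (by
          intro a b n
          rw [map_mul, ← stalkHom_sp f h, Tensor.mk_mul, sp_smul]) (pullbackVal f F x m) := by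
  obtain ⟨t, rfl⟩ : ∃ t, m = pullbackGerm f F x t := ⟨_, (pullbackGerm_pullbackVal f F x m).symm⟩
  rw [pullbackVal_pullbackGerm]
  induction t using Tensor.ind with
  | H a m =>
    obtain ⟨V, hV, m, rfl⟩ := F.exists_germ _ m
    refine (congrArg (fun z => pullbackVal f F x' ((pullbackObj f F).sp h z))
      (pullbackGerm_mk_germ f F x a hV m)).trans ?_
    refine (congrArg (pullbackVal f F x') (sp_smul _ h a _)).trans ?_
    refine (pullbackVal_smul f F x' _ _).trans ?_
    refine (congrArg (fun z => X.sp h a • pullbackVal f F x' z) (sp_germ (pullbackObj f F) h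
      (U := (Opens.map f.hom.base).obj V) hV (pullbackSection f F m))).trans ?_
    refine (congrArg (X.sp h a • ·) (pullbackVal_germ f F x' (U := (Opens.map f.hom.base).obj V) _
      (pullbackSection f F m))).trans ?_
    refine (Tensor.smul_mk_one _ _).trans ?_
    exact congrArg (Tensor.mk _ (X.sp h a)) (sp_germ F (map_specializes f h) hV m).symm

end Pullback

section Comp
variable (f : X ⟶ Y) (g : Y ⟶ Z)

lemma pullback_map_pullbackSection {F G : Y.Modules} (φ : F ⟶ G) {V : Opens Y}
    (m : F.presheaf.obj (op V)) :
    ((pullback f).map φ).hom.app _ (pullbackSection f F m) =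
      pullbackSection f G (φ.hom.app (op V) m) :=
  congrArg (fun ψ => ψ.hom.app (op V) m) ((pullbackAdj f).unit.naturality φ).symm

/-- The comparison is by definition conjugate to g_* f_* = (g f)_*, which is the identity on
sections; compatibility of conjugates with the units then gives its value on the sections 1 ⊗ m. -/
lemma pullbackComp_hom_pullbackSection (F : Z.Modules) {V : Opens Z} (m : F.presheaf.obj (op V)) :
    ((pullbackComp f g).hom.app F).hom.app _
      (pullbackSection f (pullbackObj g F) (pullbackSection g F m)) =
      pullbackSection (f ≫ g) F m := by
  have h1 := unit_conjugateEquiv (pullbackAdj (f ≫ g)) ((pullbackAdj g).comp (pullbackAdj f))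
    (pullbackComp f g).hom F
  have h2 : conjugateEquiv (pullbackAdj (f ≫ g)) ((pullbackAdj g).comp (pullbackAdj f))
    (pullbackComp f g).hom = (pushforwardComp f g).inv := by
    simp [pullbackComp, Adjunction.leftAdjointCompIso]
  rw [h2] at h1
  exact (congrArg (fun ψ => ψ.hom.app (op V) m) h1).symm

lemma pullbackComp_inv_pullbackSection (F : Z.Modules) {V : Opens Z} (m : F.presheaf.obj (op V)) :
    ((pullbackComp f g).inv.app F).hom.app _ (pullbackSection (f ≫ g) F m) =
      (pullbackSection f (pullbackObj g F) (pullbackSection g F m)) := by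
  rw [← pullbackComp_hom_pullbackSection]
  exact congrArg (fun φ => φ.hom.app _ (pullbackSection f (pullbackObj g F) (pullbackSection g F m)))
    ((pullbackComp f g).hom_inv_id_app F)
end Comp

end Modules
end LMS
end MonoidFan

/-! ### Test spaces: one-point spaces and the Sierpiński space -/

namespace MonoidFan

namespace LMS

lemma exists_germ₂ (X : LMS.{u}) (x : X) (a b : X.str.stalk x) :
    ∃ (U : Opens X) (hx : x ∈ U) (s t : X.str.obj (op U)),
      X.germ x hx s = a ∧ X.germ x hx t = b := by
  obtain ⟨U, hU, s, rfl⟩ := X.exists_germ x a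
  obtain ⟨V, hV, t, rfl⟩ := X.exists_germ x b
  exact ⟨U ⊓ V, ⟨hU, hV⟩, X.str.map (homOfLE inf_le_left).op s,
    X.str.map (homOfLE inf_le_right).op t, X.germ_map (homOfLE inf_le_left) _ _ _,
    X.germ_map (homOfLE inf_le_right) _ _ _⟩

/-- A system of monoids on the points of a space together with maps to generizations. -/
structure StalkSystem (T : TopCat.{u}) where
  mon : T → Type u
  [commMonoid : ∀ t, CommMonoid (mon t)]
  res : ∀ {t t' : T}, t' ⤳ t → mon t →* mon t'
  res_refl : ∀ {t : T} (h : t ⤳ t) (a : mon t), res h a = a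
  res_res : ∀ {t t' t'' : T} (h : t' ⤳ t) (h' : t'' ⤳ t') (a : mon t),
    res h' (res h a) = res (h'.trans h) a

namespace StalkSystem
attribute [instance] commMonoid
variable {T : TopCat.{u}} (A : StalkSystem T)

/-- The families that are compatible with generization. -/
def compatible : TopCat.LocalPredicate A.mon where
  pred {U} s := ∀ (t t' : U) (h : t'.1 ⤳ t.1), A.res h (s t) = s t'
  res i _ hs t t' h := hs (i t) (i t') h
  locality {U} s hs t t' h := by
    obtain ⟨V, hV, i, H⟩ := hs t
    exact H ⟨t.1, hV⟩ ⟨t'.1, h.mem_open V.isOpen hV⟩ h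

/-- The compatible families over an open set. -/
def sections (U : (Opens T)ᵒᵖ) : Submonoid (∀ t : U.unop, A.mon t.1) where
  carrier := {s | A.compatible.pred s}
  one_mem' := fun _ _ h => map_one (A.res h)
  mul_mem' := fun hs hs' t t' h =>
    (map_mul (A.res h) _ _).trans (congrArg₂ (· * ·) (hs t t' h) (hs' t t' h))

/-- The sheaf of compatible families. -/
def presheaf : TopCat.Presheaf CommMonCat.{u} T where
  obj U := CommMonCat.of (A.sections U)
  map {U V} i := CommMonCat.ofHom
    { toFun := fun s => ⟨fun t => s.1 (i.unop t), A.compatible.res i.unop s.1 s.2⟩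
      map_one' := rfl
      map_mul' := fun _ _ => rfl }

lemma isSheaf : A.presheaf.IsSheaf :=
  (TopCat.Presheaf.isSheaf_iff_isSheaf_comp (forget CommMonCat) _).2
    (TopCat.Presheaf.isSheaf_of_iso (NatIso.ofComponents (fun U => Iso.refl _) (by intros; rfl))
      (TopCat.subsheafToTypes A.compatible).property)

/-- The space `T` with the sheaf of compatible families. -/
def space : LMS.{u} := ⟨{ carrier := T, presheaf := A.presheaf, IsSheaf := A.isSheaf }⟩

/-- The value at `t`, as an element of `A t`, of a germ. -/
def evalFun (t : T) (a : A.space.str.stalk t) : A.mon t :=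
  (A.space.exists_germ t a).choose_spec.choose_spec.choose.1
    ⟨t, (A.space.exists_germ t a).choose_spec.choose⟩

lemma evalFun_germ (t : T) {U : Opens T} (ht : t ∈ U) (s : A.sections (op U)) :
    A.evalFun t (A.space.germ t ht s) = s.1 ⟨t, ht⟩ := by
  have := (A.space.exists_germ t (A.space.germ t ht s)).choose_spec.choose_spec.choose_spec
  obtain ⟨W, hW, i, j, e⟩ := (A.space.germ_eq_iff t _ _ _ _).1 this
  exact congrFun (congrArg Subtype.val e) ⟨t, hW⟩

/-- The value at `t`, as an element of `A t`, of a germ. -/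
def eval (t : T) : A.space.str.stalk t →* A.mon t where
  toFun := A.evalFun t
  map_one' := by
    rw [← A.space.germ_one t (U := ⊤) trivial]
    exact A.evalFun_germ t _ _
  map_mul' a b := by
    obtain ⟨U, hU, s, s', rfl, rfl⟩ := A.space.exists_germ₂ t a b
    refine (congrArg (A.evalFun t) (A.space.germ_mul t hU s s').symm).trans ?_
    refine (A.evalFun_germ t hU (s * s' : A.sections (op U))).trans ?_
    exact (congrArg₂ (· * ·) (A.evalFun_germ t hU s) (A.evalFun_germ t hU s')).symm

lemma eval_germ (t : T) {U : Opens T} (ht : t ∈ U) (s : A.sections (op U)) :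
    A.eval t (A.space.germ t ht s) = s.1 ⟨t, ht⟩ := A.evalFun_germ t ht s

/-- On the smallest neighbourhood of t a compatible family is determined by its value at t, and
every value spreads out through `res`. -/
lemma eval_bijective (t : T) (ht : IsOpen {t' | t' ⤳ t}) : Function.Bijective (A.eval t) := by
  constructor
  · intro a b e
    obtain ⟨U, hU, s, rfl⟩ := A.space.exists_germ t a
    obtain ⟨V, hV, s', rfl⟩ := A.space.exists_germ t b
    have e' : s.1 ⟨t, hU⟩ = s'.1 ⟨t, hV⟩ :=
      (A.eval_germ t hU s).symm.trans (e.trans (A.eval_germ t hV s'))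
    refine (A.space.germ_eq_iff t _ _ _ _).2 ⟨⟨_, ht⟩, specializes_rfl,
      homOfLE fun x (hx : x ⤳ t) => hx.mem_open U.isOpen hU,
      homOfLE fun x (hx : x ⤳ t) => hx.mem_open V.isOpen hV, Subtype.ext (funext fun x => ?_)⟩
    have hx : x.1 ⤳ t := x.2
    refine (s.2 ⟨t, hU⟩ ⟨x.1, hx.mem_open U.isOpen hU⟩ hx).symm.trans ?_
    exact (congrArg (A.res hx) e').trans (s'.2 ⟨t, hV⟩ ⟨x.1, hx.mem_open V.isOpen hV⟩ hx)
  · intro a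
    let s : A.sections (op (⟨_, ht⟩ : Opens T)) := ⟨fun x => A.res (show x.1 ⤳ t from x.2) a,
      fun x x' h => A.res_res _ _ _⟩
    exact ⟨A.space.germ t (U := ⟨_, ht⟩) specializes_rfl s,
      (A.eval_germ t (U := ⟨_, ht⟩) specializes_rfl s).trans (A.res_refl _ _)⟩

section Hom
variable {X : LMS.{u}} (g : T ⟶ X.toPresheafedSpace.carrier)
  (α : ∀ t : T, X.str.stalk (g t) →* A.mon t)
  (hα : ∀ {t t' : T} (h : t' ⤳ t) (a : X.str.stalk (g t)),
    A.res h (α t a) = α t' (X.sp (h.map g.hom.continuous) a))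

/-- The map of ringed spaces given by maps on stalks. -/
def homAux : A.space.toPresheafedSpace ⟶ X.toPresheafedSpace where
  base := g
  c :=
    { app := fun V => CommMonCat.ofHom
        { toFun := fun s => ⟨fun t => α t.1 (X.germ (g t.1) t.2 s), fun t t' h => by
            refine (hα h _).trans (congrArg (α t'.1) ?_)
            exact sp_germ (h.map g.hom.continuous) t.2 s⟩
          map_one' := Subtype.ext (funext fun t =>
            (congrArg (α t.1) (X.germ_one _ _)).trans (map_one _))
          map_mul' := fun s s' => Subtype.ext (funext fun t =>
            (congrArg (α t.1) (X.germ_mul _ _ s s')).trans (map_mul (α t.1) _ _)) }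
      naturality := fun V W i => by
        ext s
        exact Subtype.ext (funext fun t => congrArg (α t.1) (X.germ_map i.unop (g t.1) t.2 s)) }

lemma eval_homAux (t : T) (a : X.str.stalk (g t)) :
    A.eval t (((A.homAux g α hα).stalkMap t).hom a) = α t a := by
  obtain ⟨U, hU, s, rfl⟩ := X.exists_germ (g t) a
  refine (congrArg (A.eval t) (PresheafedSpace.stalkMap_germ_apply (A.homAux g α hα) U t hU s)).trans ?_
  exact A.eval_germ t (U := (Opens.map g).obj U) hU _

lemma isUnit_of_isUnit_homAux (t : T) (a : X.str.stalk (g t))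
    (ha : IsUnit (((A.homAux g α hα).stalkMap t).hom a)) : IsUnit (α t a) := by
  rw [← A.eval_homAux g α hα]
  exact ha.map (A.eval t)

variable (hl : ∀ (t : T) (a : X.str.stalk (g t)), IsUnit (α t a) → IsUnit a)

/-- The morphism given by local maps on stalks. -/
def homMk : A.space ⟶ X where
  hom := A.homAux g α hα
  isLocal t := ⟨fun a ha => hl t a (A.isUnit_of_isUnit_homAux g α hα t a ha)⟩

lemma eval_stalkHom_homMk (t : T) (a : X.str.stalk (g t)) :
    A.eval t (stalkHom (A.homMk g α hα hl) t a) = α t a :=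
  A.eval_homAux g α hα t a

end Hom

end StalkSystem

section Point
variable (A : Type u) [CommMonoid A]

/-- The system on the one-point space with value `A`. -/
def pointSystem : StalkSystem (TopCat.of PUnit.{u + 1}) where
  mon _ := A
  res _ := MonoidHom.id A
  res_refl _ _ := rfl
  res_res _ _ _ := rfl

/-- The one-point space with the monoid `A`. -/
abbrev point : LMS.{u} := (pointSystem A).space

/-- The stalk of the one-point space. -/
def pointEval : (point A).str.stalk PUnit.unit →* A := (pointSystem A).eval PUnit.unit

lemma pointEval_bijective : Function.Bijective (pointEval A) :=
  (pointSystem A).eval_bijective PUnit.unit (by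
    convert isOpen_univ
    exact Set.eq_univ_of_forall fun _ => specializes_rfl)

variable {A} {X : LMS.{u}} {x : X} (a : X.str.stalk x →* A) (ha : ∀ p, IsUnit (a p) → IsUnit p)

/-- The morphism from the one-point space to `X` with image `x` given by a local map on stalks. -/
def ofPoint : point A ⟶ X :=
  (pointSystem A).homMk (TopCat.ofHom ⟨fun _ => x, continuous_const⟩) (fun _ => a)
    (fun _ p => congrArg a (sp_refl _ p).symm) (fun _ p hp => ha p hp)

lemma pointEval_stalkHom (p : X.str.stalk x) :
    pointEval A (stalkHom (ofPoint a ha) PUnit.unit p) = a p :=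
  (pointSystem A).eval_stalkHom_homMk (TopCat.ofHom ⟨fun _ => x, continuous_const⟩) (fun _ => a)
    (fun _ p => congrArg a (sp_refl _ p).symm) (fun _ p hp => ha p hp) PUnit.unit p

lemma pointEval_comp_stalkHom :
    (pointEval A).comp (stalkHom (ofPoint a ha) PUnit.unit) = a :=
  MonoidHom.ext (pointEval_stalkHom a ha)

/-- Morphisms from a one-point space are equal if they agree on the point and the stalk. -/
lemma point_hom_ext {Z : LMS.{u}} {p q : point A ⟶ Z}
    (hb : p.hom.base PUnit.unit = q.hom.base PUnit.unit)
    (h : ∀ (V : Opens Z) (hp : p.hom.base PUnit.unit ∈ V) (hq : q.hom.base PUnit.unit ∈ V)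
      (s : Z.str.obj (op V)), pointEval A (stalkHom p PUnit.unit (Z.germ _ hp s)) =
        pointEval A (stalkHom q PUnit.unit (Z.germ _ hq s))) : p = q :=
  hom_ext_of_germ (fun _ => hb) fun _ V hp hq s => (pointEval_bijective A).1 (h V hp hq s)

end Point

section Sierpinski

/-- The points of the Sierpiński space. -/
inductive Sierpinski : Type u
  | closed | generic

instance : TopologicalSpace Sierpinski.{u} where
  IsOpen U := .closed ∈ U → .generic ∈ U
  isOpen_univ _ := trivial
  isOpen_inter _ _ h h' := fun hx => ⟨h hx.1, h' hx.2⟩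
  isOpen_sUnion _ h := fun ⟨U, hU, hx⟩ => ⟨U, hU, h U hU hx⟩

lemma Sierpinski.specializes : (generic : Sierpinski.{u}) ⤳ closed :=
  specializes_iff_forall_open.2 fun _ hU h => hU h

lemma Sierpinski.not_specializes : ¬ (closed : Sierpinski.{u}) ⤳ generic := fun h => by
  have := h.mem_open (s := {generic}) (fun h => by cases h) rfl
  cases this

lemma Sierpinski.isOpen_setOf_specializes (t : Sierpinski.{u}) : IsOpen {t' | t' ⤳ t} :=
  fun h => specializes.trans h

variable {A A' : Type u} [CommMonoid A] [CommMonoid A'] (ρ : A →* A')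

/-- The stalks of the space attached to a map of monoids. -/
def sierpinskiMon (A A' : Type u) : Sierpinski.{u} → Type u
  | .closed => A
  | .generic => A'

instance : ∀ t, CommMonoid (sierpinskiMon A A' t)
  | .closed => inferInstanceAs (CommMonoid A)
  | .generic => inferInstanceAs (CommMonoid A')

/-- The system on the Sierpiński space given by a map of monoids. -/
def sierpinskiSystem : StalkSystem (TopCat.of Sierpinski.{u}) where
  mon := sierpinskiMon A A'
  res {t t'} h := match t, t', h with
    | .closed, .closed, _ => MonoidHom.id A
    | .generic, .generic, _ => MonoidHom.id A'
    | .closed, .generic, _ => ρ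
    | .generic, .closed, h => (Sierpinski.not_specializes h).elim
  res_refl {t} h a := by cases t <;> rfl
  res_res {t t' t''} h h' a := by
    cases t <;> cases t' <;> cases t'' <;>
      first
      | rfl
      | exact (Sierpinski.not_specializes h).elim
      | exact (Sierpinski.not_specializes h').elim

/-- The Sierpiński space with the sheaf given by a map of monoids. -/
abbrev sierpinski : LMS.{u} := (sierpinskiSystem ρ).space

variable {ρ} {X : LMS.{u}} {x x' : X} (h : x' ⤳ x) (a : X.str.stalk x →* A)
  (ha : ∀ p, IsUnit (a p) → IsUnit p) (a' : X.str.stalk x' →* A')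
  (ha' : ∀ p, IsUnit (a' p) → IsUnit p) (hρ : ρ.comp a = a'.comp (X.sp h))

/-- The images of the points. -/
def sierpinskiBase (x x' : X) : Sierpinski.{u} → X
  | .closed => x
  | .generic => x'

/-- The maps on stalks. -/
def sierpinskiStalk (x x' : X) (a : X.str.stalk x →* A) (a' : X.str.stalk x' →* A') :
    ∀ t, X.str.stalk (sierpinskiBase x x' t) →* sierpinskiMon A A' t
  | .closed => a
  | .generic => a'

include h in
lemma continuous_sierpinskiBase : Continuous (sierpinskiBase x x') :=
  continuous_def.2 fun _ hU hx => h.mem_open hU hx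

include hρ in
lemma sierpinskiStalk_compat {t t' : Sierpinski.{u}} (h' : t' ⤳ t)
    (p : X.str.stalk (sierpinskiBase x x' t)) :
    (sierpinskiSystem ρ).res h' (sierpinskiStalk x x' a a' t p) = sierpinskiStalk x x' a a' t'
      (X.sp (h'.map (continuous_sierpinskiBase h)) p) :=
  match t, t', h' with
  | .closed, .closed, _ => congrArg a (sp_refl _ p).symm
  | .generic, .generic, _ => congrArg a' (sp_refl _ p).symm
  | .closed, .generic, _ => DFunLike.congr_fun hρ p
  | .generic, .closed, h => (Sierpinski.not_specializes h).elim

include ha ha' in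
lemma sierpinskiStalk_local (t : Sierpinski.{u}) (p : X.str.stalk (sierpinskiBase x x' t))
    (hp : IsUnit (sierpinskiStalk x x' a a' t p)) : IsUnit p :=
  match t with
  | .closed => ha p hp
  | .generic => ha' p hp

/-- The morphism from the Sierpiński space to `X` given by local maps on stalks. -/
def ofSierpinski : sierpinski ρ ⟶ X :=
  (sierpinskiSystem ρ).homMk
    (TopCat.ofHom ⟨sierpinskiBase x x', continuous_sierpinskiBase h⟩)
    (sierpinskiStalk x x' a a') (fun h' p => sierpinskiStalk_compat h a a' hρ h' p)
    (sierpinskiStalk_local a ha a' ha')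

/-- The stalk at the closed point. -/
def sierpinskiEvalClosed (ρ : A →* A') : (sierpinski ρ).str.stalk Sierpinski.closed →* A :=
  (sierpinskiSystem ρ).eval Sierpinski.closed

/-- The stalk at the generic point. -/
def sierpinskiEvalGeneric (ρ : A →* A') : (sierpinski ρ).str.stalk Sierpinski.generic →* A' :=
  (sierpinskiSystem ρ).eval Sierpinski.generic

lemma sierpinskiEvalClosed_bijective : Function.Bijective (sierpinskiEvalClosed ρ) :=
  (sierpinskiSystem ρ).eval_bijective Sierpinski.closed
    (Sierpinski.isOpen_setOf_specializes _)

lemma sierpinskiEvalGeneric_bijective : Function.Bijective (sierpinskiEvalGeneric ρ) :=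
  (sierpinskiSystem ρ).eval_bijective Sierpinski.generic
    (Sierpinski.isOpen_setOf_specializes _)

lemma sierpinskiEvalClosed_comp_stalkHom :
    (sierpinskiEvalClosed ρ).comp (stalkHom (ofSierpinski h a ha a' ha' hρ) Sierpinski.closed) = a :=
  MonoidHom.ext ((sierpinskiSystem ρ).eval_stalkHom_homMk
    (TopCat.ofHom ⟨sierpinskiBase x x', continuous_sierpinskiBase h⟩)
    (sierpinskiStalk x x' a a') (fun h' p => sierpinskiStalk_compat h a a' hρ h' p)
    (sierpinskiStalk_local a ha a' ha') Sierpinski.closed)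

lemma sierpinskiEvalGeneric_comp_stalkHom :
    (sierpinskiEvalGeneric ρ).comp (stalkHom (ofSierpinski h a ha a' ha' hρ) Sierpinski.generic) =
      a' :=
  MonoidHom.ext ((sierpinskiSystem ρ).eval_stalkHom_homMk
    (TopCat.ofHom ⟨sierpinskiBase x x', continuous_sierpinskiBase h⟩)
    (sierpinskiStalk x x' a a') (fun h' p => sierpinskiStalk_compat h a a' hρ h' p)
    (sierpinskiStalk_local a ha a' ha') Sierpinski.generic)

end Sierpinski

end LMS
end MonoidFan

/-! ### Morphisms between pullbacks on fibres, and descent data -/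

namespace MonoidFan

namespace LMS
namespace Modules
variable {T T' X Y Z : LMS.{u}}

section Fib
variable {p : T ⟶ X} {q : T ⟶ Y} {r : T ⟶ Z} {F : X.Modules} {G : Y.Modules} {H : Z.Modules}

/-- The map on the fibres `M_{T, t} ⊗ F_{p t} → M_{T, t} ⊗ G_{q t}` given by `p^* F ⟶ q^* G`. -/
def fib (ψ : pullbackObj p F ⟶ pullbackObj q G) (t : T) : PullbackStalk p F t → PullbackStalk q G t :=
  fun z => pullbackVal q G t (stalkMap ψ t (pullbackGerm p F t z))

lemma pullbackGerm_smul (p : T ⟶ X) (F : X.Modules) (t : T) (a : T.str.stalk t)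
    (z : PullbackStalk p F t) : pullbackGerm p F t (a • z) = a • pullbackGerm p F t z :=
  adjTensorMap_smul _ t a z

lemma fib_smul (ψ : pullbackObj p F ⟶ pullbackObj q G) (t : T) (a : T.str.stalk t)
    (z : PullbackStalk p F t) : fib ψ t (a • z) = a • fib ψ t z := by
  rw [fib, pullbackGerm_smul, stalkMap_smul, pullbackVal_smul]; rfl

lemma fib_id (t : T) (z : PullbackStalk p F t) : fib (𝟙 (pullbackObj p F)) t z = z := by
  rw [fib, stalkMap_id, pullbackVal_pullbackGerm]

lemma fib_comp (ψ : pullbackObj p F ⟶ pullbackObj q G) (φ : pullbackObj q G ⟶ pullbackObj r H)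
    (t : T) (z : PullbackStalk p F t) : fib (ψ ≫ φ) t z = fib φ t (fib ψ t z) := by
  rw [fib, fib, fib, stalkMap_comp, pullbackGerm_pullbackVal]

lemma fib_mk_germ (ψ : pullbackObj p F ⟶ pullbackObj q G) (t : T) (a : T.str.stalk t)
    {V : Opens X} (ht : p.hom.base t ∈ V) (m : F.presheaf.obj (op V)) :
    fib ψ t (Tensor.mk _ a (F.germ _ ht m)) = a • (ψ.hom.app _ (pullbackSection p F m)).1 ⟨t, ht⟩ := by
  refine (congrArg (pullbackVal q G t) (stalkMap_pullbackGerm t ψ a ht m)).trans ?_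
  refine (pullbackVal_smul q G t a _).trans (congrArg (a • ·) ?_)
  exact pullbackVal_germ q G t (U := (Opens.map p.hom.base).obj V) ht _

lemma fib_injective {ψ φ : pullbackObj p F ⟶ pullbackObj q G} (h : ∀ t z, fib ψ t z = fib φ t z) :
    ψ = φ := by
  refine hom_ext_stalk fun t m => (pullbackVal_bijective q G t).1 ?_
  have := h t (pullbackVal p F t m)
  rwa [fib, fib, pullbackGerm_pullbackVal] at this

lemma fib_map {F F' : X.Modules} (φ : F ⟶ F') (t : T) (a : T.str.stalk t) (m : F.stalk (p.hom.base t)) :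
    fib ((pullback p).map φ : pullbackObj p F ⟶ pullbackObj p F') t (Tensor.mk _ a m) =
      Tensor.mk _ a (stalkMap φ _ m) := by
  obtain ⟨V, hV, m, rfl⟩ := F.exists_germ _ m
  refine (fib_mk_germ _ t a hV m).trans ?_
  rw [stalkMap_germ]
  refine (congrArg (fun z => a • z) (congrFun (congrArg Subtype.val
    (pullback_map_pullbackSection p φ m)) ⟨t, hV⟩)).trans ?_
  exact Tensor.smul_mk_one _ _

/-- The map `M_{T, t} ⊗ F_{p t} → M_{T, t'} ⊗ F_{p t'}` for a generization `t'` of `t`. -/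
def fibSp (p : T ⟶ X) (F : X.Modules) {t t' : T} (h : t' ⤳ t) :
    PullbackStalk p F t → PullbackStalk p F t' :=
  Tensor.lift (fun a n => Tensor.mk (stalkHom p t') (T.sp h a) (F.sp (map_specializes p h) n)) (by
    intro a b n
    rw [map_mul, ← stalkHom_sp p h, Tensor.mk_mul, sp_smul])

/-- A morphism of sheaves commutes with generization, and `fibSp` is the generization map of p^* F
seen through `pullbackVal`. -/
lemma fib_fibSp (ψ : pullbackObj p F ⟶ pullbackObj q G) {t t' : T} (h : t' ⤳ t)
    (z : PullbackStalk p F t) : fib ψ t' (fibSp p F h z) = fibSp q G h (fib ψ t z) := by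
  have h1 : fibSp p F h z = pullbackVal p F t' ((pullbackObj p F).sp h (pullbackGerm p F t z)) := by
    rw [pullbackObj_sp, pullbackVal_pullbackGerm]; rfl
  rw [h1, fib, pullbackGerm_pullbackVal, stalkMap_sp, pullbackObj_sp]; rfl

end Fib

section Comp
variable (g : T' ⟶ T) (p : T ⟶ X) (F : X.Modules)

/-- The map `M_{T, g t} ⊗ F → M_{T', t} ⊗ F`. -/
def fibPull (t : T') : PullbackStalk p F (g.hom.base t) → PullbackStalk (g ≫ p) F t :=
  Tensor.map (stalkHom g t) (stalkHom_comp g p t)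

lemma fib_pullbackComp_hom (t : T') (a : T'.str.stalk t)
    (z : (pullbackObj p F).stalk (g.hom.base t)) :
    fib (p := g) (q := g ≫ p) ((pullbackComp g p).hom.app F) t (Tensor.mk _ a z) =
      a • fibPull g p F t (pullbackVal p F _ z) := by
  obtain ⟨z, rfl⟩ : ∃ z', z = pullbackGerm p F _ z' := ⟨_, (pullbackGerm_pullbackVal p F _ z).symm⟩
  rw [pullbackVal_pullbackGerm]
  induction z using Tensor.ind with
  | H b m =>
    obtain ⟨V, hV, m, rfl⟩ := F.exists_germ _ m
    have e1 : (Tensor.mk (stalkHom g t) a (pullbackGerm p F _ (Tensor.mk _ b (F.germ _ hV m)))) =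
        Tensor.mk (stalkHom g t) (a * stalkHom g t b)
          ((pullbackObj p F).germ (U := (Opens.map p.hom.base).obj V) _ hV (pullbackSection p F m)) := by
      rw [Tensor.mk_mul]
      exact congrArg (Tensor.mk _ a) (pullbackGerm_mk_germ p F _ b hV m)
    refine (congrArg (fib (p := g) (q := g ≫ p) ((pullbackComp g p).hom.app F) t) e1).trans ?_
    refine (fib_mk_germ _ t _ (V := (Opens.map p.hom.base).obj V) hV _).trans ?_
    refine (congrArg (fun z => (a * stalkHom g t b) • z) (congrFun (congrArg Subtype.val
      (pullbackComp_hom_pullbackSection g p F m)) ⟨t, hV⟩)).trans ?_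
    refine (Tensor.smul_mk_one _ _).trans ?_
    rfl

lemma fib_pullbackComp_inv (t : T') (z : PullbackStalk p F (g.hom.base t)) :
    fib (p := g ≫ p) (q := g) ((pullbackComp g p).inv.app F) t (fibPull g p F t z) =
      Tensor.mk _ 1 (pullbackGerm p F _ z) := by
  have h1 := fib_pullbackComp_hom g p F t 1 (pullbackGerm p F _ z)
  rw [pullbackVal_pullbackGerm, one_smul] at h1
  rw [← h1]
  refine (fib_comp (p := g) (q := g ≫ p) (r := g) _ _ t _).symm.trans ?_
  refine Eq.trans ?_ (fib_id (p := g) (F := pullbackObj p F) t _)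
  exact congrArg (fun ψ => fib (p := g) (q := g) ψ t (Tensor.mk _ 1 (pullbackGerm p F _ z)))
    ((pullbackComp g p).hom_inv_id_app F)

-- The base change of ψ along g, corrected by the comparison isomorphisms, is extension of scalars
-- along the stalk map of g. The base change axiom of descent data is used in this form.
variable {p F} in
lemma fib_pull {q : T ⟶ Y} {G : Y.Modules} (ψ : pullbackObj p F ⟶ pullbackObj q G) (t : T')
    (z : PullbackStalk p F (g.hom.base t)) :
    fib (p := g ≫ p) (q := g ≫ q) ((pullbackComp g p).inv.app F ≫ (pullback g).map ψ ≫
      (pullbackComp g q).hom.app G) t (fibPull g p F t z) = fibPull g q G t (fib ψ _ z) := by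
  refine (fib_comp (p := g ≫ p) (q := g) (r := g ≫ q) _ _ t _).trans ?_
  refine (congrArg _ (fib_pullbackComp_inv g p F t z)).trans ?_
  refine (fib_comp (p := g) (q := g) (r := g ≫ q) _ _ t _).trans ?_
  refine (congrArg _ (fib_map (p := g) ψ t 1 _)).trans ?_
  refine (fib_pullbackComp_hom g q G t 1 _).trans ?_
  rw [one_smul]; rfl

end Comp
end Modules

open Modules

variable {X Y : LMS.{u}} {f : X ⟶ Y}

namespace ModDescent
variable (D : ModDescent f) {T T' : LMS.{u}} 

/-- The isomorphism `p₁^* N ≅ p₂^* N` of the descent datum. -/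
def glueHom (p₁ p₂ : T ⟶ X) (w : p₁ ≫ f = p₂ ≫ f) :
    pullbackObj p₁ D.sheaf ⟶ pullbackObj p₂ D.sheaf :=
  D.hom (p₁ ≫ f) (i₁ := ()) (i₂ := ()) p₁ p₂ rfl w.symm

lemma glueHom_self (p : T ⟶ X) : D.glueHom p p rfl = 𝟙 (pullbackObj p D.sheaf) :=
  D.hom_self (p ≫ f) p rfl

lemma hom_eq_glueHom {p₁ p₂ : T ⟶ X} (q : T ⟶ Y) (w₁ : p₁ ≫ f = q) (w₂ : p₂ ≫ f = q) :
    D.hom q (i₁ := ()) (i₂ := ()) p₁ p₂ w₁ w₂ = D.glueHom p₁ p₂ (w₁.trans w₂.symm) := by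
  subst w₁
  rfl

lemma glueHom_comp {p₁ p₂ p₃ : T ⟶ X} (w : p₁ ≫ f = p₂ ≫ f) (w' : p₂ ≫ f = p₃ ≫ f) :
    D.glueHom p₁ p₂ w ≫ D.glueHom p₂ p₃ w' = D.glueHom p₁ p₃ (w.trans w') := by
  have := D.hom_comp (p₁ ≫ f) (i₁ := ()) (i₂ := ()) (i₃ := ()) p₁ p₂ p₃ rfl w.symm (w.trans w').symm
  rw [hom_eq_glueHom, hom_eq_glueHom, hom_eq_glueHom] at this
  exact this

lemma glueHom_pull (g : T' ⟶ T) {p₁ p₂ : T ⟶ X} (w : p₁ ≫ f = p₂ ≫ f) :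
    (pullbackComp g p₁).inv.app D.sheaf ≫ (pullback g).map (D.glueHom p₁ p₂ w) ≫
      (pullbackComp g p₂).hom.app D.sheaf = D.glueHom (g ≫ p₁) (g ≫ p₂) (by simp [w]) := by
  have := D.pullHom_hom g (p₁ ≫ f) ((g ≫ p₁) ≫ f) (by simp) (i₁ := ()) (i₂ := ()) p₁ p₂ rfl w.symm
    (g ≫ p₁) (g ≫ p₂) rfl rfl
  refine Eq.trans ?_ this
  unfold Pseudofunctor.LocallyDiscreteOpToCat.pullHom
  -- For a composite that holds by definition `mapComp'` is `mapComp`, which unfolds to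
  -- `pullbackComp`.
  have e : ∀ p : T ⟶ X, pseudofunctor.mapComp' p.op.toLoc g.op.toLoc (g ≫ p).op.toLoc rfl = 
    pseudofunctor.mapComp p.op.toLoc g.op.toLoc := fun p => pseudofunctor.mapComp'_eq_mapComp _ _
  rw [e, e]
  rfl

end ModDescent
end LMS
end MonoidFan

/-! ### Descent data at pairs of monoid-valued points -/

namespace MonoidFan

/-- A map of monoids is local if only units are mapped to units. -/
def IsLoc {P Q : Type u} [CommMonoid P] [CommMonoid Q] (h : Q →* P) : Prop :=
  ∀ q, IsUnit (h q) → IsUnit q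

namespace IsLoc
variable {P Q R : Type u} [CommMonoid P] [CommMonoid Q] [CommMonoid R]

lemma comp {k : P →* R} {h : Q →* P} (hk : IsLoc k) (hh : IsLoc h) : IsLoc (k.comp h) :=
  fun q hq => hh q (hk _ hq)

lemma of_bijective {h : Q →* P} (hh : Function.Bijective h) : IsLoc h :=
  (IsEqFaithfullyFlat.of_bijective hh).isUnit

lemma pushoutLift {S : Type u} [CommMonoid S] {h : Q →* P} {k : Q →* R} {f : P →* S} {g : R →* S}
    (hf : IsLoc f) (hg : IsLoc g) (w : f.comp h = g.comp k) : IsLoc (Pushout.lift f g w) := by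
  intro x hx
  obtain ⟨p, r, rfl⟩ := Pushout.exists_eq x
  rw [map_mul, ← MonoidHom.comp_apply, ← MonoidHom.comp_apply, Pushout.lift_comp_inl,
    Pushout.lift_comp_inr] at hx
  exact ((hf p (isUnit_of_mul_isUnit_left hx)).map _).mul
    ((hg r (isUnit_of_mul_isUnit_right hx)).map _)

/-- A map h that is local but perhaps not flat stays local after base change along a faithfully flat
k. It is applied to composites M_{Y,y} → M_{X,x} → A, where A is not assumed flat. -/
lemma pushoutInr {h : Q →* P} {k : Q →* R} (hh : IsLoc h) (hk : IsEqFaithfullyFlat k) :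
    IsLoc (Pushout.inr h k) := by
  intro r hr
  obtain ⟨x, hx⟩ := hr.exists_right_inv
  obtain ⟨a, b, rfl⟩ := Pushout.exists_eq x
  have hx' : Pushout.inl h k a * Pushout.inr h k (r * b) =
      Pushout.inl h k 1 * Pushout.inr h k 1 := by
    rw [map_mul, mul_left_comm, hx]; simp
  obtain ⟨c, q, q', e, e1, e2⟩ := (Pushout.mul_eq_iff hk.toIsEqFlat).1 hx'
  have hc : IsUnit c := IsUnit.of_mul_eq_one (k q') e1.symm
  have hq' : IsUnit q' := hk.isUnit _ (IsUnit.of_mul_eq_one c (by rw [mul_comm]; exact e1.symm))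
  have hq : IsUnit q := hh _ (isUnit_of_mul_isUnit_right (x := a) (by
    rw [e2, one_mul]; exact hq'.map h))
  exact isUnit_of_mul_isUnit_left (y := b) (by rw [e]; exact hc.mul (hq.map k))

end IsLoc

lemma Tensor.map_surjective {P Q R : Type u} [CommMonoid P] [CommMonoid Q] [CommMonoid R]
    {h : Q →* P} {M : Type u} [MulAction Q M] {j : P →* R} (hj : Function.Surjective j)
    {l : Q →* R} (hl : j.comp h = l) : Function.Surjective (Tensor.map (M := M) j hl) := by
  intro t
  induction t using Tensor.ind with
  | H r m =>
    obtain ⟨p, rfl⟩ := hj r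
    exact ⟨Tensor.mk h p m, rfl⟩

namespace LMS
open Modules
variable {X Y : LMS.{u}} {f : X ⟶ Y}

lemma isLoc_stalkHom (f : X ⟶ Y) (x : X) : IsLoc (stalkHom f x) := fun _ => isUnit_stalkHom f

lemma pointEval_stalkHom_comp {A : Type u} [CommMonoid A] {x : X} (a : X.str.stalk x →* A)
    (ha : IsLoc a) (p : X ⟶ Y) (s : Y.str.stalk (p.hom.base x)) :
    pointEval A (stalkHom (ofPoint a ha ≫ p) PUnit.unit s) = a (stalkHom p x s) :=
  (congrArg (pointEval A) (DFunLike.congr_fun (stalkHom_comp (ofPoint a ha) p PUnit.unit) s).symm).trans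
    (pointEval_stalkHom a ha _)

variable (f) in
/-- Two points of `X` with values in a monoid have the same image in `Y`. -/
structure SameImage {A : Type u} [CommMonoid A] {x₁ x₂ : X} (a₁ : X.str.stalk x₁ →* A)
    (a₂ : X.str.stalk x₂ →* A) : Prop where
  base : f.hom.base x₁ = f.hom.base x₂
  stalk : ∀ (V : Opens Y) (h₁ : f.hom.base x₁ ∈ V) (h₂ : f.hom.base x₂ ∈ V)
    (s : Y.str.obj (op V)), a₁ (stalkHom f x₁ (Y.germ _ h₁ s)) = a₂ (stalkHom f x₂ (Y.germ _ h₂ s))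

namespace SameImage
variable {A A' : Type u} [CommMonoid A] [CommMonoid A'] {x₁ x₂ x₃ : X} {a₁ : X.str.stalk x₁ →* A}
    {a₂ : X.str.stalk x₂ →* A} {a₃ : X.str.stalk x₃ →* A}

lemma refl (a₁ : X.str.stalk x₁ →* A) : SameImage f a₁ a₁ := ⟨rfl, fun _ _ _ _ => rfl⟩

lemma symm (w : SameImage f a₁ a₂) : SameImage f a₂ a₁ :=
  ⟨w.base.symm, fun V h₁ h₂ s => (w.stalk V h₂ h₁ s).symm⟩

lemma trans (w : SameImage f a₁ a₂) (w' : SameImage f a₂ a₃) : SameImage f a₁ a₃ :=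
  ⟨w.base.trans w'.base, fun V h₁ h₂ s =>
    (w.stalk V h₁ (w.base ▸ h₁) s).trans (w'.stalk V _ h₂ s)⟩

lemma map (w : SameImage f a₁ a₂) (j : A →* A') {b₁ : X.str.stalk x₁ →* A'}
    {b₂ : X.str.stalk x₂ →* A'} (e₁ : j.comp a₁ = b₁) (e₂ : j.comp a₂ = b₂) : SameImage f b₁ b₂ := by
  subst e₁ e₂
  exact ⟨w.base, fun V h₁ h₂ s => congrArg j (w.stalk V h₁ h₂ s)⟩

lemma ofPoint_comp (w : SameImage f a₁ a₂) (h₁ : IsLoc a₁) (h₂ : IsLoc a₂) :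
    ofPoint a₁ h₁ ≫ f = ofPoint a₂ h₂ ≫ f := by
  refine point_hom_ext w.base fun V hp hq s => ?_
  refine (pointEval_stalkHom_comp a₁ h₁ f _).trans (Eq.trans ?_
    (pointEval_stalkHom_comp a₂ h₂ f _).symm)
  exact w.stalk V hp hq s

end SameImage

lemma pointEval_comp_bijective (A : Type u) [CommMonoid A] :
    IsEqFaithfullyFlat (pointEval A) := .of_bijective (pointEval_bijective A)

namespace ModDescent
variable (D : ModDescent f)

/-- The isomorphism of a descent datum on a space. -/
def glue {T : LMS.{u}} (p₁ p₂ : T ⟶ X) (w : p₁ ≫ f = p₂ ≫ f) (t : T) :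
    PullbackStalk p₁ D.sheaf t → PullbackStalk p₂ D.sheaf t :=
  fib (D.glueHom p₁ p₂ w) t

lemma glue_self {T : LMS.{u}} (p : T ⟶ X) (t : T) (z : PullbackStalk p D.sheaf t) :
    D.glue p p rfl t z = z := by
  rw [glue, glueHom_self, fib_id]

lemma glue_glue {T : LMS.{u}} {p₁ p₂ p₃ : T ⟶ X} (w : p₁ ≫ f = p₂ ≫ f) (w' : p₂ ≫ f = p₃ ≫ f)
    (t : T) (z : PullbackStalk p₁ D.sheaf t) :
    D.glue p₂ p₃ w' t (D.glue p₁ p₂ w t z) = D.glue p₁ p₃ (w.trans w') t z := by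
  rw [glue, glue, ← fib_comp, glueHom_comp]; rfl

section GlueAt
variable {A A' : Type u} [CommMonoid A] [CommMonoid A'] {x₁ x₂ x₃ : X} {a₁ : X.str.stalk x₁ →* A}
    {a₂ : X.str.stalk x₂ →* A} {a₃ : X.str.stalk x₃ →* A} (h₁ : IsLoc a₁) (h₂ : IsLoc a₂)
    (h₃ : IsLoc a₃) (w : SameImage f a₁ a₂) (w' : SameImage f a₂ a₃)

/-- The fibre of a pullback to a one-point space. -/
def pointFib (N : X.Modules) (h₁ : IsLoc a₁) :
    PullbackStalk (ofPoint a₁ h₁) N PUnit.unit → Tensor a₁ (N.stalk x₁) :=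
  Tensor.map (h := stalkHom (ofPoint a₁ h₁) PUnit.unit)
    (M := N.stalk ((ofPoint a₁ h₁).hom.base PUnit.unit)) (pointEval A)
    (pointEval_comp_stalkHom a₁ h₁)

lemma pointFib_bijective (N : X.Modules) : Function.Bijective (pointFib N h₁) :=
  ⟨Tensor.map_injective (h := stalkHom (ofPoint a₁ h₁) PUnit.unit)
    (M := N.stalk ((ofPoint a₁ h₁).hom.base PUnit.unit)) (pointEval_comp_bijective A)
      (pointEval_comp_stalkHom a₁ h₁),
    Tensor.map_surjective (h := stalkHom (ofPoint a₁ h₁) PUnit.unit)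
    (M := N.stalk ((ofPoint a₁ h₁).hom.base PUnit.unit)) (pointEval_bijective A).2
      (pointEval_comp_stalkHom a₁ h₁)⟩

lemma pointFib_smul (N : X.Modules) (b) (z : PullbackStalk (ofPoint a₁ h₁) N PUnit.unit) :
    pointFib N h₁ (b • z) = pointEval A b • pointFib N h₁ z :=
  Tensor.map_smul (h := stalkHom (ofPoint a₁ h₁) PUnit.unit)
    (M := N.stalk ((ofPoint a₁ h₁).hom.base PUnit.unit)) (pointEval A)
    (pointEval_comp_stalkHom a₁ h₁) b z

/-- The isomorphism of a descent datum at a pair of points with values in a monoid. -/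
def glueAt (z : Tensor a₁ (D.sheaf.stalk x₁)) : Tensor a₂ (D.sheaf.stalk x₂) :=
  pointFib D.sheaf h₂ (D.glue (ofPoint a₁ h₁) (ofPoint a₂ h₂) (w.ofPoint_comp h₁ h₂) PUnit.unit
    (Function.surjInv (pointFib_bijective h₁ D.sheaf).2 z))

lemma glueAt_pointFib (z : PullbackStalk (ofPoint a₁ h₁) D.sheaf PUnit.unit) :
    D.glueAt h₁ h₂ w (pointFib D.sheaf h₁ z) = pointFib D.sheaf h₂
      (D.glue (ofPoint a₁ h₁) (ofPoint a₂ h₂) (w.ofPoint_comp h₁ h₂) PUnit.unit z) := by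
  rw [glueAt, Function.leftInverse_surjInv (pointFib_bijective h₁ D.sheaf)]

lemma glueAt_smul (b : A) (z : Tensor a₁ (D.sheaf.stalk x₁)) :
    D.glueAt h₁ h₂ w (b • z) = b • D.glueAt h₁ h₂ w z := by
  obtain ⟨z, rfl⟩ := (pointFib_bijective h₁ D.sheaf).2 z
  obtain ⟨b, rfl⟩ := (pointEval_bijective A).2 b
  rw [← pointFib_smul, glueAt_pointFib, glueAt_pointFib, ← pointFib_smul]
  exact congrArg _ (fib_smul _ _ _ _)

lemma glueAt_self (z : Tensor a₁ (D.sheaf.stalk x₁)) :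
    D.glueAt h₁ h₁ (.refl a₁) z = z := by
  obtain ⟨z, rfl⟩ := (pointFib_bijective h₁ D.sheaf).2 z
  refine (D.glueAt_pointFib h₁ h₁ _ z).trans (congrArg _ ?_)
  exact D.glue_self (ofPoint a₁ h₁) PUnit.unit z

lemma glueAt_glueAt (z : Tensor a₁ (D.sheaf.stalk x₁)) :
    D.glueAt h₂ h₃ w' (D.glueAt h₁ h₂ w z) = D.glueAt h₁ h₃ (w.trans w') z := by
  obtain ⟨z, rfl⟩ := (pointFib_bijective h₁ D.sheaf).2 z
  refine (congrArg _ (D.glueAt_pointFib h₁ h₂ w z)).trans ?_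
  refine (D.glueAt_pointFib h₂ h₃ w' _).trans
    (Eq.trans (congrArg _ ?_) (D.glueAt_pointFib h₁ h₃ (w.trans w') z).symm)
  exact D.glue_glue (w.ofPoint_comp h₁ h₂) (w'.ofPoint_comp h₂ h₃) PUnit.unit z

lemma glueAt_injective : Function.Injective (D.glueAt h₁ h₂ w) := fun z z' e => by
  have := congrArg (D.glueAt h₂ h₁ w.symm) e
  rwa [glueAt_glueAt, glueAt_glueAt, glueAt_self, glueAt_self] at this

lemma glueAt_surjective : Function.Surjective (D.glueAt h₁ h₂ w) := fun z =>
  ⟨D.glueAt h₂ h₁ w.symm z, by rw [glueAt_glueAt, glueAt_self]⟩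

end GlueAt

/-- The element `b ⊗ m_{p t}` of the fibre of a pullback. -/
def mkGerm {T : LMS.{u}} (p : T ⟶ X) (N : X.Modules) (t : T) (b : T.str.stalk t) {V : Opens X}
    (hV : p.hom.base t ∈ V) (m : N.presheaf.obj (op V)) : PullbackStalk p N t :=
  Tensor.mk (stalkHom p t) b (N.germ (p.hom.base t) hV m)

lemma exists_mkGerm {T : LMS.{u}} {p : T ⟶ X} {N : X.Modules} {t : T} (z : PullbackStalk p N t) :
    ∃ (b : T.str.stalk t) (V : Opens X) (hV : p.hom.base t ∈ V) (m : N.presheaf.obj (op V)),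
      z = mkGerm p N t b hV m := by
  induction z using Tensor.ind with
  | H b n =>
    obtain ⟨V, hV, m, rfl⟩ := N.exists_germ _ n
    exact ⟨b, V, hV, m, rfl⟩

/-- Fibres along equal morphisms have types that are equal only propositionally. Germs of named
sections exist in both, so the equation passes over without transport. -/
lemma glue_congr {T : LMS.{u}} {p₁ p₂ q₁ q₂ : T ⟶ X} (w : p₁ ≫ f = p₂ ≫ f) (e₁ : p₁ = q₁)
    (e₂ : p₂ = q₂) (w' : q₁ ≫ f = q₂ ≫ f) (t : T) {V W : Opens X} (hp : p₁.hom.base t ∈ V)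
    (hp' : p₂.hom.base t ∈ W) (hq : q₁.hom.base t ∈ V) (hq' : q₂.hom.base t ∈ W) (m m')
    (b b' : T.str.stalk t)
    (h : D.glue p₁ p₂ w t (mkGerm p₁ D.sheaf t b hp m) = mkGerm p₂ D.sheaf t b' hp' m') :
    D.glue q₁ q₂ w' t (mkGerm q₁ D.sheaf t b hq m) = mkGerm q₂ D.sheaf t b' hq' m' := by
  subst e₁ e₂
  exact h

lemma glue_fibPull {T T' : LMS.{u}} (g : T' ⟶ T) (p₁ p₂ : T ⟶ X) (w : p₁ ≫ f = p₂ ≫ f)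
    (w' : (g ≫ p₁) ≫ f = (g ≫ p₂) ≫ f) (t : T') (z : PullbackStalk p₁ D.sheaf (g.hom.base t)) :
    D.glue (g ≫ p₁) (g ≫ p₂) w' t (fibPull g p₁ D.sheaf t z) =
      fibPull g p₂ D.sheaf t (D.glue p₁ p₂ w _ z) := by
  rw [glue, ← glueHom_pull]
  exact fib_pull g (D.glueHom p₁ p₂ w) t z

/-- The isomorphisms at pairs of points are induced by the isomorphisms on any space. -/
lemma glueAt_map {T : LMS.{u}} (p₁ p₂ : T ⟶ X) (w : p₁ ≫ f = p₂ ≫ f) (t : T) {A : Type u}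
    [CommMonoid A] (j : T.str.stalk t →* A) (hj : IsLoc j) {a₁ : X.str.stalk (p₁.hom.base t) →* A}
    {a₂ : X.str.stalk (p₂.hom.base t) →* A} (h₁ : IsLoc a₁) (h₂ : IsLoc a₂)
    (w' : SameImage f a₁ a₂) (e₁ : j.comp (stalkHom p₁ t) = a₁) (e₂ : j.comp (stalkHom p₂ t) = a₂)
    (z : PullbackStalk p₁ D.sheaf t) :
    D.glueAt h₁ h₂ w' (Tensor.map j e₁ z) = Tensor.map j e₂ (D.glue p₁ p₂ w t z) := by
  obtain ⟨b, V, hV, m, rfl⟩ := exists_mkGerm z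
  obtain ⟨b', W, hW, m', hn⟩ := exists_mkGerm (D.glue p₁ p₂ w t (mkGerm p₁ D.sheaf t b hV m))
  let g : point A ⟶ T := ofPoint j hj
  -- The A-valued point j of T followed by p is the point of X given by the composite on stalks. So
  -- base change of the datum along g computes `glueAt`.
  have eq : ∀ {p : T ⟶ X} {a : X.str.stalk (p.hom.base t) →* A} (h : IsLoc a)
      (_ : j.comp (stalkHom p t) = a), g ≫ p = ofPoint a h := by
    rintro p _ h rfl
    refine point_hom_ext rfl fun V hp hq s => ?_
    exact (pointEval_stalkHom_comp j hj p _).trans (pointEval_stalkHom _ h _).symm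
  have h3 : D.glue (g ≫ p₁) (g ≫ p₂) (by simp [w]) PUnit.unit
      (mkGerm (g ≫ p₁) D.sheaf PUnit.unit (stalkHom g PUnit.unit b) hV m) =
        mkGerm (g ≫ p₂) D.sheaf PUnit.unit (stalkHom g PUnit.unit b') hW m' :=
    (D.glue_fibPull g p₁ p₂ w _ PUnit.unit (mkGerm p₁ D.sheaf t b hV m)).trans
      (congrArg (fibPull g p₂ D.sheaf PUnit.unit) hn)
  have h6 := D.glue_congr _ (eq h₁ e₁) (eq h₂ e₂) (w'.ofPoint_comp h₁ h₂) PUnit.unit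
    hV hW hV hW m m' _ _ h3
  rw [hn]
  have h7 := (D.glueAt_pointFib h₁ h₂ w' _).trans (congrArg (pointFib D.sheaf h₂) h6)
  have h8 : Tensor.mk a₁ (pointEval A (stalkHom g PUnit.unit b)) (D.sheaf.germ _ hV m) =
      Tensor.map j e₁ (mkGerm p₁ D.sheaf t b hV m) :=
    congrArg (fun b => Tensor.mk a₁ b (D.sheaf.germ _ hV m)) (pointEval_stalkHom j hj b)
  refine (congrArg (D.glueAt h₁ h₂ w') h8.symm).trans (h7.trans ?_)
  exact congrArg (fun b => Tensor.mk a₂ b (D.sheaf.germ _ hW m')) (pointEval_stalkHom j hj b')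

end ModDescent
end LMS
end MonoidFan

/-! ### Compatibility with generization, and matching elements -/

namespace MonoidFan

namespace LMS
open Modules
variable {X Y : LMS.{u}} {f : X ⟶ Y}

variable (f) in
/-- The map `M_{Y, y} → M_{X, x}` for a point `x` over `y`. -/
def stalkHomAt {x : X} {y : Y} (h : f.hom.base x = y) : Y.str.stalk y →* X.str.stalk x :=
  match y, h with
  | _, rfl => stalkHom f x

lemma stalkHomAt_germ {x : X} {y : Y} (h : f.hom.base x = y) {V : Opens Y} (hV : y ∈ V)
    (s : Y.str.obj (op V)) :
    stalkHomAt f h (Y.germ y hV s) = stalkHom f x (Y.germ _ (h ▸ hV) s) := by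
  subst h
  rfl

lemma stalkHomAt_sp {x x' : X} {y y' : Y} (h : f.hom.base x = y) (h' : f.hom.base x' = y')
    (s : x' ⤳ x) (s' : y' ⤳ y) :
    (stalkHomAt f h').comp (Y.sp s') = (X.sp s).comp (stalkHomAt f h) := by
  subst h h'
  exact MonoidHom.ext fun a => stalkHom_sp f s a

lemma isEqFaithfullyFlat_stalkHomAt (hf : ∀ x, IsEqFaithfullyFlat (stalkHom f x)) {x : X} {y : Y}
    (h : f.hom.base x = y) : IsEqFaithfullyFlat (stalkHomAt f h) := by
  subst h
  exact hf x

lemma isLoc_stalkHomAt {x : X} {y : Y} (h : f.hom.base x = y) : IsLoc (stalkHomAt f h) := by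
  subst h
  exact isLoc_stalkHom f x

/-- This turns the condition on germs into an equality of maps out of M_{Y,y}, as the universal
property of the pushout requires. -/
lemma sameImage_iff {A : Type u} [CommMonoid A] {x₁ x₂ : X} {a₁ : X.str.stalk x₁ →* A}
    {a₂ : X.str.stalk x₂ →* A} {y : Y} (h₁ : f.hom.base x₁ = y) (h₂ : f.hom.base x₂ = y) :
    SameImage f a₁ a₂ ↔ a₁.comp (stalkHomAt f h₁) = a₂.comp (stalkHomAt f h₂) := by
  constructor
  · intro w
    ext a
    obtain ⟨V, hV, s, rfl⟩ := Y.exists_germ y a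
    rw [MonoidHom.comp_apply, MonoidHom.comp_apply, stalkHomAt_germ, stalkHomAt_germ]
    exact w.stalk V _ _ s
  · refine fun e => ⟨h₁.trans h₂.symm, fun V hV hV' s => ?_⟩
    have := DFunLike.congr_fun e (Y.germ y (h₁ ▸ hV) s)
    rwa [MonoidHom.comp_apply, MonoidHom.comp_apply, stalkHomAt_germ, stalkHomAt_germ] at this

namespace ModDescent
variable (D : ModDescent f)

lemma glueAt_comp {A A' : Type u} [CommMonoid A] [CommMonoid A'] {x₁ x₂ : X}
    {a₁ : X.str.stalk x₁ →* A} {a₂ : X.str.stalk x₂ →* A} (h₁ : IsLoc a₁) (h₂ : IsLoc a₂)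
    (w : SameImage f a₁ a₂) {j : A →* A'} (hj : IsLoc j) {b₁ : X.str.stalk x₁ →* A'}
    {b₂ : X.str.stalk x₂ →* A'} (g₁ : IsLoc b₁) (g₂ : IsLoc b₂) (w' : SameImage f b₁ b₂)
    (e₁ : j.comp a₁ = b₁) (e₂ : j.comp a₂ = b₂) (z : Tensor a₁ (D.sheaf.stalk x₁)) :
    D.glueAt g₁ g₂ w' (Tensor.map j e₁ z) = Tensor.map j e₂ (D.glueAt h₁ h₂ w z) := by
  obtain ⟨z, rfl⟩ := (pointFib_bijective h₁ D.sheaf).2 z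
  rw [glueAt_pointFib]
  have e : ∀ {x : X} {a : X.str.stalk x →* A} {b : X.str.stalk x →* A'} (h : IsLoc a)
      (e : j.comp a = b), (j.comp (pointEval A)).comp (stalkHom (ofPoint a h) PUnit.unit) = b := by
    rintro x a _ h rfl
    rw [MonoidHom.comp_assoc]
    exact congrArg _ (pointEval_comp_stalkHom a h)
  have key : ∀ {x : X} {a : X.str.stalk x →* A} {b : X.str.stalk x →* A'} (h : IsLoc a)
      (e' : j.comp a = b) (z : PullbackStalk (ofPoint a h) D.sheaf PUnit.unit),
      Tensor.map j e' (pointFib D.sheaf h z) = Tensor.map (h := stalkHom (ofPoint a h) PUnit.unit)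
        (M := D.sheaf.stalk ((ofPoint a h).hom.base PUnit.unit)) (j.comp (pointEval A))
          (e h e') z := by
    intro x a b h e' z
    induction z using Tensor.ind with
    | H p m => rfl
  rw [key, key]
  exact D.glueAt_map (ofPoint a₁ h₁) (ofPoint a₂ h₂) _ PUnit.unit (j.comp (pointEval A))
    (hj.comp (.of_bijective (pointEval_bijective A))) g₁ g₂ w' (e h₁ e₁) (e h₂ e₂) z

section Sp
variable {A A' : Type u} [CommMonoid A] [CommMonoid A'] {x₁ x₂ x₁' x₂' : X}
    {a₁ : X.str.stalk x₁ →* A} {a₂ : X.str.stalk x₂ →* A} (h₁ : IsLoc a₁) (h₂ : IsLoc a₂)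
    (w : SameImage f a₁ a₂) (s₁ : x₁' ⤳ x₁) (s₂ : x₂' ⤳ x₂)
    {b₁ : X.str.stalk x₁' →* A'} {b₂ : X.str.stalk x₂' →* A'} (g₁ : IsLoc b₁) (g₂ : IsLoc b₂)
    (w' : SameImage f b₁ b₂) {ρ : A →* A'}
    (e₁ : ρ.comp a₁ = b₁.comp (X.sp s₁)) (e₂ : ρ.comp a₂ = b₂.comp (X.sp s₂))

include w w' in
lemma ofSierpinski_comp : ofSierpinski s₁ a₁ h₁ b₁ g₁ e₁ ≫ f = ofSierpinski s₂ a₂ h₂ b₂ g₂ e₂ ≫ f := by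
  refine hom_ext_of_germ (fun t => ?_) (fun t V hp hq s => ?_)
  · cases t with
    | closed => exact w.base
    | generic => exact w'.base
  · cases t with
    | closed =>
      refine (sierpinskiEvalClosed_bijective (ρ := ρ)).1 ?_
      have key : ∀ {x x' : X} (s : x' ⤳ x) {a : X.str.stalk x →* A} (h : IsLoc a)
          {b : X.str.stalk x' →* A'} (g : IsLoc b) (e : ρ.comp a = b.comp (X.sp s)) (c),
          sierpinskiEvalClosed ρ (stalkHom (ofSierpinski s a h b g e ≫ f) Sierpinski.closed c) =
            a (stalkHom f x c) := fun s a h b g e c =>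
        (congrArg (sierpinskiEvalClosed ρ) (DFunLike.congr_fun
          (stalkHom_comp (ofSierpinski s a h b g e) f Sierpinski.closed) c).symm).trans
          (DFunLike.congr_fun (sierpinskiEvalClosed_comp_stalkHom s a h b g e) _)
      exact (key _ _ _ _ _).trans ((w.stalk V hp hq s).trans (key _ _ _ _ _).symm)
    | generic =>
      refine (sierpinskiEvalGeneric_bijective (ρ := ρ)).1 ?_
      have key : ∀ {x x' : X} (s : x' ⤳ x) {a : X.str.stalk x →* A} (h : IsLoc a)
          {b : X.str.stalk x' →* A'} (g : IsLoc b) (e : ρ.comp a = b.comp (X.sp s)) (c),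
          sierpinskiEvalGeneric ρ (stalkHom (ofSierpinski s a h b g e ≫ f) Sierpinski.generic c) =
            b (stalkHom f x' c) := fun s a h b g e c =>
        (congrArg (sierpinskiEvalGeneric ρ) (DFunLike.congr_fun
          (stalkHom_comp (ofSierpinski s a h b g e) f Sierpinski.generic) c).symm).trans
          (DFunLike.congr_fun (sierpinskiEvalGeneric_comp_stalkHom s a h b g e) _)
      exact (key _ _ _ _ _).trans ((w'.stalk V hp hq s).trans (key _ _ _ _ _).symm)

-- The data at (x₁, x₂) and at (x₁', x₂') are the two fibres of one isomorphism over the Sierpiński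
-- space of ρ, and that isomorphism commutes with passage from the closed to the generic point.
include e₁ e₂ in
lemma glueAt_sp {n₁ : D.sheaf.stalk x₁} {n₂ : D.sheaf.stalk x₂}
    (e : D.glueAt h₁ h₂ w (Tensor.mk a₁ 1 n₁) = Tensor.mk a₂ 1 n₂) :
    D.glueAt g₁ g₂ w' (Tensor.mk b₁ 1 (D.sheaf.sp s₁ n₁)) = Tensor.mk b₂ 1 (D.sheaf.sp s₂ n₂) := by
  let p₁ := ofSierpinski s₁ a₁ h₁ b₁ g₁ e₁
  let p₂ := ofSierpinski s₂ a₂ h₂ b₂ g₂ e₂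
  have W : p₁ ≫ f = p₂ ≫ f := ofSierpinski_comp h₁ h₂ w s₁ s₂ g₁ g₂ w' e₁ e₂
  have c₁ : (sierpinskiEvalClosed ρ).comp (stalkHom p₁ Sierpinski.closed) = a₁ :=
    sierpinskiEvalClosed_comp_stalkHom s₁ a₁ h₁ b₁ g₁ e₁
  have c₂ : (sierpinskiEvalClosed ρ).comp (stalkHom p₂ Sierpinski.closed) = a₂ :=
    sierpinskiEvalClosed_comp_stalkHom s₂ a₂ h₂ b₂ g₂ e₂
  have d₁ : (sierpinskiEvalGeneric ρ).comp (stalkHom p₁ Sierpinski.generic) = b₁ :=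
    sierpinskiEvalGeneric_comp_stalkHom s₁ a₁ h₁ b₁ g₁ e₁
  have d₂ : (sierpinskiEvalGeneric ρ).comp (stalkHom p₂ Sierpinski.generic) = b₂ :=
    sierpinskiEvalGeneric_comp_stalkHom s₂ a₂ h₂ b₂ g₂ e₂
  let z₁ : PullbackStalk p₁ D.sheaf Sierpinski.closed := Tensor.mk _ 1 n₁
  let z₂ : PullbackStalk p₂ D.sheaf Sierpinski.closed := Tensor.mk _ 1 n₂
  have i₁ : Tensor.map (h := stalkHom p₁ Sierpinski.closed)
      (M := D.sheaf.stalk (p₁.hom.base Sierpinski.closed)) (sierpinskiEvalClosed ρ) c₁ z₁ =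
        Tensor.mk a₁ 1 n₁ := congrArg (fun b => Tensor.mk a₁ b n₁) (map_one _)
  have i₂ : Tensor.map (h := stalkHom p₂ Sierpinski.closed)
      (M := D.sheaf.stalk (p₂.hom.base Sierpinski.closed)) (sierpinskiEvalClosed ρ) c₂ z₂ =
        Tensor.mk a₂ 1 n₂ := congrArg (fun b => Tensor.mk a₂ b n₂) (map_one _)
  have hz : D.glue p₁ p₂ W Sierpinski.closed z₁ = z₂ := by
    refine Tensor.map_injective (h := stalkHom p₂ Sierpinski.closed)
      (M := D.sheaf.stalk (p₂.hom.base Sierpinski.closed))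
      (.of_bijective sierpinskiEvalClosed_bijective) c₂ ?_
    refine (D.glueAt_map p₁ p₂ W Sierpinski.closed (sierpinskiEvalClosed ρ)
      (.of_bijective sierpinskiEvalClosed_bijective) h₁ h₂ w c₁ c₂ z₁).symm.trans ?_
    exact (congrArg (D.glueAt h₁ h₂ w) i₁).trans (e.trans i₂.symm)
  have hz' := (fib_fibSp (D.glueHom p₁ p₂ W) Sierpinski.specializes z₁).trans
    (congrArg (fibSp p₂ D.sheaf Sierpinski.specializes) hz)
  have H := D.glueAt_map p₁ p₂ W Sierpinski.generic (sierpinskiEvalGeneric ρ)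
      (.of_bijective sierpinskiEvalGeneric_bijective) g₁ g₂ w' d₁ d₂
      (fibSp p₁ D.sheaf Sierpinski.specializes z₁)
  have j₁ : Tensor.map (h := stalkHom p₁ Sierpinski.generic)
      (M := D.sheaf.stalk (p₁.hom.base Sierpinski.generic)) (sierpinskiEvalGeneric ρ) d₁
        (fibSp p₁ D.sheaf Sierpinski.specializes z₁) = Tensor.mk b₁ 1 (D.sheaf.sp s₁ n₁) :=
    congrArg (fun b => Tensor.mk b₁ b (D.sheaf.sp s₁ n₁))
      ((congrArg (sierpinskiEvalGeneric ρ) (map_one _)).trans (map_one _))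
  have j₂ : Tensor.map (h := stalkHom p₂ Sierpinski.generic)
      (M := D.sheaf.stalk (p₂.hom.base Sierpinski.generic)) (sierpinskiEvalGeneric ρ) d₂
        (fibSp p₂ D.sheaf Sierpinski.specializes z₂) = Tensor.mk b₂ 1 (D.sheaf.sp s₂ n₂) :=
    congrArg (fun b => Tensor.mk b₂ b (D.sheaf.sp s₂ n₂))
      ((congrArg (sierpinskiEvalGeneric ρ) (map_one _)).trans (map_one _))
  refine (congrArg (D.glueAt g₁ g₂ w') j₁.symm).trans (H.trans (Eq.trans ?_ j₂))
  exact congrArg _ hz'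

end Sp

/-- Elements of the stalks at `x₁` and `x₂` that are identified by the descent datum. -/
def Matches {x₁ x₂ : X} (n₁ : D.sheaf.stalk x₁) (n₂ : D.sheaf.stalk x₂) : Prop :=
  ∀ (A : Type u) [CommMonoid A] (a₁ : X.str.stalk x₁ →* A) (a₂ : X.str.stalk x₂ →* A)
    (h₁ : IsLoc a₁) (h₂ : IsLoc a₂) (w : SameImage f a₁ a₂),
      D.glueAt h₁ h₂ w (Tensor.mk a₁ 1 n₁) = Tensor.mk a₂ 1 n₂

namespace Matches
variable {D} {x₁ x₂ x₃ : X} {n₁ : D.sheaf.stalk x₁} {n₂ : D.sheaf.stalk x₂} {n₃ : D.sheaf.stalk x₃}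

lemma symm (H : D.Matches n₁ n₂) : D.Matches n₂ n₁ := fun A _ a₂ a₁ h₂ h₁ w => by
  rw [← H A a₁ a₂ h₁ h₂ w.symm, glueAt_glueAt, glueAt_self]

/-- Each pair of local maps with the same image factors through M_{X,x₁} ⊕_{M_{Y,y}} M_{X,x₂} by a
local map, so the universal pair decides. -/
lemma of_pushout {y : Y} (h₁ : f.hom.base x₁ = y) (h₂ : f.hom.base x₂ = y)
    (g₁ : IsLoc (Pushout.inl (stalkHomAt f h₁) (stalkHomAt f h₂)))
    (g₂ : IsLoc (Pushout.inr (stalkHomAt f h₁) (stalkHomAt f h₂)))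
    (w : SameImage f (Pushout.inl (stalkHomAt f h₁) (stalkHomAt f h₂))
      (Pushout.inr (stalkHomAt f h₁) (stalkHomAt f h₂)))
    (e : D.glueAt g₁ g₂ w (Tensor.mk _ 1 n₁) = Tensor.mk _ 1 n₂) : D.Matches n₁ n₂ := by
  intro A _ a₁ a₂ l₁ l₂ w'
  have c := (sameImage_iff h₁ h₂).1 w'
  have := D.glueAt_comp g₁ g₂ w (.pushoutLift l₁ l₂ c) l₁ l₂ w' (Pushout.lift_comp_inl a₁ a₂ c)
    (Pushout.lift_comp_inr a₁ a₂ c) (Tensor.mk _ 1 n₁)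
  rw [e, Tensor.map_mk, Tensor.map_mk, map_one] at this
  exact this

variable (hf : ∀ x, IsEqFaithfullyFlat (stalkHom f x)) {y : Y}
include hf

/-- A-valued points at x₁ and x₃ come with none at x₂. One appears over A ⊕_{M_{Y,y}} M_{X,x₂},
which is faithfully flat over A, so the equation can be checked there. -/
lemma trans (h₁ : f.hom.base x₁ = y) (h₂ : f.hom.base x₂ = y) (H : D.Matches n₁ n₂)
    (H' : D.Matches n₂ n₃) : D.Matches n₁ n₃ := by
  intro A _ a₁ a₃ l₁ l₃ w
  let h := a₁.comp (stalkHomAt f h₁)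
  let k := stalkHomAt f h₂
  have hk : IsEqFaithfullyFlat k := isEqFaithfullyFlat_stalkHomAt hf h₂
  have hinl : IsEqFaithfullyFlat (Pushout.inl h k) := Pushout.inl_faithfullyFlat hk
  have hinr : IsLoc (Pushout.inr h k) := .pushoutInr (l₁.comp (isLoc_stalkHomAt h₁)) hk
  have k₁ : IsLoc ((Pushout.inl h k).comp a₁) := IsLoc.comp hinl.isUnit l₁
  have k₃ : IsLoc ((Pushout.inl h k).comp a₃) := IsLoc.comp hinl.isUnit l₃
  have w₁ : SameImage f ((Pushout.inl h k).comp a₁) (Pushout.inr h k) :=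
    (sameImage_iff h₁ h₂).2 (Pushout.condition h k)
  have w₃ : SameImage f ((Pushout.inl h k).comp a₁) ((Pushout.inl h k).comp a₃) :=
    w.map (Pushout.inl h k) rfl rfl
  refine Tensor.map_injective hinl rfl ?_
  rw [← D.glueAt_comp l₁ l₃ w hinl.isUnit k₁ k₃ w₃ rfl rfl, Tensor.map_mk, Tensor.map_mk, map_one]
  rw [← D.glueAt_glueAt k₁ hinr k₃ w₁ (w₁.symm.trans w₃), H _ _ _ _ _ _]
  exact H' _ _ _ _ _ _

/-- Over the universal pushout the gluing map is injective, and N_{x₁} embeds into its extension of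
scalars by faithful flatness. -/
lemma eq_of_matches {n₁' : D.sheaf.stalk x₁} (h : f.hom.base x₁ = f.hom.base x₂) (H : D.Matches n₁ n₂) (H' : D.Matches n₁' n₂) : n₁ = n₁' := by
  have hk := isEqFaithfullyFlat_stalkHomAt hf (f := f) (rfl : f.hom.base x₂ = _)
  have hh := isEqFaithfullyFlat_stalkHomAt hf h
  have hinl := Pushout.inl_faithfullyFlat (h := stalkHomAt f h) hk
  have hinr := Pushout.inr_faithfullyFlat (k := stalkHomAt f (rfl : f.hom.base x₂ = _)) hh
  have w := (sameImage_iff h rfl).2 (Pushout.condition (stalkHomAt f h) (stalkHomAt f (rfl : f.hom.base x₂ = _)))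
  refine Tensor.mk_one_injective hinl ?_
  refine D.glueAt_injective hinl.isUnit hinr.isUnit w ?_
  exact (H _ _ _ hinl.isUnit hinr.isUnit w).trans (H' _ _ _ hinl.isUnit hinr.isUnit w).symm

/-- Over the universal pushout let t be the preimage of 1 ⊗ n₂ under gluing, and i the map from
M_{X,x₁}. As n₂ matches itself, the two images of t over the pushout of i with itself agree, so t
comes from N_{x₁} by descent of elements. -/
lemma exists_matches (h : f.hom.base x₁ = f.hom.base x₂) (H : D.Matches n₂ n₂) :
    ∃ n₁ : D.sheaf.stalk x₁, D.Matches n₁ n₂ := by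
  have h₂ : f.hom.base x₂ = f.hom.base x₂ := rfl
  have hk := isEqFaithfullyFlat_stalkHomAt hf h₂
  have hh := isEqFaithfullyFlat_stalkHomAt hf h
  let i := Pushout.inl (stalkHomAt f h) (stalkHomAt f h₂)
  let j := Pushout.inr (stalkHomAt f h) (stalkHomAt f h₂)
  have hi : IsEqFaithfullyFlat i := Pushout.inl_faithfullyFlat hk
  have hj : IsEqFaithfullyFlat j := Pushout.inr_faithfullyFlat hh
  have w : SameImage f i j := (sameImage_iff h h₂).2 (Pushout.condition _ _)
  obtain ⟨t, ht⟩ := D.glueAt_surjective hi.isUnit hj.isUnit w (Tensor.mk j 1 n₂)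
  have hl : (two₁ i).comp i = (two₂ i).comp i := Pushout.condition i i
  have l₁ : IsLoc (two₁ i) := (Pushout.inl_faithfullyFlat hi).isUnit
  have l₂ : IsLoc (two₂ i) := (Pushout.inr_faithfullyFlat hi).isUnit
  have l : IsLoc ((two₁ i).comp i) := l₁.comp hi.isUnit
  have k₁ : IsLoc ((two₁ i).comp j) := l₁.comp hj.isUnit
  have k₂ : IsLoc ((two₂ i).comp j) := l₂.comp hj.isUnit
  have w₁ : SameImage f ((two₁ i).comp i) ((two₁ i).comp j) := w.map _ rfl rfl
  have w₂ : SameImage f ((two₁ i).comp i) ((two₂ i).comp j) := w.map _ hl.symm rfl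
  obtain ⟨m, rfl⟩ := hi.exists_eq_mk rfl hl.symm t (by
    refine D.glueAt_injective l k₂ w₂ ?_
    rw [D.glueAt_comp hi.isUnit hj.isUnit w l₂ l k₂ w₂ hl.symm rfl,
      ← D.glueAt_glueAt l k₁ k₂ w₁ (w₁.symm.trans w₂),
      D.glueAt_comp hi.isUnit hj.isUnit w l₁ l k₁ w₁ rfl rfl, ht, Tensor.map_mk, Tensor.map_mk,
      map_one, map_one]
    exact H _ _ _ _ _ _)
  exact ⟨m, of_pushout h h₂ hi.isUnit hj.isUnit w ht⟩

/-- The universal pushout at (x₁, x₂) maps to the one at (x₁', x₂'), and `glueAt_sp` is applied to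
this map. -/
lemma sp {x₁' x₂' : X} (H : D.Matches n₁ n₂) (h : f.hom.base x₁ = f.hom.base x₂)
    (s₁ : x₁' ⤳ x₁) (s₂ : x₂' ⤳ x₂) (h' : f.hom.base x₁' = f.hom.base x₂') :
    D.Matches (D.sheaf.sp s₁ n₁) (D.sheaf.sp s₂ n₂) := by
  have h₂ : f.hom.base x₂ = f.hom.base x₂ := rfl
  have h₂' : f.hom.base x₂' = f.hom.base x₂' := rfl
  let i := Pushout.inl (stalkHomAt f h) (stalkHomAt f h₂)
  let j := Pushout.inr (stalkHomAt f h) (stalkHomAt f h₂)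
  let i' := Pushout.inl (stalkHomAt f h') (stalkHomAt f h₂')
  let j' := Pushout.inr (stalkHomAt f h') (stalkHomAt f h₂')
  have hi : IsLoc i := (Pushout.inl_faithfullyFlat (isEqFaithfullyFlat_stalkHomAt hf h₂)).isUnit
  have hj : IsLoc j := (Pushout.inr_faithfullyFlat (isEqFaithfullyFlat_stalkHomAt hf h)).isUnit
  have hi' : IsLoc i' := (Pushout.inl_faithfullyFlat (isEqFaithfullyFlat_stalkHomAt hf h₂')).isUnit
  have hj' : IsLoc j' := (Pushout.inr_faithfullyFlat (isEqFaithfullyFlat_stalkHomAt hf h')).isUnit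
  have w : SameImage f i j := (sameImage_iff h h₂).2 (Pushout.condition _ _)
  have w' : SameImage f i' j' := (sameImage_iff h' h₂').2 (Pushout.condition _ _)
  have c : (i'.comp (X.sp s₁)).comp (stalkHomAt f h) = (j'.comp (X.sp s₂)).comp (stalkHomAt f h₂) := by
    have s := map_specializes f s₂
    rw [MonoidHom.comp_assoc, MonoidHom.comp_assoc, ← stalkHomAt_sp h h' s₁ s,
      ← stalkHomAt_sp h₂ h₂' s₂ s, ← MonoidHom.comp_assoc, ← MonoidHom.comp_assoc]
    exact congrArg (fun g : _ →* Pushout (stalkHomAt f h') (stalkHomAt f h₂') => g.comp (Y.sp s))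
      (Pushout.condition (stalkHomAt f h') (stalkHomAt f h₂'))
  refine of_pushout h' h₂' hi' hj' w' ?_
  exact D.glueAt_sp hi hj w s₁ s₂ hi' hj' w' (Pushout.lift_comp_inl (i'.comp (X.sp s₁)) (j'.comp (X.sp s₂)) c)
    (Pushout.lift_comp_inr (i'.comp (X.sp s₁)) (j'.comp (X.sp s₂)) c) (H _ i j hi hj w)

end Matches

end ModDescent
end LMS
end MonoidFan

/-! ### The descended module -/

namespace MonoidFan

namespace LMS
open Modules
variable {X Y : LMS.{u}} {f : X ⟶ Y}

variable (f) in
/-- The conditions on `f` that are used for descent along `f`. -/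
structure IsDescentMap : Prop where
  surjective : Function.Surjective f.hom.base
  flat : ∀ x, IsEqFaithfullyFlat (stalkHom f x)
  exists_specializes : ∀ (x : X) (y' : Y), y' ⤳ f.hom.base x → ∃ x', x' ⤳ x ∧ f.hom.base x' = y'
  isOpen_source : ∀ x : X, IsOpen {x' | x' ⤳ x}
  isOpen_target : ∀ y : Y, IsOpen {y' | y' ⤳ y}

namespace ModDescent
variable (D : ModDescent f)

section Fibre
variable (hf : ∀ x, IsEqFaithfullyFlat (stalkHom f x)) (x : X)

lemma sameImage_of_comp_eq {A : Type u} [CommMonoid A] {x : X} {a₁ a₂ : X.str.stalk x →* A}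
    (e : a₁.comp (stalkHom f x) = a₂.comp (stalkHom f x)) : SameImage f a₁ a₂ :=
  ⟨rfl, fun _ h _ s => DFunLike.congr_fun e (Y.germ _ h s)⟩

/-- The isomorphisms of a descent datum at pairs of points, as morphisms of modules. -/
def glueAtHom {A : Type u} [CommMonoid A] {x : X} {a₁ a₂ : X.str.stalk x →* A} (h₁ : IsLoc a₁)
    (h₂ : IsLoc a₂) (w : SameImage f a₁ a₂) :
    (PMod.extend a₁).obj ⟨D.sheaf.stalk x⟩ ⟶ (PMod.extend a₂).obj ⟨D.sheaf.stalk x⟩ :=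
  PMod.homMk (M := (PMod.extend a₁).obj ⟨D.sheaf.stalk x⟩)
    (N := (PMod.extend a₂).obj ⟨D.sheaf.stalk x⟩) (D.glueAt h₁ h₂ w) (D.glueAt_smul h₁ h₂ w)

lemma glueAtHom_comp {A : Type u} [CommMonoid A] {x : X} {a₁ a₂ a₃ : X.str.stalk x →* A}
    (h₁ : IsLoc a₁) (h₂ : IsLoc a₂) (h₃ : IsLoc a₃) (w : SameImage f a₁ a₂)
    (w' : SameImage f a₂ a₃) :
    D.glueAtHom h₁ h₂ w ≫ D.glueAtHom h₂ h₃ w' = D.glueAtHom h₁ h₃ (w.trans w') :=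
  PMod.hom_ext fun z => D.glueAt_glueAt h₁ h₂ h₃ w w' z

lemma glueAtHom_self {A : Type u} [CommMonoid A] {x : X} {a : X.str.stalk x →* A}
    (h : IsLoc a) (w : SameImage f a a) : D.glueAtHom h h w = 𝟙 _ :=
  PMod.hom_ext fun z => D.glueAt_self h z

lemma pullHom_glueAtHom {A A' : Type u} [CommMonoid A] [CommMonoid A'] {x : X}
    {a₁ a₂ : X.str.stalk x →* A} (h₁ : IsLoc a₁) (h₂ : IsLoc a₂) (w : SameImage f a₁ a₂)
    {j : A →* A'} (hj : IsLoc j) {b₁ b₂ : X.str.stalk x →* A'} (g₁ : IsLoc b₁) (g₂ : IsLoc b₂)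
    (w' : SameImage f b₁ b₂) (e₁ : j.comp a₁ = b₁) (e₂ : j.comp a₂ = b₂) :
    PMod.pullHom j b₁ b₂ e₁ e₂ (D.glueAtHom h₁ h₂ w) = D.glueAtHom g₁ g₂ w' := by
  ext z
  have key : ∀ n : D.sheaf.stalk x, PMod.pullHom j b₁ b₂ e₁ e₂ (D.glueAtHom h₁ h₂ w)
      (Tensor.mk b₁ 1 n) = D.glueAtHom g₁ g₂ w' (Tensor.mk b₁ 1 n) := by
    intro n
    change (PMod.extendComp a₂ j b₂ e₂ ⟨D.sheaf.stalk x⟩).hom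
      (Tensor.mk j 1 (D.glueAt h₁ h₂ w (Tensor.mk a₁ 1 n))) =
        D.glueAt g₁ g₂ w' (Tensor.mk b₁ 1 n)
    have := D.glueAt_comp h₁ h₂ w hj g₁ g₂ w' e₁ e₂ (Tensor.mk a₁ 1 n)
    rw [Tensor.map_mk, map_one] at this
    rw [this]
    induction D.glueAt h₁ h₂ w (Tensor.mk a₁ 1 n) using Tensor.ind with
    | H p m => exact congrArg (fun b => Tensor.mk b₂ b m) (one_mul (j p))
  induction z using Tensor.ind with
  | H b n =>
    let φ := PMod.pullHom j b₁ b₂ e₁ e₂ (D.glueAtHom h₁ h₂ w)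
    let m : (PMod.extend b₁).obj ⟨D.sheaf.stalk x⟩ := Tensor.mk b₁ 1 n
    have h : Tensor.mk b₁ b n = b • m := (Tensor.smul_mk_one (h := b₁) b n).symm
    refine (congrArg φ h).trans ((PMod.hom_smul φ b m).trans ?_)
    refine (congrArg (b • ·) (key n)).trans (Eq.trans ?_ (congrArg (D.glueAtHom g₁ g₂ w') h.symm))
    exact (PMod.hom_smul (D.glueAtHom g₁ g₂ w') b m).symm

include hf in
lemma isLoc_two₁ : IsLoc (two₁ (stalkHom f x)) := (Pushout.inl_faithfullyFlat (hf x)).isUnit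

include hf in
lemma isLoc_two₂ : IsLoc (two₂ (stalkHom f x)) := (Pushout.inr_faithfullyFlat (hf x)).isUnit

/-- The descent datum on the stalk at `x`. -/
def fibreDescent : DescentMod (stalkHom f x) where
  obj := ⟨D.sheaf.stalk x⟩
  iso :=
    { hom := D.glueAtHom (isLoc_two₁ hf x) (isLoc_two₂ hf x)
        (sameImage_of_comp_eq (Pushout.condition _ _))
      inv := D.glueAtHom (isLoc_two₂ hf x) (isLoc_two₁ hf x)
        (sameImage_of_comp_eq (Pushout.condition _ _).symm)
      hom_inv_id := by rw [glueAtHom_comp, glueAtHom_self]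
      inv_hom_id := by rw [glueAtHom_comp, glueAtHom_self] }
  cocycle := by
    -- All maps into the triple pushout are local, so they define points of X with values in it; the
    -- cocycle condition becomes transitivity of `glueAt`.
    have i : IsLoc (Pushout.inl ((two₁ (stalkHom f x)).comp (stalkHom f x)) (stalkHom f x)) :=
      (Pushout.inl_faithfullyFlat (hf x)).isUnit
    have l₁ : IsLoc (three₁ (stalkHom f x)) := i.comp (isLoc_two₁ hf x)
    have l₂ : IsLoc (three₂ (stalkHom f x)) := i.comp (isLoc_two₂ hf x)
    have l₃ : IsLoc (three₃ (stalkHom f x)) :=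
      .pushoutInr ((isLoc_two₁ hf x).comp (isLoc_stalkHom f x)) (hf x)
    have w₁₂ := sameImage_of_comp_eq (three₁_eq_three₂ (stalkHom f x))
    have w₂₃ := sameImage_of_comp_eq (three₂_eq_three₃ (stalkHom f x))
    have w₁₃ := sameImage_of_comp_eq (three₁_eq_three₃ (stalkHom f x))
    refine (congrArg₂ (· ≫ ·) (D.pullHom_glueAtHom _ _ _ (.pushoutLift l₁ l₂ _) l₁ l₂ w₁₂
      (three₁₂_two₁ _) (three₁₂_two₂ _)) (D.pullHom_glueAtHom _ _ _ (.pushoutLift l₂ l₃ _) l₂ l₃ w₂₃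
      (three₂₃_two₁ _) (three₂₃_two₂ _))).trans ?_
    refine (D.glueAtHom_comp l₁ l₂ l₃ w₁₂ w₂₃).trans ?_
    exact (D.pullHom_glueAtHom _ _ _ (.pushoutLift l₁ l₃ _) l₁ l₃ w₁₃
      (three₁₃_two₁ _) (three₁₃_two₂ _)).symm

/-- For a single point x the universal pushout is P ⊕_Q P for the stalk map Q → P, so matching
itself is the equalizer condition; the next lemma is the converse. -/
lemma matches_self_of_equalizer (g : (D.fibreDescent hf x).equalizer) : D.Matches g.1 g.1 :=
  Matches.of_pushout (y := f.hom.base x) rfl rfl (isLoc_two₁ hf x) (isLoc_two₂ hf x)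
    (sameImage_of_comp_eq (Pushout.condition _ _)) g.2.symm

lemma matches_iff_equalizer {n : D.sheaf.stalk x} (H : D.Matches n n) :
    Tensor.mk (two₂ (stalkHom f x)) 1 n = (D.fibreDescent hf x).iso.hom
      (Tensor.mk (two₁ (stalkHom f x)) 1 n) :=
  (H _ _ _ (isLoc_two₁ hf x) (isLoc_two₂ hf x) (sameImage_of_comp_eq (Pushout.condition _ _))).symm

end Fibre

lemma Matches.smul {D : ModDescent f} {x₁ x₂ : X} {n₁ : D.sheaf.stalk x₁} {n₂ : D.sheaf.stalk x₂}
    (H : D.Matches n₁ n₂) {V : Opens Y} (h₁ : f.hom.base x₁ ∈ V) (h₂ : f.hom.base x₂ ∈ V)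
    (q : Y.str.obj (op V)) :
    D.Matches (stalkHom f x₁ (Y.germ _ h₁ q) • n₁) (stalkHom f x₂ (Y.germ _ h₂ q) • n₂) := by
  intro A _ a₁ a₂ l₁ l₂ w
  rw [Tensor.mk_one_smul, Tensor.mk_one_smul, glueAt_smul, H, w.stalk V h₁ h₂]

/-- The sections of the descended module. -/
def descendPred (V : (Opens Y)ᵒᵖ) (s : ((pushforward f).obj D.sheaf).presheaf.obj V) : Prop :=
  ∀ (x₁ x₂ : X) (h₁ : f.hom.base x₁ ∈ V.unop) (h₂ : f.hom.base x₂ ∈ V.unop),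
    f.hom.base x₁ = f.hom.base x₂ →
      D.Matches (D.sheaf.germ (U := (Opens.map f.hom.base).obj V.unop) x₁ h₁ s)
        (D.sheaf.germ (U := (Opens.map f.hom.base).obj V.unop) x₂ h₂ s)

lemma descendPred_map {V W : (Opens Y)ᵒᵖ} (i : V ⟶ W)
    {s : ((pushforward f).obj D.sheaf).presheaf.obj V} (hs : D.descendPred V s) :
    D.descendPred W (((pushforward f).obj D.sheaf).presheaf.map i s) := by
  intro x₁ x₂ h₁ h₂ h
  have key : ∀ (x : X) (hx : f.hom.base x ∈ W.unop),
      D.sheaf.germ (U := (Opens.map f.hom.base).obj W.unop) x hx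
        (((pushforward f).obj D.sheaf).presheaf.map i s) =
      D.sheaf.germ (U := (Opens.map f.hom.base).obj V.unop) x (i.unop.le hx) s := fun x hx =>
    D.sheaf.germ_map ((Opens.map f.hom.base).map i.unop) x hx s
  have := hs x₁ x₂ (i.unop.le h₁) (i.unop.le h₂) h
  rw [← key x₁ h₁, ← key x₂ h₂] at this
  exact this

lemma descendPred_smul {V : (Opens Y)ᵒᵖ} (q : Y.str.obj V)
    {s : ((pushforward f).obj D.sheaf).presheaf.obj V} (hs : D.descendPred V s) :
    D.descendPred V (q • s) := by
  intro x₁ x₂ h₁ h₂ h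
  have e := fun x hx => germ_pushforward_smul f D.sheaf (V := V.unop) x hx q s
  have := (hs x₁ x₂ h₁ h₂ h).smul h₁ h₂ q
  rw [← e, ← e] at this
  exact this

/-- The presheaf of the descended module. -/
def descendPresheaf : TopCat.Presheaf (Type u) Y.toPresheafedSpace.carrier where
  obj V := {s : ((pushforward f).obj D.sheaf).presheaf.obj V // D.descendPred V s}
  map {V W} i := ↾ fun s => ⟨((pushforward f).obj D.sheaf).presheaf.map i s.1,
    D.descendPred_map i s.2⟩
  map_id V := by
    refine ConcreteCategory.hom_ext _ _ fun s => ?_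
    exact Subtype.ext (ConcreteCategory.congr_hom
      (((pushforward f).obj D.sheaf).presheaf.map_id V) s.1)
  map_comp i j := by
    refine ConcreteCategory.hom_ext _ _ fun s => ?_
    exact Subtype.ext (ConcreteCategory.congr_hom
      (((pushforward f).obj D.sheaf).presheaf.map_comp i j) s.1)

lemma descendPresheaf_isSheaf : D.descendPresheaf.IsSheaf := by
  refine TopCat.Presheaf.isSheaf_of_isSheafUniqueGluing_types _ fun ι U sf hsf => ?_
  let F : TopCat.Sheaf (Type u) Y.toPresheafedSpace.carrier :=
    ⟨((pushforward f).obj D.sheaf).presheaf, ((pushforward f).obj D.sheaf).isSheaf⟩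
  obtain ⟨s, hs, hu⟩ := TopCat.Sheaf.existsUnique_gluing F U (fun i => (sf i).1) (fun i j =>
    congrArg Subtype.val (hsf i j))
  refine ⟨⟨s, fun x₁ x₂ h₁ h₂ h => ?_⟩, fun i => Subtype.ext (hs i), fun t ht =>
    Subtype.ext (hu t.1 fun i => congrArg Subtype.val (ht i))⟩
  obtain ⟨i, hi⟩ := Opens.mem_iSup.1 h₁
  have key : ∀ (x : X) (hx : f.hom.base x ∈ U i) (hx' : f.hom.base x ∈ iSup U),
      D.sheaf.germ (U := (Opens.map f.hom.base).obj (iSup U)) x hx' s =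
      D.sheaf.germ (U := (Opens.map f.hom.base).obj (U i)) x hx (sf i).1 := fun x hx hx' =>
    (D.sheaf.germ_map ((Opens.map f.hom.base).map (Opens.leSupr U i)) x hx s).symm.trans
      (congrArg (D.sheaf.germ (U := (Opens.map f.hom.base).obj (U i)) x hx) (hs i))
  have := (sf i).2 x₁ x₂ hi (h ▸ hi) h
  rw [← key x₁ hi h₁, ← key x₂ (h ▸ hi) h₂] at this
  exact this

/-- The module on `Y` obtained from a descent datum. -/
def descend : Y.Modules where
  presheaf := D.descendPresheaf
  isSheaf := D.descendPresheaf_isSheaf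
  action _ :=
    { smul := fun q s => ⟨q • s.1, D.descendPred_smul q s.2⟩
      one_smul := fun s => Subtype.ext (one_smul _ s.1)
      mul_smul := fun a b s => Subtype.ext (mul_smul a b s.1) }
  map_smul i a s := Subtype.ext (((pushforward f).obj D.sheaf).map_smul i a s.1)

/-- The inclusion of the descended module. -/
def descendι : D.descend ⟶ (pushforward f).obj D.sheaf where
  hom := { app := fun _ => ↾ fun s => s.1, naturality := fun _ _ _ => rfl }
  map_smul _ _ _ := rfl

/-- The map `f^* G(N) ⟶ N`. -/
def counit : pullbackObj f D.descend ⟶ D.sheaf := pullbackInvFun D.descendι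

lemma stalkMap_counit (x : X) (a : X.str.stalk x) {V : Opens Y} (hx : f.hom.base x ∈ V)
    (s : D.descend.presheaf.obj (op V)) :
    stalkMap D.counit x (pullbackGerm f D.descend x (Tensor.mk _ a (D.descend.germ _ hx s))) =
      a • D.sheaf.germ (U := (Opens.map f.hom.base).obj V) x hx s.1 := by
  refine (stalkMap_pullbackGerm x D.counit a hx s).trans ?_
  exact congrArg (fun z => a • D.sheaf.germ (U := (Opens.map f.hom.base).obj V) x hx z)
    (pullbackInvFun_app_pullbackSection D.descendι s)

end ModDescent
end LMS
end MonoidFan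

/-! ### Stalks of the descended module -/

namespace MonoidFan

namespace LMS
open Modules
variable {X Y : LMS.{u}} {f : X ⟶ Y}

namespace ModDescent
variable (D : ModDescent f)

/-- The map from the stalk of the descended module at `f x` to the stalk at `x`. -/
def descendStalk (x : X) : D.descend.stalk (f.hom.base x) → D.sheaf.stalk x :=
  adjStalkMap D.descendι x

lemma descendStalk_germ (x : X) {V : Opens Y} (hx : f.hom.base x ∈ V)
    (s : D.descend.presheaf.obj (op V)) :
    D.descendStalk x (D.descend.germ _ hx s) =
      D.sheaf.germ (U := (Opens.map f.hom.base).obj V) x hx s.1 :=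
  adjStalkMap_germ D.descendι x hx s

lemma descendStalk_smul (x : X) (q : Y.str.stalk (f.hom.base x))
    (m : D.descend.stalk (f.hom.base x)) :
    D.descendStalk x (q • m) = stalkHom f x q • D.descendStalk x m :=
  adjStalkMap_smul D.descendι x q m

lemma stalkMap_counit_pullbackGerm (x : X) (a : X.str.stalk x)
    (m : D.descend.stalk (f.hom.base x)) :
    stalkMap D.counit x (pullbackGerm f D.descend x (Tensor.mk _ a m)) =
      a • D.descendStalk x m := by
  obtain ⟨V, hV, s, rfl⟩ := D.descend.exists_germ _ m
  rw [stalkMap_counit, descendStalk_germ]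

lemma matches_descendStalk (x : X) (m : D.descend.stalk (f.hom.base x)) :
    D.Matches (D.descendStalk x m) (D.descendStalk x m) := by
  obtain ⟨V, hV, s, rfl⟩ := D.descend.exists_germ _ m
  rw [descendStalk_germ]
  exact s.2 x x hV hV rfl

variable (hd : IsDescentMap f)
include hd

/-- Over the smallest neighbourhood of f(x) a section is determined by its germ at x: a point x'
there lies in the fibre of some generization x'' of x, and the germ at x'' determines the matching
germ at x'. -/
lemma descendStalk_injective (x : X) : Function.Injective (D.descendStalk x) := by
  intro m m' e
  obtain ⟨V, hV, s, rfl⟩ := D.descend.exists_germ _ m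
  obtain ⟨V', hV', s', rfl⟩ := D.descend.exists_germ _ m'
  rw [descendStalk_germ, descendStalk_germ] at e
  let W : Opens Y := ⟨_, hd.isOpen_target (f.hom.base x)⟩
  have i : W ≤ V := fun y (hy : y ⤳ f.hom.base x) => hy.mem_open V.isOpen hV
  have i' : W ≤ V' := fun y (hy : y ⤳ f.hom.base x) => hy.mem_open V'.isOpen hV'
  refine (D.descend.germ_eq_iff _ _ _ _ _).2 ⟨W, specializes_rfl, homOfLE i, homOfLE i', ?_⟩
  refine Subtype.ext (D.sheaf.section_ext (U := (Opens.map f.hom.base).obj W) fun x' hx' => ?_)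
  refine (D.sheaf.germ_map ((Opens.map f.hom.base).map (homOfLE i)) x' hx' s.1).trans
    (Eq.trans ?_ (D.sheaf.germ_map ((Opens.map f.hom.base).map (homOfLE i')) x' hx' s'.1).symm)
  obtain ⟨x'', hx, hb⟩ := hd.exists_specializes x _ hx'
  have m₁ := s.2 x' x'' (i hx') (i (hb.symm ▸ hx')) hb.symm
  have m₂ := s'.2 x' x'' (i' hx') (i' (hb.symm ▸ hx')) hb.symm
  refine Matches.eq_of_matches hd.flat hb.symm m₁ ?_
  have e' : D.sheaf.germ (U := (Opens.map f.hom.base).obj V) x'' (i (hb.symm ▸ hx')) s.1 =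
      D.sheaf.germ (U := (Opens.map f.hom.base).obj V') x'' (i' (hb.symm ▸ hx')) s'.1 :=
    (D.sheaf.sp_germ hx (U := (Opens.map f.hom.base).obj V) hV s.1).symm.trans
      ((congrArg (D.sheaf.sp hx) e).trans
        (D.sheaf.sp_germ hx (U := (Opens.map f.hom.base).obj V') hV' s'.1))
  have := e' ▸ m₂
  exact this

/-- Over the preimage of the smallest neighbourhood of f(x), t(x') is the element matching the
generization of n at some x'' ⤳ x in the fibre of x'. It does not depend on x'' because n matches
itself, and uniqueness of partners makes t compatible with generization, hence a section. -/
lemma exists_descendStalk_eq (x : X) {n : D.sheaf.stalk x} (H : D.Matches n n) :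
    ∃ m, D.descendStalk x m = n := by
  let V : Opens Y := ⟨_, hd.isOpen_target (f.hom.base x)⟩
  have hex : ∀ x' : ((Opens.map f.hom.base).obj V : Opens X), ∃ n' : D.sheaf.stalk x'.1,
      ∀ (x'' : X) (h : x'' ⤳ x), f.hom.base x'' = f.hom.base x'.1 →
        D.Matches n' (D.sheaf.sp h n) := by
    intro x'
    obtain ⟨x'', h, e⟩ := hd.exists_specializes x _ x'.2
    obtain ⟨n', hn'⟩ := Matches.exists_matches hd.flat e.symm (H.sp hd.flat rfl h h rfl)
    exact ⟨n', fun x₃ h₃ e₃ => hn'.trans hd.flat rfl e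
      (H.sp hd.flat rfl h h₃ (e.trans e₃.symm))⟩
  choose t ht using hex
  have uniq : ∀ (x' : ((Opens.map f.hom.base).obj V : Opens X)) (m : D.sheaf.stalk x'.1) (x'' : X)
      (h : x'' ⤳ x), f.hom.base x'' = f.hom.base x'.1 → D.Matches m (D.sheaf.sp h n) → m = t x' :=
    fun x' m x'' h e hm => Matches.eq_of_matches hd.flat e.symm hm (ht x' x'' h e)
  have hsp : ∀ (x₁ x₂ : ((Opens.map f.hom.base).obj V : Opens X)) (h : x₂.1 ⤳ x₁.1),
      D.sheaf.sp h (t x₁) = t x₂ := by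
    intro x₁ x₂ h
    obtain ⟨x₁', h₁, e₁⟩ := hd.exists_specializes x _ x₁.2
    -- The lift of f(x₂) is taken as a generization of x₁', so that the matching of t(x₁) at x₁' can
    -- be generized to it.
    obtain ⟨x₂', h₂, e₂⟩ := hd.exists_specializes x₁' (f.hom.base x₂.1)
      (e₁.symm ▸ map_specializes f h)
    refine uniq x₂ _ x₂' (h₂.trans h₁) e₂ ?_
    rw [← Modules.sp_sp D.sheaf h₁ h₂]
    exact (ht x₁ x₁' h₁ e₁).sp hd.flat e₁.symm h h₂ e₂.symm
  -- On the smallest neighbourhood of x' the family consists of the generizations of its value at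
  -- x', so it is given there by one section.
  obtain ⟨s, hs⟩ := D.sheaf.exists_section t fun x' => by
    obtain ⟨W, hW, s, hs⟩ := D.sheaf.exists_germ _ (t x')
    let W' : Opens X := ⟨_, hd.isOpen_source x'.1⟩
    have i : W' ≤ W := fun y (hy : y ⤳ x'.1) => hy.mem_open W.isOpen hW
    have i' : W' ≤ (Opens.map f.hom.base).obj V := fun y (hy : y ⤳ x'.1) =>
      hy.mem_open ((Opens.map f.hom.base).obj V).isOpen x'.2
    refine ⟨W', specializes_rfl, homOfLE i', D.sheaf.presheaf.map (homOfLE i).op s, fun y => ?_⟩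
    have hy : y.1 ⤳ x'.1 := y.2
    refine (D.sheaf.germ_map (homOfLE i) y.1 y.2 s).trans (Eq.trans ?_ (hsp x' ⟨y.1, i' y.2⟩ hy))
    exact (D.sheaf.sp_germ hy hW s).symm.trans (congrArg _ hs)
  refine ⟨D.descend.germ (U := V) _ specializes_rfl ⟨s, fun x₁ x₂ h₁ h₂ h => ?_⟩, ?_⟩
  · have e₁ := hs ⟨x₁, h₁⟩
    have e₂ := hs ⟨x₂, h₂⟩
    rw [e₁, e₂]
    obtain ⟨x', hx', e'⟩ := hd.exists_specializes x _ h₁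
    exact (ht ⟨x₁, h₁⟩ x' hx' e').trans hd.flat rfl e' (ht ⟨x₂, h₂⟩ x' hx' (e'.trans h)).symm
  · refine (D.descendStalk_germ x (V := V) specializes_rfl _).trans ?_
    refine (hs ⟨x, specializes_rfl⟩).trans (uniq ⟨x, specializes_rfl⟩ n x specializes_rfl rfl ?_).symm
    rw [Modules.sp_refl]
    exact H

/-- The stalk of the descended module is the equalizer in N_x, so this is the counit of descent
along the stalk map of f at x, and the two lemmas for `DescentMod` apply. -/
lemma stalkMap_counit_bijective (x : X) : Function.Bijective (stalkMap D.counit x) := by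
  have hb : Function.Bijective (pullbackGerm f D.descend x) :=
    Function.bijective_iff_has_inverse.2 ⟨pullbackVal f D.descend x,
      pullbackVal_pullbackGerm f D.descend x, pullbackGerm_pullbackVal f D.descend x⟩
  constructor
  · intro m m' e
    obtain ⟨z, rfl⟩ := hb.2 m
    obtain ⟨z', rfl⟩ := hb.2 m'
    induction z using Tensor.ind with
    | H a m => induction z' using Tensor.ind with
      | H b m' =>
        rw [stalkMap_counit_pullbackGerm, stalkMap_counit_pullbackGerm] at e
        obtain ⟨c, q, r, rfl, rfl, e'⟩ := DescentMod.exists_of_smul_eq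
          (D := D.fibreDescent hd.flat x) (hd.flat x)
          (g := ⟨_, D.matches_iff_equalizer hd.flat x (D.matches_descendStalk x m)⟩)
          (g' := ⟨_, D.matches_iff_equalizer hd.flat x (D.matches_descendStalk x m')⟩) e
        have e'' : stalkHom f x q • D.descendStalk x m = stalkHom f x r • D.descendStalk x m' :=
          congrArg Subtype.val e'
        rw [← descendStalk_smul, ← descendStalk_smul] at e''
        rw [Tensor.mk_mul, Tensor.mk_mul, D.descendStalk_injective hd x e'']
  · intro n
    obtain ⟨p, g, rfl⟩ := DescentMod.exists_eq_smul (D := D.fibreDescent hd.flat x) (hd.flat x) n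
    obtain ⟨m, hm⟩ := D.exists_descendStalk_eq hd x (D.matches_self_of_equalizer hd.flat x g)
    exact ⟨pullbackGerm f D.descend x (Tensor.mk _ p m), by
      rw [stalkMap_counit_pullbackGerm, hm]; rfl⟩

end ModDescent
end LMS
end MonoidFan

/-! ### Morphisms of descent data and the canonical datum -/

namespace MonoidFan

namespace LMS
open Modules
variable {X Y : LMS.{u}} {f : X ⟶ Y}

lemma stalkHom_germ_congr {T : LMS.{u}} {p q : T ⟶ Y} (e : p = q) (t : T) {V : Opens Y}
    (hp : p.hom.base t ∈ V) (hq : q.hom.base t ∈ V) (s : Y.str.obj (op V)) :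
    stalkHom p t (Y.germ _ hp s) = stalkHom q t (Y.germ _ hq s) := by
  subst e
  rfl

lemma sameImage_stalkHom {T : LMS.{u}} {p₁ p₂ : T ⟶ X} (w : p₁ ≫ f = p₂ ≫ f) (t : T) :
    SameImage f (stalkHom p₁ t) (stalkHom p₂ t) where
  base := congrArg (fun q : T ⟶ Y => q.hom.base t) w
  stalk V h₁ h₂ s := by
    refine (DFunLike.congr_fun (stalkHom_comp p₁ f t) _).trans (Eq.trans ?_
      (DFunLike.congr_fun (stalkHom_comp p₂ f t) _).symm)
    exact stalkHom_germ_congr w t h₁ h₂ s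

namespace ModDescent

section Glue
variable {D E : ModDescent f}

/-- Matching refers to monoid-valued points only. The stalk of T at t, with its identity map, is
such a monoid and recovers the gluing over T. -/
lemma glue_of_matches {T : LMS.{u}} {p₁ p₂ : T ⟶ X} (w : p₁ ≫ f = p₂ ≫ f) (t : T)
    {n₁ : D.sheaf.stalk (p₁.hom.base t)} {n₂ : D.sheaf.stalk (p₂.hom.base t)}
    (H : D.Matches n₁ n₂) : D.glue p₁ p₂ w t (Tensor.mk _ 1 n₁) = Tensor.mk _ 1 n₂ := by
  have hid : IsEqFaithfullyFlat (MonoidHom.id (T.str.stalk t)) :=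
    .of_bijective Function.bijective_id
  refine Tensor.map_injective hid (MonoidHom.id_comp _) ?_
  rw [← D.glueAt_map p₁ p₂ w t (MonoidHom.id _) hid.isUnit (isLoc_stalkHom p₁ t)
    (isLoc_stalkHom p₂ t) (sameImage_stalkHom w t) (MonoidHom.id_comp _)]
  exact H _ _ _ _ _ _

lemma pointFib_mk_one {A : Type u} [CommMonoid A] {x : X} {a : X.str.stalk x →* A} (h : IsLoc a)
    (N : X.Modules) (n : N.stalk x) :
    pointFib N h (Tensor.mk (stalkHom (ofPoint a h) PUnit.unit)
      (M := N.stalk ((ofPoint a h).hom.base PUnit.unit)) 1 n) = Tensor.mk a 1 n :=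
  congrArg (fun b => Tensor.mk a b n) (map_one (pointEval A))

/-- The underlying morphism of a morphism of modules with descent data. -/
def sheafHom (φ : D ⟶ E) : D.sheaf ⟶ E.sheaf := Pseudofunctor.DescentData.Hom.hom φ ()

lemma sheafHom_comm (φ : D ⟶ E) {T : LMS.{u}} {p₁ p₂ : T ⟶ X} (w : p₁ ≫ f = p₂ ≫ f) :
    (pullback p₁).map (sheafHom φ) ≫ E.glueHom p₁ p₂ w =
      D.glueHom p₁ p₂ w ≫ (pullback p₂).map (sheafHom φ) :=
  Pseudofunctor.DescentData.Hom.comm φ (p₁ ≫ f) (i₁ := ()) (i₂ := ()) p₁ p₂ rfl w.symm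

lemma Matches.map (φ : D ⟶ E) {x₁ x₂ : X} {n₁ : D.sheaf.stalk x₁} {n₂ : D.sheaf.stalk x₂}
    (H : D.Matches n₁ n₂) :
    E.Matches (stalkMap (sheafHom φ) x₁ n₁) (stalkMap (sheafHom φ) x₂ n₂) := by
  have key : ∀ (T : LMS.{u}) (p₁ p₂ : T ⟶ X) (w : p₁ ≫ f = p₂ ≫ f) (t : T)
      (m₁ : D.sheaf.stalk (p₁.hom.base t)) (m₂ : D.sheaf.stalk (p₂.hom.base t)),
      D.Matches m₁ m₂ → E.glue p₁ p₂ w t (Tensor.mk _ 1 (stalkMap (sheafHom φ) _ m₁)) =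
        Tensor.mk _ 1 (stalkMap (sheafHom φ) _ m₂) := by
    intro T p₁ p₂ w t m₁ m₂ H
    have h := congrArg (fun ψ => fib (p := p₁) (q := p₂) ψ t (Tensor.mk _ 1 m₁)) (sheafHom_comm φ w)
    refine (congrArg (E.glue p₁ p₂ w t) (fib_map (p := p₁) (sheafHom φ) t 1 m₁).symm).trans ?_
    refine (fib_comp (p := p₁) (q := p₁) (r := p₂) _ _ t _).symm.trans (h.trans ?_)
    refine (fib_comp (p := p₁) (q := p₂) (r := p₂) _ _ t _).trans ?_
    refine (congrArg _ (glue_of_matches w t H)).trans ?_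
    exact fib_map (p := p₂) (sheafHom φ) t 1 m₂
  intro A _ a₁ a₂ h₁ h₂ w
  rw [← pointFib_mk_one h₁, glueAt_pointFib]
  refine Eq.trans (congrArg _ ?_) (pointFib_mk_one h₂ E.sheaf _)
  exact key _ (ofPoint a₁ h₁) (ofPoint a₂ h₂) (w.ofPoint_comp h₁ h₂) PUnit.unit n₁ n₂ H

end Glue

section Taut
variable (M : Y.Modules)

lemma fib_mapComp_hom {T : LMS.{u}} {p : T ⟶ X} {q : T ⟶ Y} (e : p ≫ f = q) (e') (t : T)
    {V : Opens Y} (hV : f.hom.base (p.hom.base t) ∈ V) (hV' : q.hom.base t ∈ V)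
    (b : T.str.stalk t) (m : M.presheaf.obj (op V)) :
    fib (p := q) (q := p) (F := M) (G := pullbackObj f M)
      ((pseudofunctor.mapComp' f.op.toLoc p.op.toLoc q.op.toLoc e').hom.toNatTrans.app M) t
        (mkGerm q M t b hV' m) =
      mkGerm p (pullbackObj f M) t b (V := (Opens.map f.hom.base).obj V) hV (pullbackSection f M m) := by
  subst e
  have : pseudofunctor.mapComp' f.op.toLoc p.op.toLoc (p ≫ f).op.toLoc e' =
    pseudofunctor.mapComp f.op.toLoc p.op.toLoc := pseudofunctor.mapComp'_eq_mapComp _ _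
  rw [this]
  refine (fib_mk_germ (p := p ≫ f) (q := p) ((pullbackComp p f).inv.app M) t b hV' m).trans ?_
  refine (congrArg (fun z => b • z) (congrFun (congrArg Subtype.val
      (pullbackComp_inv_pullbackSection p f M m)) ⟨t, hV'⟩)).trans ?_
  exact Tensor.smul_mk_one _ _

lemma fib_mapComp_inv {T : LMS.{u}} {p : T ⟶ X} {q : T ⟶ Y} (e : p ≫ f = q) (e') (t : T)
    {V : Opens Y} (hV : f.hom.base (p.hom.base t) ∈ V) (hV' : q.hom.base t ∈ V)
    (b : T.str.stalk t) (m : M.presheaf.obj (op V)) :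
    fib (p := p) (q := q) (G := M) (F := pullbackObj f M)
      ((pseudofunctor.mapComp' f.op.toLoc p.op.toLoc q.op.toLoc e').inv.toNatTrans.app M) t
        (mkGerm p (pullbackObj f M) t b (V := (Opens.map f.hom.base).obj V) hV
          (pullbackSection f M m)) = mkGerm q M t b hV' m := by
  subst e
  have : pseudofunctor.mapComp' f.op.toLoc p.op.toLoc (p ≫ f).op.toLoc e' =
    pseudofunctor.mapComp f.op.toLoc p.op.toLoc := pseudofunctor.mapComp'_eq_mapComp _ _
  rw [this]
  refine (fib_mk_germ (p := p) (q := p ≫ f) ((pullbackComp p f).hom.app M) t b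
    (V := (Opens.map f.hom.base).obj V) hV (pullbackSection f M m)).trans ?_
  refine (congrArg (fun z => b • z) (congrFun (congrArg Subtype.val
      (pullbackComp_hom_pullbackSection p f M m)) ⟨t, hV'⟩)).trans ?_
  exact Tensor.smul_mk_one _ _

/-- The canonical datum passes through the pullback of M along f p₁ = f p₂, and both comparison maps
preserve the pullbacks of sections of M. -/
lemma glue_toModDescent {T : LMS.{u}} {p₁ p₂ : T ⟶ X} (w : p₁ ≫ f = p₂ ≫ f) (t : T)
    {V : Opens Y} (h₁ : f.hom.base (p₁.hom.base t) ∈ V) (h₂ : f.hom.base (p₂.hom.base t) ∈ V)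
    (b : T.str.stalk t) (m : M.presheaf.obj (op V)) :
    ((toModDescent f).obj M).glue p₁ p₂ w t (mkGerm p₁ (pullbackObj f M) t b
        (V := (Opens.map f.hom.base).obj V) h₁ (pullbackSection f M m)) =
      mkGerm p₂ (pullbackObj f M) t b
        (V := (Opens.map f.hom.base).obj V) h₂ (pullbackSection f M m) := by
  refine (fib_comp (p := p₁) (q := p₁ ≫ f) (r := p₂) _ _ t _).trans ?_
  refine (congrArg _ (fib_mapComp_inv M rfl _ t h₁ h₁ b m)).trans ?_
  exact fib_mapComp_hom M w.symm _ t h₂ h₁ b m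

lemma matches_toModDescent {x₁ x₂ : X} {V : Opens Y} (h₁ : f.hom.base x₁ ∈ V)
    (h₂ : f.hom.base x₂ ∈ V) (m : M.presheaf.obj (op V)) :
    ((toModDescent f).obj M).Matches
      ((pullbackObj f M).germ (U := (Opens.map f.hom.base).obj V) x₁ h₁ (pullbackSection f M m))
      ((pullbackObj f M).germ (U := (Opens.map f.hom.base).obj V) x₂ h₂ (pullbackSection f M m)) := by
  intro A _ a₁ a₂ l₁ l₂ w
  refine (congrArg _ (pointFib_mk_one l₁ (pullbackObj f M) _).symm).trans ?_
  refine (glueAt_pointFib _ l₁ l₂ w _).trans ?_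
  refine Eq.trans (congrArg _ ?_) (pointFib_mk_one l₂ (pullbackObj f M) _)
  exact glue_toModDescent M (w.ofPoint_comp l₁ l₂) PUnit.unit h₁ h₂ 1 m

end Taut
end ModDescent
end LMS
end MonoidFan

/-! ### Descent for all modules -/

namespace MonoidFan

/-- A map of modules is bijective if it becomes bijective after a faithfully flat extension of
scalars. -/
lemma IsEqFaithfullyFlat.bijective_of_bijective {P Q : Type u} [CommMonoid P] [CommMonoid Q]
    {h : Q →* P} (hh : IsEqFaithfullyFlat h)
    {M N : Type u} [MulAction Q M] [MulAction Q N] (φ : M → N)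
    (hφ : ∀ (q : Q) (m : M), φ (q • m) = q • φ m) (ψ : Tensor h M → Tensor h N)
    (hψ : ∀ a m, ψ (Tensor.mk h a m) = Tensor.mk h a (φ m)) (hb : Function.Bijective ψ) :
    Function.Bijective φ := by
  constructor
  · intro m m' e
    refine Tensor.mk_one_injective hh (hb.1 ?_)
    rw [hψ, hψ, e]
  · intro n
    obtain ⟨z, hz⟩ := hb.2 (Tensor.mk h 1 n)
    induction z using Tensor.ind with
    | H a m =>
      rw [hψ] at hz
      -- From a ⊗ φ(m) = 1 ⊗ n one gets q φ(m) = r n with r a unit by locality, so n is the image of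
      -- r⁻¹ q m.
      obtain ⟨c, q, r, -, e, e'⟩ := (Tensor.mk_eq_iff hh.toIsEqFlat).1 hz
      obtain ⟨r, rfl⟩ : IsUnit r :=
        hh.isUnit _ (IsUnit.of_mul_eq_one c (by rw [mul_comm]; exact e.symm))
      exact ⟨(↑r⁻¹ : Q) • q • m, by rw [hφ, hφ, e', ← mul_smul, Units.inv_mul, one_smul]⟩

namespace LMS
open Modules
variable {X Y : LMS.{u}} {f : X ⟶ Y}

namespace ModDescent
variable {D : ModDescent f} {M : Y.Modules}

/-- The morphism `M ⟶ G(D)` given by a morphism of descent data `f^* M ⟶ D`. -/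
def liftDescend (χ : (toModDescent f).obj M ⟶ D) : M ⟶ D.descend where
  hom :=
    { app := fun V => ↾ fun m => ⟨(pullbackToFun (F := M) (sheafHom χ)).hom.app V m, by
        intro x₁ x₂ h₁ h₂ _
        have H := (matches_toModDescent M h₁ h₂ m).map χ
        have e := fun (x : X) (hx : f.hom.base x ∈ V.unop) => stalkMap_germ (sheafHom χ)
          (U := (Opens.map f.hom.base).obj V.unop) x hx (pullbackSection f M (V := V.unop) m)
        refine Eq.mp ?_ H
        exact congrArg₂ (fun a b => D.Matches a b) (e x₁ h₁) (e x₂ h₂)⟩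
      naturality := fun V W i => by
        refine ConcreteCategory.hom_ext _ _ fun m => Subtype.ext ?_
        exact naturality_apply (pullbackToFun (F := M) (sheafHom χ)) i m }
  map_smul V a m := Subtype.ext ((pullbackToFun (F := M) (sheafHom χ)).map_smul V a m)

lemma map_liftDescend_comp_counit (χ : (toModDescent f).obj M ⟶ D) :
    ((pullback f).map (liftDescend χ) : pullbackObj f M ⟶ pullbackObj f D.descend) ≫ D.counit =
      sheafHom χ := by
  refine pullback_hom_ext fun V m => ?_
  refine (congrArg (D.counit.hom.app _) (pullback_map_pullbackSection f (liftDescend χ) m)).trans ?_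
  exact pullbackInvFun_app_pullbackSection D.descendι _

lemma fib_counit {T : LMS.{u}} (p : T ⟶ X) (t : T) (b : T.str.stalk t) {V : Opens Y}
    (hV : f.hom.base (p.hom.base t) ∈ V) (s : D.descend.presheaf.obj (op V)) :
    fib ((pullback p).map D.counit : pullbackObj p (pullbackObj f D.descend) ⟶ pullbackObj p D.sheaf) t
      (mkGerm p (pullbackObj f D.descend) t b (V := (Opens.map f.hom.base).obj V) hV
        (pullbackSection f D.descend s)) =
      Tensor.mk _ b (D.sheaf.germ (U := (Opens.map f.hom.base).obj V) (p.hom.base t) hV s.1) := by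
  refine (fib_map (p := p) D.counit t b _).trans (congrArg (Tensor.mk _ b) ?_)
  refine (stalkMap_germ D.counit (U := (Opens.map f.hom.base).obj V) _ hV _).trans ?_
  exact congrArg (D.sheaf.germ (U := (Opens.map f.hom.base).obj V) (p.hom.base t) hV)
    (pullbackInvFun_app_pullbackSection D.descendι s)

lemma exists_mkGerm_pullbackSection {T : LMS.{u}} (p : T ⟶ X) (M : Y.Modules) (t : T)
    (z : PullbackStalk p (pullbackObj f M) t) :
    ∃ (b : T.str.stalk t) (V : Opens Y) (hV : f.hom.base (p.hom.base t) ∈ V)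
      (m : M.presheaf.obj (op V)), z = mkGerm p (pullbackObj f M) t b
        (V := (Opens.map f.hom.base).obj V) hV (pullbackSection f M m) := by
  induction z using Tensor.ind with
  | H b n =>
    obtain ⟨z, rfl⟩ : ∃ z, n = pullbackGerm f M _ z := ⟨_, (pullbackGerm_pullbackVal f M _ n).symm⟩
    induction z using Tensor.ind with
    | H a m =>
      obtain ⟨V, hV, m, rfl⟩ := M.exists_germ _ m
      refine ⟨b * stalkHom p t a, V, hV, m, ?_⟩
      refine (congrArg (Tensor.mk _ b) (pullbackGerm_mk_germ f M _ a hV m)).trans ?_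
      exact (Tensor.mk_mul _ _ _).symm

/-- The sections of the descended module generate the fibres. On them the canonical datum is the
identity on sections, and the given datum acts in the same way by the matching condition. -/
lemma counit_comm {T : LMS.{u}} {p₁ p₂ : T ⟶ X} (w : p₁ ≫ f = p₂ ≫ f) :
    ((pullback p₁).map D.counit : pullbackObj p₁ (pullbackObj f D.descend) ⟶ pullbackObj p₁ D.sheaf) ≫
      D.glueHom p₁ p₂ w = ((toModDescent f).obj D.descend).glueHom p₁ p₂ w ≫
        ((pullback p₂).map D.counit :
          pullbackObj p₂ (pullbackObj f D.descend) ⟶ pullbackObj p₂ D.sheaf) := by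
  refine fib_injective fun t z => ?_
  obtain ⟨b, V, h₁, m, rfl⟩ := exists_mkGerm_pullbackSection p₁ D.descend t z
  have h₂ : f.hom.base (p₂.hom.base t) ∈ V :=
    (congrArg (fun q : T ⟶ Y => q.hom.base t ∈ V) w).mp h₁
  refine (fib_comp (p := p₁) (q := p₁) (r := p₂) _ _ t _).trans ?_
  refine Eq.trans ?_ (fib_comp (p := p₁) (q := p₂) (r := p₂) _ _ t _).symm
  refine (congrArg (fib (p := p₁) (q := p₂) _ t) (fib_counit p₁ t b h₁ m)).trans ?_
  refine Eq.trans ?_ (congrArg (fib (p := p₂) (q := p₂) _ t)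
    (glue_toModDescent D.descend w t h₁ h₂ b m)).symm
  refine Eq.trans ?_ (fib_counit p₂ t b h₂ m).symm
  refine (congrArg (D.glue p₁ p₂ w t) (Tensor.smul_mk_one b _).symm).trans ?_
  refine (fib_smul (p := p₁) (q := p₂) _ t b _).trans ?_
  refine (congrArg (b • ·) (glue_of_matches w t (m.2 _ _ h₁ h₂
    (congrArg (fun q : T ⟶ Y => q.hom.base t) w)))).trans ?_
  exact Tensor.smul_mk_one b _

variable (D) in
/-- The map from the pullback of the descended module, as a morphism of descent data. -/
def counitHom : (toModDescent f).obj D.descend ⟶ D :=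
  { hom := fun _ => D.counit
    comm := fun T q _ _ p₁ p₂ w₁ w₂ => by
      have h1 := D.hom_eq_glueHom q w₁ w₂
      have h2 := ((toModDescent f).obj D.descend).hom_eq_glueHom q w₁ w₂
      refine (congrArg (fun z => (pullback p₁).map D.counit ≫ z) h1).trans ?_
      refine Eq.trans ?_ (congrArg (fun z => z ≫ (pullback p₂).map D.counit) h2).symm
      exact counit_comm (w₁.trans w₂.symm) }

lemma isIso_of_isIso_sheafHom {D E : ModDescent f} (φ : D ⟶ E) (h : IsIso (sheafHom φ)) : IsIso φ :=
  (Pseudofunctor.DescentData.isoMk (D₁ := D) (D₂ := E) (fun _ => @asIso _ _ _ _ (sheafHom φ) h)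
    (fun _ q _ _ p₁ p₂ w₁ w₂ => Pseudofunctor.DescentData.Hom.comm φ q p₁ p₂ w₁ w₂)).isIso_hom

end ModDescent

open ModDescent

section Equivalence
variable (hd : IsDescentMap f)
include hd

lemma IsDescentMap.isIso_counit (D : ModDescent f) : IsIso D.counit :=
  isIso_of_stalkMap_bijective _ (D.stalkMap_counit_bijective hd)

lemma IsDescentMap.isIso_counitHom (D : ModDescent f) : IsIso D.counitHom :=
  isIso_of_isIso_sheafHom _ (hd.isIso_counit D)

/-- A morphism is an isomorphism if its pullback is. -/
lemma IsDescentMap.isIso_of_isIso_map {F G : Y.Modules} (φ : F ⟶ G)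
    [IsIso ((pullback f).map φ)] : IsIso φ := by
  refine isIso_of_stalkMap_bijective _ fun y => ?_
  obtain ⟨x, rfl⟩ := hd.surjective y
  have hb : Function.Bijective (fib (p := f) (q := f) ((pullback f).map φ) x) :=
    (pullbackVal_bijective f G x).comp ((stalkMap_bijective_of_isIso ((pullback f).map φ) x).comp
      (Function.bijective_iff_has_inverse.2 ⟨pullbackVal f F x,
        pullbackVal_pullbackGerm f F x, pullbackGerm_pullbackVal f F x⟩))
  exact (hd.flat x).bijective_of_bijective _ (stalkMap_smul φ _) _ (fib_map φ x) hb

/-- For the unit η the composite of f^* η with the counit is the identity. The counit is invertible,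
hence so is f^* η, and f^* reflects isomorphisms. -/
lemma IsDescentMap.isIso_liftDescend_id (M : Y.Modules) :
    IsIso (liftDescend (𝟙 ((toModDescent f).obj M))) := by
  have := hd.isIso_counit ((toModDescent f).obj M)
  have : IsIso ((pullback f).map (liftDescend (𝟙 ((toModDescent f).obj M)))) :=
    @isIso_of_comp_hom_eq_id _ _ _ _ ((toModDescent f).obj M).counit this _
      (map_liftDescend_comp_counit (𝟙 ((toModDescent f).obj M)))
  exact hd.isIso_of_isIso_map _

lemma IsDescentMap.map_injective {F G : Y.Modules} {φ ψ : F ⟶ G}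
    (h : (pullback f).map φ = (pullback f).map ψ) : φ = ψ := by
  refine hom_ext_stalk fun y m => ?_
  obtain ⟨x, rfl⟩ := hd.surjective y
  refine Tensor.mk_one_injective (hd.flat x) ?_
  rw [← fib_map, ← fib_map, h]

/-- Descent of modules along `f`. -/
theorem IsDescentMap.toModDescent_isEquivalence : (toModDescent f).IsEquivalence where
  faithful := ⟨fun h => hd.map_injective (congrArg sheafHom h)⟩
  full := ⟨fun {M N} χ => by
    have := hd.isIso_liftDescend_id N
    -- A morphism χ : f^* M → f^* N of descent data lifts to M → G(f^* N), and the unit η identifies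
    -- N with G(f^* N). The pullback of η⁻¹ is the counit, which returns χ.
    let η := liftDescend (𝟙 ((toModDescent f).obj N))
    refine ⟨liftDescend χ ≫ inv η, Pseudofunctor.DescentData.hom_ext fun _ => ?_⟩
    have h : (pullback f).map η ≫ ((toModDescent f).obj N).counit = 𝟙 (pullbackObj f N) :=
      map_liftDescend_comp_counit (𝟙 ((toModDescent f).obj N))
    have e : (pullback f).map (inv η) = ((toModDescent f).obj N).counit := by
      refine (cancel_epi ((pullback f).map η)).1 (Eq.trans ?_ h.symm)
      rw [← Functor.map_comp, IsIso.hom_inv_id]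
      exact (pullback f).map_id N
    refine ((pullback f).map_comp (liftDescend χ) (inv η)).trans ?_
    exact (congrArg (fun z => (pullback f).map (liftDescend χ) ≫ z) e).trans
      (map_liftDescend_comp_counit χ)⟩
  essSurj := ⟨fun D => by
    have := hd.isIso_counitHom D
    exact ⟨_, ⟨asIso D.counitHom⟩⟩⟩

end Equivalence
end LMS
end MonoidFan

/-! ### Generizations and faces in locally finite type fans -/

namespace MonoidFan

namespace Spec
variable {P : Type u} [CommMonoid P]

lemma specializes_iff {F G : Spec P} : G ⤳ F ↔ (F : Face P).1 ≤ (G : Face P).1 := by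
  refine ⟨fun h p hp => ?_, fun h => specializes_iff_forall_open.2 fun U hU hF => mem_of_le hU hF h⟩
  exact h.mem_open (Face.isOpen_basicOpen p) hp

lemma sp_toStalk {F G : Spec P} (h : G ⤳ F) (p : P) : (Spec P).sp h (toStalk F p) = toStalk G p :=
  LMS.sp_germ h (U := ⊤) trivial _

/-- A point of the spectrum of a finitely generated monoid has a smallest neighbourhood. -/
lemma isOpen_setOf_specializes (hP : Monoid.FG P) (F : Spec P) : IsOpen {G : Spec P | G ⤳ F} := by
  classical
  obtain ⟨S, hS⟩ := Monoid.fg_def.1 hP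
  -- A face containing this product contains each generator in F, and these generate F because
  -- factors of elements of F lie in F.
  let p : P := ∏ s ∈ S with s ∈ (F : Face P).1, s
  have hp : p ∈ (F : Face P).1 := Submonoid.prod_mem _ fun s hs => (Finset.mem_filter.1 hs).2
  have key : ∀ (G : Face P), p ∈ G.1 → (F : Face P).1 ≤ G.1 := by
    intro G hG
    have hs : ∀ s ∈ S, s ∈ (F : Face P).1 → s ∈ G.1 := fun s hs hF => by
      have : p = s * ∏ t ∈ (S.filter (· ∈ (F : Face P).1)).erase s, t :=
        (Finset.mul_prod_erase _ _ (Finset.mem_filter.2 ⟨hs, hF⟩)).symm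
      exact (G.2 _ _ (this ▸ hG)).1
    intro q hq
    have hq' : q ∈ Submonoid.closure (S : Set P) := hS ▸ Submonoid.mem_top q
    induction hq' using Submonoid.closure_induction with
    | mem s h => exact hs s h hq
    | one => exact G.1.one_mem
    | mul a b _ _ ha hb =>
      obtain ⟨h₁, h₂⟩ := (F : Face P).2 a b hq
      exact G.1.mul_mem (ha h₁) (hb h₂)
  have e : {G : Spec P | G ⤳ F} = Face.basicOpen p :=
    Set.ext fun G => specializes_iff.trans ⟨fun h => h hp, fun h => key G h⟩
  rw [e]
  exact Face.isOpen_basicOpen p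

lemma isUnit_sp_iff {F G : Spec P} (h : G ⤳ F) (a : (Spec P).str.stalk F) :
    ∃ p : P, (IsUnit ((Spec P).sp h a) ↔ p ∈ (G : Face P).1) ∧
      ∃ b, IsUnit (toStalk F b) ∧ a * toStalk F b = toStalk F p := by
  obtain ⟨p, b, hb, e⟩ := exists_toStalk_mul_eq F a
  have hb' : IsUnit (toStalk G b) := isUnit_toStalk_iff.2 (specializes_iff.1 h hb)
  refine ⟨p, ?_, b, isUnit_toStalk_iff.2 hb, e⟩
  have e' := congrArg ((Spec P).sp h) e
  rw [map_mul, sp_toStalk, sp_toStalk] at e'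
  rw [← isUnit_toStalk_iff, ← e', IsUnit.mul_iff, and_iff_left hb']

/-- Every face of the stalk at `F` is given by a generization of `F`. -/
lemma exists_specializes (F : Spec P) (K : Face ((Spec P).str.stalk F)) :
    ∃ (G : Spec P) (h : G ⤳ F), ∀ a, IsUnit ((Spec P).sp h a) ↔ a ∈ K.1 := by
  let G : Face P := Face.comap (toStalk F) K
  have h : (G : Spec P) ⤳ F := specializes_iff.2 fun p hp =>
    closedPoint_le K (isUnit_toStalk_iff.2 hp)
  refine ⟨G, h, fun a => ?_⟩
  obtain ⟨p, e₁, b, hb, e₂⟩ := isUnit_sp_iff h a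
  rw [e₁]
  change toStalk F p ∈ K.1 ↔ _
  rw [← e₂]
  exact ⟨fun h => (K.2 _ _ h).1, fun h => K.1.mul_mem h (closedPoint_le K hb)⟩

/-- A generization is determined by the elements that become invertible. -/
lemma eq_of_isUnit_sp_iff {F G G' : Spec P} (h : G ⤳ F) (h' : G' ⤳ F)
    (e : ∀ a, IsUnit ((Spec P).sp h a) ↔ IsUnit ((Spec P).sp h' a)) : G = G' := by
  refine Subtype.ext (Submonoid.ext fun p => ?_)
  have := e (toStalk F p)
  rw [sp_toStalk, sp_toStalk] at this
  exact isUnit_toStalk_iff.symm.trans (this.trans isUnit_toStalk_iff)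

end Spec

namespace LMS
variable {X Y : LMS.{u}}

lemma isUnit_stalkHom_iff (f : X ⟶ Y) (x : X) (a : Y.str.stalk (f.hom.base x)) :
    IsUnit (stalkHom f x a) ↔ IsUnit a := ⟨isUnit_stalkHom f, fun h => h.map _⟩

namespace IsOpenEmbedding
variable {f : X ⟶ Y} (hf : IsOpenEmbedding f)
include hf

lemma isOpenEmbedding_base : Topology.IsOpenEmbedding f.hom.base :=
  PresheafedSpace.IsOpenImmersion.base_open (self := hf)

lemma stalkHom_bijective (x : X) : Function.Bijective (stalkHom f x) := by
  have : PresheafedSpace.IsOpenImmersion f.hom := hf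
  have : IsIso (f.hom.stalkMap x) := inferInstance
  exact ConcreteCategory.bijective_of_isIso (f.hom.stalkMap x)

lemma exists_eq_of_specializes {x : X} {y : Y} (h : y ⤳ f.hom.base x) :
    ∃ x' : X, x' ⤳ x ∧ f.hom.base x' = y := by
  obtain ⟨x', rfl⟩ := h.mem_open hf.isOpenEmbedding_base.isOpen_range ⟨x, rfl⟩
  exact ⟨x', hf.isOpenEmbedding_base.isInducing.specializes_iff.1 h, rfl⟩

lemma isOpen_setOf_specializes {x : X} (h : IsOpen {x' | x' ⤳ x}) :
    IsOpen {y | y ⤳ f.hom.base x} := by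
  have e : {y | y ⤳ f.hom.base x} = f.hom.base '' {x' | x' ⤳ x} := by
    ext y
    constructor
    · exact fun hy => hf.exists_eq_of_specializes hy
    · rintro ⟨x', hx', rfl⟩
      exact map_specializes f hx'
  rw [e]
  exact hf.isOpenEmbedding_base.isOpenMap _ h

end IsOpenEmbedding

namespace IsLocFinTypeFan
variable (hX : X.IsLocFinTypeFan)
include hX

lemma isOpen_setOf_specializes (x : X) : IsOpen {x' | x' ⤳ x} := by
  obtain ⟨P, _, j, hP, hj, F, rfl⟩ := hX x
  exact hj.isOpen_setOf_specializes (Spec.isOpen_setOf_specializes hP F)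

lemma exists_specializes (x : X) (K : Face (X.str.stalk x)) :
    ∃ (x' : X) (h : x' ⤳ x), ∀ a, IsUnit (X.sp h a) ↔ a ∈ K.1 := by
  obtain ⟨P, _, j, hP, hj, F, rfl⟩ := hX x
  let e : (Spec P).str.stalk F →* X.str.stalk (j.hom.base F) :=
    (MulEquiv.ofBijective _ (hj.stalkHom_bijective F)).symm.toMonoidHom
  obtain ⟨G, h, H⟩ := Spec.exists_specializes F (Face.comap e K)
  refine ⟨j.hom.base G, map_specializes j h, fun a => ?_⟩
  rw [← isUnit_stalkHom_iff j G, stalkHom_sp j h, H]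
  change e (stalkHom j F a) ∈ K.1 ↔ a ∈ K.1
  rw [show e (stalkHom j F a) = a from
    (MulEquiv.ofBijective _ (hj.stalkHom_bijective F)).symm_apply_apply a]

lemma eq_of_isUnit_sp_iff {x x' x'' : X} (h : x' ⤳ x) (h' : x'' ⤳ x)
    (e : ∀ a, IsUnit (X.sp h a) ↔ IsUnit (X.sp h' a)) : x' = x'' := by
  obtain ⟨P, _, j, hP, hj, F, rfl⟩ := hX x
  obtain ⟨G, hG, rfl⟩ := hj.exists_eq_of_specializes h
  obtain ⟨G', hG', rfl⟩ := hj.exists_eq_of_specializes h'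
  refine congrArg _ (Spec.eq_of_isUnit_sp_iff hG hG' fun a => ?_)
  obtain ⟨a, rfl⟩ := (hj.stalkHom_bijective F).2 a
  rw [← stalkHom_sp j hG, ← stalkHom_sp j hG', isUnit_stalkHom_iff, isUnit_stalkHom_iff]
  exact e a

end IsLocFinTypeFan

/-- The face of elements that become invertible at a generization. -/
def faceOfSpecializes {x x' : X} (h : x' ⤳ x) : Face (X.str.stalk x) :=
  Face.comap (X.sp h) (Spec.closedPoint _)

end LMS

/-- The face generated by the image of a face. -/
def Face.map {P Q : Type u} [CommMonoid P] [CommMonoid Q] (h : Q →* P) (G : Face Q) : Face P :=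
  ⟨{ carrier := {a | ∃ (a' : P) (g : Q), g ∈ G.1 ∧ a * a' = h g}
     one_mem' := ⟨1, 1, G.1.one_mem, by simp⟩
     mul_mem' := by
      rintro a b ⟨a', g, hg, e⟩ ⟨b', g', hg', e'⟩
      exact ⟨a' * b', g * g', G.1.mul_mem hg hg', by rw [map_mul, ← e, ← e']; ac_rfl⟩ }, by
    rintro a b ⟨c, g, hg, e⟩
    exact ⟨⟨b * c, g, hg, by rw [← e]; ac_rfl⟩, ⟨a * c, g, hg, by rw [← e]; ac_rfl⟩⟩⟩

/-- Going down for faces: if h(q) a = h(g) with g in G, flatness gives s q = s' g with s' a unit by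
locality, so s q lies in G and so does its factor q. -/
lemma IsEqFaithfullyFlat.mem_map_iff {P Q : Type u} [CommMonoid P] [CommMonoid Q] {h : Q →* P}
    (hh : IsEqFaithfullyFlat h) (G : Face Q) (q : Q) : h q ∈ (Face.map h G).1 ↔ q ∈ G.1 := by
  constructor
  · rintro ⟨a, g, hg, e⟩
    obtain ⟨c, s, s', -, e', e''⟩ := hh.eq_mul a 1 q g (by rw [mul_comm, e, one_mul])
    have hs : IsUnit s' := hh.isUnit _ (IsUnit.of_mul_eq_one c (by rw [mul_comm]; exact e'.symm))
    exact (G.2 s q (e'' ▸ G.1.mul_mem (Spec.closedPoint_le G hs) hg)).2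
  · exact fun hq => ⟨1, q, hq, by simp⟩

namespace LMS
variable {X Y : LMS.{u}} {f : X ⟶ Y}

/-- A flat cover of locally finite type fans satisfies the conditions for descent. -/
lemma IsFlatCover.isDescentMap (hX : X.IsLocFinTypeFan) (hY : Y.IsLocFinTypeFan)
    (hf : IsFlatCover f) : IsDescentMap f := by
  have ff : ∀ x, IsEqFaithfullyFlat (stalkHom f x) := fun x =>
    ⟨(hf.1 x).isEqFlat, fun _ h => isUnit_stalkHom f h⟩
  refine ⟨hf.2, ff, fun x y' h => ?_, hX.isOpen_setOf_specializes, hY.isOpen_setOf_specializes⟩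
  -- y' corresponds to a face of M_{Y,f(x)}. The face it generates in M_{X,x} defines x', and it
  -- contracts to the original face, whence f(x') = y'.
  obtain ⟨x', h', e⟩ := hX.exists_specializes x (Face.map (stalkHom f x) (faceOfSpecializes h))
  refine ⟨x', h', hY.eq_of_isUnit_sp_iff (map_specializes f h') h fun b => ?_⟩
  rw [← isUnit_stalkHom_iff f x', stalkHom_sp f h', e, (ff x).mem_map_iff]
  rfl

end LMS
end MonoidFan

/-! ### Cartesian modules -/

namespace MonoidFan

lemma PMod.bijective_of_isIso {P : Type u} [CommMonoid P] {M N : PMod P} (f : M ⟶ N) [IsIso f] :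
    Function.Bijective f :=
  Function.bijective_iff_has_inverse.2 ⟨inv f,
    fun m => DFunLike.congr_fun (IsIso.hom_inv_id f) m,
    fun n => DFunLike.congr_fun (IsIso.inv_hom_id f) n⟩

section Tensor
variable {P Q : Type u} [CommMonoid P] [CommMonoid Q]

/-- The map `P ⊗_Q M → P ⊗_Q N` given by a map of modules. -/
def Tensor.mapRight (h : Q →* P) {M N : Type u} [MulAction Q M] [MulAction Q N] (φ : M → N)
    (hφ : ∀ (q : Q) (m : M), φ (q • m) = q • φ m) : Tensor h M → Tensor h N :=
  Tensor.lift (fun a m => Tensor.mk h a (φ m)) (by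
    intro a q m
    rw [Tensor.mk_mul, hφ])

lemma Tensor.mapRight_bijective (h : Q →* P) {M N : Type u} [MulAction Q M] [MulAction Q N]
    (φ : M → N) (hφ : ∀ (q : Q) (m : M), φ (q • m) = q • φ m) (hb : Function.Bijective φ) :
    Function.Bijective (Tensor.mapRight h φ hφ) := by
  have hs := Function.surjInv_eq hb.2
  refine Function.bijective_iff_has_inverse.2 ⟨Tensor.mapRight h (Function.surjInv hb.2)
    (fun q n => hb.1 (by rw [hφ, hs, hs])), fun z => ?_, fun z => ?_⟩
  · induction z using Tensor.ind with
    | H a m => exact congrArg (Tensor.mk h a) (hb.1 (hs _))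
  · induction z using Tensor.ind with
    | H a m => exact congrArg (Tensor.mk h a) (hs _)

end Tensor

namespace LMS
namespace Modules
variable {X Y : LMS.{u}}

/-- The map `M_{X, x'} ⊗ F_x → F_{x'}` for a generization `x'` of `x`. -/
def spTensor (F : X.Modules) {x x' : X} (h : x' ⤳ x) : Tensor (X.sp h) (F.stalk x) → F.stalk x' :=
  Tensor.lift (fun a m => a • F.sp h m) (by
    intro a b m
    rw [sp_smul, mul_smul])

lemma spTensor_smul (F : X.Modules) {x x' : X} (h : x' ⤳ x) (a : X.str.stalk x')
    (z : Tensor (X.sp h) (F.stalk x)) : F.spTensor h (a • z) = a • F.spTensor h z := by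
  induction z using Tensor.ind with
  | H b m => exact mul_smul a b (F.sp h m)

/-- `F` is cartesian: the stalks at generizations are obtained by extension of scalars. -/
def IsCartesian (F : X.Modules) : Prop :=
  ∀ {x x' : X} (h : x' ⤳ x), Function.Bijective (F.spTensor h)

lemma IsCartesian.of_iso {F G : X.Modules} (e : F ≅ G) (hF : F.IsCartesian) : G.IsCartesian := by
  intro x x' h
  have hb : ∀ x, Function.Bijective (stalkMap e.hom x) := fun x => stalkMap_bijective_of_isIso _ x
  have hc := Tensor.mapRight_bijective (X.sp h) (stalkMap e.hom x) (stalkMap_smul e.hom x) (hb x)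
  refine (Function.Bijective.of_comp_iff _ hc).1 ?_
  have : G.spTensor h ∘ Tensor.mapRight (X.sp h) (stalkMap e.hom x) (stalkMap_smul e.hom x) =
      stalkMap e.hom x' ∘ F.spTensor h := by
    funext z
    induction z using Tensor.ind with
    | H a m =>
      refine (congrArg (a • ·) (stalkMap_sp e.hom h m).symm).trans ?_
      exact (stalkMap_smul e.hom x' a (F.sp h m)).symm
  rw [this]
  exact (hb x').comp (hF h)

section Pullback
variable (f : X ⟶ Y) (F : Y.Modules) {x x' : X} (h : x' ⤳ x)

/-- The isomorphism `M_{X, x'} ⊗ M_{Y, f x'} ⊗ F_{f x} ≅ M_{X, x'} ⊗ (f^* F)_x`. -/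
def pullbackSpEquiv (z : Tensor (stalkHom f x') (Tensor (Y.sp (map_specializes f h))
    (F.stalk (f.hom.base x)))) : Tensor (X.sp h) ((pullbackObj f F).stalk x) :=
  Tensor.mapRight (X.sp h) (pullbackGerm f F x) (fun a z => pullbackGerm_smul f F x a z)
    ((PMod.extendComp (stalkHom f x) (X.sp h) _ rfl ⟨F.stalk (f.hom.base x)⟩).inv
      ((PMod.extendComp (Y.sp (map_specializes f h)) (stalkHom f x')
        ((X.sp h).comp (stalkHom f x)) (MonoidHom.ext (stalkHom_sp f h))
        ⟨F.stalk (f.hom.base x)⟩).hom z))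

lemma pullbackSpEquiv_bijective : Function.Bijective (pullbackSpEquiv f F h) := by
  have hb : Function.Bijective (pullbackGerm f F x) :=
    Function.bijective_iff_has_inverse.2 ⟨pullbackVal f F x,
      pullbackVal_pullbackGerm f F x, pullbackGerm_pullbackVal f F x⟩
  exact (Tensor.mapRight_bijective _ _ _ hb).comp
    ((PMod.bijective_of_isIso _).comp (PMod.bijective_of_isIso _))

lemma pullbackVal_spTensor (z : Tensor (stalkHom f x') (Tensor (Y.sp (map_specializes f h))
    (F.stalk (f.hom.base x)))) :
    pullbackVal f F x' ((pullbackObj f F).spTensor h (pullbackSpEquiv f F h z)) =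
      Tensor.mapRight (stalkHom f x') (F.spTensor (map_specializes f h))
        (F.spTensor_smul (map_specializes f h)) z := by
  induction z using Tensor.ind with
  | H a z => induction z using Tensor.ind with
    | H b m =>
      refine (pullbackVal_smul f F x' (a * stalkHom f x' b) _).trans ?_
      refine (congrArg ((a * stalkHom f x' b) • ·) ((pullbackObj_sp f F h _).trans
        (congrArg _ (pullbackVal_pullbackGerm f F x (Tensor.mk _ 1 m))))).trans ?_
      refine (congrArg ((a * stalkHom f x' b) • ·) (congrArg (fun c => Tensor.mk (stalkHom f x') c
        (F.sp (map_specializes f h) m)) (map_one (X.sp h)))).trans ?_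
      exact (Tensor.smul_mk_one _ _).trans (Tensor.mk_mul a b _)

/-- Up to isomorphisms at both ends, the comparison map of f^* F at x' ⤳ x is the base change of
that of F along the stalk map at x'. -/
lemma bijective_spTensor_pullback_iff :
    Function.Bijective ((pullbackObj f F).spTensor h) ↔
      Function.Bijective (Tensor.mapRight (stalkHom f x') (F.spTensor (map_specializes f h))
        (F.spTensor_smul (map_specializes f h))) := by
  rw [← Function.Bijective.of_comp_iff _ (pullbackSpEquiv_bijective f F h),
    ← Function.Bijective.of_comp_iff' (pullbackVal_bijective f F x')]
  exact iff_of_eq (congrArg _ (funext (pullbackVal_spTensor f F h)))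

variable {F} in
lemma IsCartesian.pullback (hF : F.IsCartesian) : (pullbackObj f F).IsCartesian := fun h =>
  (bijective_spTensor_pullback_iff f F h).2 (Tensor.mapRight_bijective _ _ _ (hF _))

variable {f F} in
lemma bijective_spTensor_of_pullback (hf : IsEqFaithfullyFlat (stalkHom f x'))
    (hF : (pullbackObj f F).IsCartesian) :
    Function.Bijective (F.spTensor (map_specializes f h)) :=
  hf.bijective_of_bijective _ (F.spTensor_smul _) _ (fun _ _ => rfl)
    ((bijective_spTensor_pullback_iff f F h).1 (hF h))

end Pullback

lemma IsCartesian.of_pullback {f : X ⟶ Y} (hd : IsDescentMap f) {F : Y.Modules}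
    (hF : (pullbackObj f F).IsCartesian) : F.IsCartesian := by
  intro y y' h
  obtain ⟨x, rfl⟩ := hd.surjective y
  obtain ⟨x', h', rfl⟩ := hd.exists_specializes x y' h
  exact bijective_spTensor_of_pullback h' (hd.flat x') hF

/-- The condition is local: open sets contain the generizations of their points, and stalk maps of
open embeddings are bijective. -/
lemma IsCartesian.of_forall_exists_isOpenEmbedding {F : X.Modules}
    (H : ∀ x : X, ∃ (Z : LMS.{u}) (j : Z ⟶ X), IsOpenEmbedding j ∧ x ∈ Set.range j.hom.base ∧
      (pullbackObj j F).IsCartesian) : F.IsCartesian := by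
  intro x x' h
  obtain ⟨Z, j, hj, ⟨z, rfl⟩, hF⟩ := H x
  obtain ⟨z', h', rfl⟩ := hj.exists_eq_of_specializes h
  exact bijective_spTensor_of_pullback h' (.of_bijective (hj.stalkHom_bijective z')) hF

end Modules
end LMS

namespace Spec
open LMS LMS.Modules
variable {P : Type u} [CommMonoid P] (M : PMod P)

section Tilde
variable (F : Spec P)

/-- The value in `F⁻¹ P ⊗ M` of a germ of `M^~`. -/
def tildeVal : (tilde M).stalk F → Tensor (toStalk F) M :=
  TopCat.stalkToFiber (tildePred M).sheafify F

variable {F} in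
lemma tildeVal_germ {U : Opens (Spec P)} (hF : F ∈ U) (s : (tilde M).presheaf.obj (op U)) :
    tildeVal M F ((tilde M).germ F hF s) = s.1 ⟨F, hF⟩ :=
  TopCat.stalkToFiber_germ _ U F hF s

variable {F} in
lemma tildeVal_smul (a : (Spec P).str.stalk F) (m : (tilde M).stalk F) :
    tildeVal M F (a • m) = a • tildeVal M F m := by
  obtain ⟨U, hU, s, t, rfl, rfl⟩ := (tilde M).exists_germ₂ F a m
  rw [← germ_smul, tildeVal_germ, tildeVal_germ]
  rfl

variable {M} in
/-- The global section of `M^~` given by an element of `M`. -/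
def tildeSection (m : M) : (tilde M).presheaf.obj (op ⊤) :=
  ⟨fun F => Tensor.mk (toStalk F.1) 1 m, fun _ => ⟨⊤, trivial, 𝟙 _, 1, m, fun G =>
    congrArg (fun a => Tensor.mk (toStalk G.1) a m) ((Spec P).germ_one (U := ⊤) G.1 trivial).symm⟩⟩

/-- The germ of `M^~` with a given value. -/
def tildeGerm : Tensor (toStalk F) M → (tilde M).stalk F :=
  Tensor.lift (fun a m => a • (tilde M).germ F (U := ⊤) trivial (tildeSection m)) (by
    intro a p m
    rw [mul_smul]
    refine congrArg (a • ·) ((germ_smul (tilde M) (U := ⊤) F trivial _ _).symm.trans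
      (congrArg ((tilde M).germ F (U := ⊤) trivial) (Subtype.ext (funext fun G => ?_))))
    exact (Tensor.mk_one_smul (h := toStalk G.1) p m).symm)

lemma tildeVal_tildeGerm (z : Tensor (toStalk F) M) : tildeVal M F (tildeGerm M F z) = z := by
  induction z using Tensor.ind with
  | H a m =>
    refine (tildeVal_smul M a _).trans ?_
    refine (congrArg (a • ·) (tildeVal_germ M (U := ⊤) trivial _)).trans ?_
    exact Tensor.smul_mk_one a m

lemma tildeGerm_tildeVal (m : (tilde M).stalk F) : tildeGerm M F (tildeVal M F m) = m := by
  obtain ⟨U, hU, s, rfl⟩ := (tilde M).exists_germ F m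
  rw [tildeVal_germ]
  obtain ⟨W, hW, i, a, m, e⟩ := s.2 ⟨F, hU⟩
  refine (congrArg (tildeGerm M F) (e ⟨F, hW⟩)).trans ?_
  refine (congrArg ((Spec P).germ F hW a • ·) ((tilde M).germ_map (homOfLE le_top) F hW
    (tildeSection m)).symm).trans ((germ_smul (tilde M) F hW _ _).symm.trans ?_)
  refine Eq.trans ?_ ((tilde M).germ_map i F hW s)
  refine congrArg ((tilde M).germ F hW) (Subtype.ext (funext fun G => ?_))
  exact (Tensor.smul_mk_one _ _).trans (e G).symm

lemma tildeVal_bijective : Function.Bijective (tildeVal M F) :=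
  Function.bijective_iff_has_inverse.2 ⟨tildeGerm M F, tildeGerm_tildeVal M F,
    tildeVal_tildeGerm M F⟩

lemma tildeGerm_bijective : Function.Bijective (tildeGerm M F) :=
  Function.bijective_iff_has_inverse.2 ⟨tildeVal M F, tildeVal_tildeGerm M F,
    tildeGerm_tildeVal M F⟩

end Tilde

lemma tildeGerm_smul (F : Spec P) (a : (Spec P).str.stalk F) (z : Tensor (toStalk F) M) :
    tildeGerm M F (a • z) = a • tildeGerm M F z := by
  induction z using Tensor.ind with
  | H b m => exact mul_smul a b _

/-- Extension of scalars from P to the stalk at F and then to the stalk at G is extension from P to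
the stalk at G. -/
lemma isCartesian_tilde : (tilde M).IsCartesian := by
  intro F G h
  have hl : ((Spec P).sp h).comp (toStalk F) = toStalk G := MonoidHom.ext (sp_toStalk h)
  let κ : Tensor (toStalk G) M → Tensor ((Spec P).sp h) ((tilde M).stalk F) := fun z =>
    Tensor.mapRight _ (tildeGerm M F) (tildeGerm_smul M F)
      ((PMod.extendComp (toStalk F) ((Spec P).sp h) (toStalk G) hl M).inv z)
  have hκ : Function.Bijective κ :=
    (Tensor.mapRight_bijective _ _ _ (tildeGerm_bijective M F)).comp (PMod.bijective_of_isIso _)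
  rw [← Function.Bijective.of_comp_iff _ hκ]
  convert tildeGerm_bijective M G
  funext z
  induction z using Tensor.ind with
  | H a m =>
    refine congrArg (a • ·) ?_
    refine (congrArg ((tilde M).sp h) (one_smul _ _)).trans ?_
    exact sp_germ (tilde M) h (U := ⊤) trivial (tildeSection m)

end Spec
end MonoidFan

/-! ### Cartesian modules on affine fans -/

namespace MonoidFan

namespace Spec
open LMS LMS.Modules
variable {P : Type u} [CommMonoid P]

variable (P) in
/-- The closed point, as a point of the fan `Spec P`. -/
def closed : Spec P := closedPoint P

lemma specializes_closedPoint (F : Spec P) : F ⤳ (closed P) :=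
  specializes_iff.2 (closedPoint_le F)

section
variable (G : (Spec P).Modules)

/-- The stalk at the closed point as a `P`-module. -/
def closedStalk : PMod P :=
  PMod.restrict (toStalk (closed P)) ⟨G.stalk (closed P)⟩

/-- The map from the stalk of `G(closed P)^~` to the stalk of `G`. -/
def closedStalkMap (F : Spec P) : Tensor (toStalk F) (closedStalk G) → G.stalk F :=
  Tensor.lift (fun a m => a • G.sp (specializes_closedPoint F) m) (by
    intro a p m
    refine (mul_smul _ _ _).trans (congrArg (a • ·) ?_)
    refine Eq.trans ?_ (Modules.sp_smul G (specializes_closedPoint F)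
      (toStalk (closed P) p) m).symm
    exact congrArg (· • G.sp (specializes_closedPoint F) m)
      (sp_toStalk (specializes_closedPoint F) p).symm)

lemma closedStalkMap_smul (F : Spec P) (a : (Spec P).str.stalk F)
    (z : Tensor (toStalk F) (closedStalk G)) :
    closedStalkMap G F (a • z) = a • closedStalkMap G F z := by
  induction z using Tensor.ind with
  | H b m => exact mul_smul a b _

-- Every point is a generization of the closed point, whose stalk is P, so this is the cartesian
-- condition at the closed point.
variable {G} in
lemma closedStalkMap_bijective (hG : G.IsCartesian) (F : Spec P) :
    Function.Bijective (closedStalkMap G F) := by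
  have hc := toStalk_closedPoint_bijective (P := P) (F := closed P) rfl
  let h := specializes_closedPoint F
  let κ : Tensor (toStalk F) (closedStalk G) →
      Tensor ((Spec P).sp h) (G.stalk (closed P)) :=
    Tensor.lift (fun a m => Tensor.mk ((Spec P).sp h) (M := G.stalk (closed P)) a m) (by
      intro a p m
      exact (congrArg (fun b => Tensor.mk ((Spec P).sp h) (M := G.stalk (closed P)) (a * b) m) (sp_toStalk h p).symm).trans
        (Tensor.mk_mul (M := G.stalk (closed P)) a _ m))
  have hκ : Function.Bijective κ := by
    refine Function.bijective_iff_has_inverse.2 ⟨Tensor.lift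
      (fun a m => Tensor.mk (toStalk F) (M := closedStalk G) a m) ?_, fun z => ?_, fun z => ?_⟩
    · intro a b m
      obtain ⟨p, rfl⟩ := hc.2 b
      exact (congrArg (fun b => Tensor.mk (toStalk F) (M := closedStalk G) (a * b) m)
        (sp_toStalk h p)).trans (Tensor.mk_mul (M := closedStalk G) a p m)
    · induction z using Tensor.ind with
      | H a m => rfl
    · induction z using Tensor.ind with
      | H a m => rfl
  have e : closedStalkMap G F = G.spTensor h ∘ κ := by
    funext z
    induction z using Tensor.ind with
    | H a m => rfl
  rw [e]
  exact (hG h).comp hκ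

variable {G} in
/-- The element of the stalk of `G(closed P)^~` given by an element of a stalk of `G`. -/
def closedStalkInv (hG : G.IsCartesian) (F : Spec P) :
    G.stalk F → Tensor (toStalk F) (closedStalk G) :=
  Function.surjInv (closedStalkMap_bijective hG F).2

variable {G} (hG : G.IsCartesian)

lemma closedStalkMap_closedStalkInv (F : Spec P) (m : G.stalk F) :
    closedStalkMap G F (closedStalkInv hG F m) = m :=
  Function.surjInv_eq (closedStalkMap_bijective hG F).2 m

lemma closedStalkInv_bijective (F : Spec P) : Function.Bijective (closedStalkInv hG F) :=
  Function.bijective_iff_has_inverse.2 ⟨closedStalkMap G F, closedStalkMap_closedStalkInv hG F,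
    fun _ => (closedStalkMap_bijective hG F).1 (closedStalkMap_closedStalkInv hG F _)⟩

lemma tildePred_closedStalkInv {U : Opens (Spec P)} (s : G.presheaf.obj (op U)) :
    (tildePred (closedStalk G)).sheafify.pred (U := U)
      (fun F => closedStalkInv hG F.1 (G.germ F.1 F.2 s)) := by
  intro F
  obtain ⟨z, hz⟩ : ∃ z, z = closedStalkInv hG F.1 (G.germ F.1 F.2 s) := ⟨_, rfl⟩
  have e := (congrArg (closedStalkMap G F.1) hz).trans (closedStalkMap_closedStalkInv hG F.1 _)
  induction z using Tensor.ind with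
  | H a m =>
    obtain ⟨V, hV, a, rfl⟩ := (Spec P).exists_germ F.1 a
    obtain ⟨V', hV', t, ht⟩ := G.exists_germ (closed P) m
    -- An open set containing the closed point is the whole space, so the representative t of m is
    -- defined everywhere.
    have hVV : ∀ F : Spec P, F ∈ V' := fun F => (specializes_closedPoint F).mem_open V'.isOpen hV'
    have hsp : ∀ F : Spec P, G.sp (specializes_closedPoint F) m = G.germ F (hVV F) t := fun F =>
      (congrArg _ ht.symm).trans (Modules.sp_germ G (specializes_closedPoint F) hV' t)
    let i : V ⟶ V' := homOfLE fun F _ => hVV F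
    have e' : G.germ F.1 hV (a • G.presheaf.map i.op t) = G.germ F.1 F.2 s := by
      refine (germ_smul G F.1 hV _ _).trans (Eq.trans ?_ e)
      exact congrArg ((Spec P).germ F.1 hV a • ·) ((G.germ_map i F.1 hV t).trans (hsp F.1).symm)
    obtain ⟨W, hW, j, k, e''⟩ := (G.germ_eq_iff _ _ _ _ _).1 e'
    refine ⟨W, hW, k, (Spec P).str.map j.op a, m, fun H => ?_⟩
    refine (closedStalkMap_bijective hG H.1).1 ?_
    refine (closedStalkMap_closedStalkInv hG H.1 _).trans ?_
    refine (G.germ_map k H.1 H.2 s).symm.trans ((congrArg (G.germ H.1 H.2) e''.symm).trans ?_)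
    refine (G.germ_map j H.1 H.2 _).trans ((germ_smul G H.1 (j.le H.2) _ _).trans ?_)
    exact congrArg₂ (· • ·) ((Spec P).germ_map j H.1 H.2 a).symm
      ((G.germ_map i H.1 (j.le H.2) t).trans (hsp H.1).symm)

/-- The map from a cartesian module to the module given by its stalk at the closed point. -/
def toTilde : G ⟶ tilde (closedStalk G) where
  hom :=
    { app := fun U => ↾ fun s => ⟨fun F => closedStalkInv hG F.1 (G.germ (U := U.unop) F.1 F.2 s),
        tildePred_closedStalkInv hG (U := U.unop) s⟩
      naturality := fun U V i => by
        refine ConcreteCategory.hom_ext _ _ fun s => Subtype.ext (funext fun F => ?_)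
        exact congrArg (closedStalkInv hG F.1) (G.germ_map i.unop F.1 F.2 s) }
  map_smul U a s := Subtype.ext (funext fun F => (closedStalkMap_bijective hG F.1).1 (by
    refine (closedStalkMap_closedStalkInv hG F.1 _).trans ?_
    refine Eq.trans ?_ (closedStalkMap_smul G F.1 ((Spec P).germ (U := U.unop) F.1 F.2 a)
      (closedStalkInv hG F.1 (G.germ (U := U.unop) F.1 F.2 s))).symm
    rw [closedStalkMap_closedStalkInv]
    exact germ_smul G (U := U.unop) F.1 F.2 a s))

lemma isIso_toTilde : IsIso (toTilde hG) := by
  refine isIso_of_stalkMap_bijective _ fun F => ?_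
  refine (Function.Bijective.of_comp_iff' (tildeVal_bijective (closedStalk G) F) _).1 ?_
  convert closedStalkInv_bijective hG F
  funext m
  obtain ⟨U, hU, s, rfl⟩ := G.exists_germ F m
  exact (congrArg (tildeVal (closedStalk G) F) (stalkMap_germ (toTilde hG) F hU s)).trans
    (tildeVal_germ (closedStalk G) hU _)

end
end Spec

/-- An equivalence restricts to an equivalence of full subcategories. -/
lemma isEquivalence_lift {C D : Type*} [Category C] [Category D] (F : C ⥤ D) [F.IsEquivalence]
    (p : ObjectProperty C) (q : ObjectProperty D) [q.IsClosedUnderIsomorphisms]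
    (h : ∀ M : C, p M ↔ q (F.obj M)) :
    (ObjectProperty.lift q (p.ι ⋙ F) (fun M => (h M.obj).1 M.property)).IsEquivalence where
  faithful := inferInstance
  full := inferInstance
  essSurj := ⟨fun D => by
    have e := F.objObjPreimageIso D.obj
    refine ⟨⟨F.objPreimage D.obj, (h _).2 (q.prop_of_iso e.symm D.property)⟩, ⟨?_⟩⟩
    exact q.ι.preimageIso e⟩

/-! ### Descent of quasi-coherent modules -/

namespace LMS
open Modules
variable {X Y : LMS.{u}}

/-- On a locally finite type fan the quasi-coherent modules are the cartesian ones. -/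
lemma IsLocFinTypeFan.isQCoh_iff (hX : X.IsLocFinTypeFan) (F : X.Modules) :
    F.IsQCoh ↔ F.IsCartesian := by
  constructor
  · refine fun hF => IsCartesian.of_forall_exists_isOpenEmbedding fun x => ?_
    obtain ⟨P, _, j, M, hj, hx, ⟨e⟩⟩ := hF x
    exact ⟨Spec P, j, hj, hx, IsCartesian.of_iso e.symm (Spec.isCartesian_tilde M)⟩
  · intro hF x
    obtain ⟨P, _, j, hP, hj, hx⟩ := hX x
    -- On an affine chart a cartesian module is the one associated with its stalk at the closed
    -- point, so any affine cover of the fan serves.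
    have := Spec.isIso_toTilde (hF.pullback j)
    exact ⟨P, _, j, _, hj, hx, ⟨@asIso _ _ _ _ (Spec.toTilde (hF.pullback j)) this⟩⟩

lemma IsLocFinTypeFan.isQCoh_of_iso (hX : X.IsLocFinTypeFan) {F G : X.Modules} (e : F ≅ G)
    (hF : F.IsQCoh) : G.IsQCoh :=
  (hX.isQCoh_iff G).2 (IsCartesian.of_iso e ((hX.isQCoh_iff F).1 hF))

/-- Quasi-coherence is preserved and reflected by the pullback along a flat cover. -/
lemma IsFlatCover.isQCoh_pullback_iff {f : X ⟶ Y} (hX : X.IsLocFinTypeFan) (hY : Y.IsLocFinTypeFan)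
    (hf : IsFlatCover f) (M : Y.Modules) : M.IsQCoh ↔ ((Modules.pullback f).obj M).IsQCoh := by
  refine (hY.isQCoh_iff M).trans (Iff.trans ?_ (hX.isQCoh_iff _).symm)
  exact ⟨fun h => IsCartesian.pullback f h, fun h => IsCartesian.of_pullback (hf.isDescentMap hX hY) h⟩

variable {f : X ⟶ Y}

lemma IsLocFinTypeFan.isClosedUnderIsomorphisms (hX : X.IsLocFinTypeFan) :
    ObjectProperty.IsClosedUnderIsomorphisms (fun D : ModDescent f => D.sheaf.IsQCoh) :=
  ⟨fun {D E} e h => hX.isQCoh_of_iso (F := D.sheaf) (G := E.sheaf)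
    { hom := e.hom.hom ()
      inv := e.inv.hom ()
      hom_inv_id := congrArg (fun φ : D ⟶ D => φ.hom ()) e.hom_inv_id
      inv_hom_id := congrArg (fun φ : E ⟶ E => φ.hom ()) e.inv_hom_id } h⟩

lemma IsLocFinTypeFan.isClosedUnderIsomorphisms_fibre (hX : X.IsLocFinTypeFan)
    (sq : Limits.ChosenPullback f f) (sq₃ : Limits.ChosenPullback₃ sq sq sq) :
    ObjectProperty.IsClosedUnderIsomorphisms
      (fun D : ModFibreDescent sq sq₃ => D.sheaf.IsQCoh) :=
  ⟨fun {D E} e h => hX.isQCoh_of_iso (F := D.sheaf) (G := E.sheaf)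
    { hom := e.hom.hom ()
      inv := e.inv.hom ()
      hom_inv_id := congrArg (fun φ : D ⟶ D => φ.hom ()) e.hom_inv_id
      inv_hom_id := congrArg (fun φ : E ⟶ E => φ.hom ()) e.inv_hom_id } h⟩

/-- Descent of quasi-coherent modules along a flat cover. -/
theorem IsFlatCover.toQCohDescent_isEquivalence (hX : X.IsLocFinTypeFan) (hY : Y.IsLocFinTypeFan)
    (hf : IsFlatCover f) (H : ∀ M : Y.Modules, M.IsQCoh → ((Modules.pullback f).obj M).IsQCoh) :
    (toQCohDescent f H).IsEquivalence := by
  have := (hf.isDescentMap hX hY).toModDescent_isEquivalence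
  have := hX.isClosedUnderIsomorphisms (f := f)
  exact isEquivalence_lift (toModDescent f) (fun F : Y.Modules => F.IsQCoh)
    (fun D : ModDescent f => D.sheaf.IsQCoh) (hf.isQCoh_pullback_iff hX hY)

/-- Descent of quasi-coherent modules along a flat cover, with descent data on fibre products. -/
theorem IsFlatCover.toQCohFibreDescent_isEquivalence (hX : X.IsLocFinTypeFan)
    (hY : Y.IsLocFinTypeFan) (hf : IsFlatCover f)
    (H : ∀ M : Y.Modules, M.IsQCoh → ((Modules.pullback f).obj M).IsQCoh)
    (sq : Limits.ChosenPullback f f) (sq₃ : Limits.ChosenPullback₃ sq sq sq) :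
    (toQCohFibreDescent sq sq₃ H).IsEquivalence := by
  have := (hf.isDescentMap hX hY).toModDescent_isEquivalence
  have := hX.isClosedUnderIsomorphisms_fibre sq sq₃
  -- Descent data on all T and on the chosen fibre products form equivalent categories; the functor
  -- in question is `toModDescent` followed by this equivalence.
  have : (Pseudofunctor.DescentData'.fromDescentDataFunctor Modules.pseudofunctor.{u}
      (f := fun _ : Unit => f) (fun _ _ => sq) (fun _ _ _ => sq₃)).IsEquivalence :=
    (Pseudofunctor.DescentData'.descentDataEquivalence _ _ _).isEquivalence_inverse
  have : (toModFibreDescent sq sq₃).IsEquivalence := Functor.isEquivalence_trans _ _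
  exact isEquivalence_lift (toModFibreDescent sq sq₃) (fun F : Y.Modules => F.IsQCoh)
    (fun D : ModFibreDescent sq sq₃ => D.sheaf.IsQCoh) (hf.isQCoh_pullback_iff hX hY)

end LMS
end MonoidFan

end

theorem mainTheorem4 :
    (∀ (Q P : Type u) [CommMonoid Q] [CommMonoid P] (h : Q →* P),
      MonoidFan.LMS.IsFlatCover (MonoidFan.Spec.map h) →
        ∃ e : MonoidFan.PMod Q ≌ MonoidFan.DescentMod h,
          e.functor = MonoidFan.tautDescent h ∧ e.inverse = MonoidFan.descend h) ∧
    (∀ (X Y : MonoidFan.LMS.{u}) (f : X ⟶ Y),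
      X.IsLocFinTypeFan → Y.IsLocFinTypeFan → MonoidFan.LMS.IsFlatCover f →
        ∃ hf : ∀ M : Y.Modules, M.IsQCoh → ((MonoidFan.LMS.Modules.pullback f).obj M).IsQCoh,
          (MonoidFan.LMS.toQCohDescent f hf).IsEquivalence ∧
          ∀ (sq : Limits.ChosenPullback f f) (sq₃ : Limits.ChosenPullback₃ sq sq sq),
            (MonoidFan.LMS.toQCohFibreDescent sq sq₃ hf).IsEquivalence) := by
  refine ⟨fun Q P _ _ h hh => ⟨hh.isEqFaithfullyFlat.descentEquivalence, rfl, rfl⟩, ?_⟩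
  intro X Y f hX hY hf
  have H := fun M : Y.Modules => (hf.isQCoh_pullback_iff hX hY M).1
  exact ⟨H, hf.toQCohDescent_isEquivalence hX hY H,
    hf.toQCohFibreDescent_isEquivalence hX hY H⟩
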